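/- **Setting.** For $i=1,\dots,n$ let $A^i,B^i$ be Hilbert spaces; put $A=\bigotimes_i A^i$, $B=\bigotimes_i B^i$, $H=A\otimes B$, and for $I\subseteq\{1,\dots,n\}$ put $A^I=\bigotimes_{i\in I}A^i$, $B^I=\bigotimes_{i\in I}B^i$. Operators on some of the tensor factors are extended to the others by the identity. Attach to every $A^i$ and every $B^i$ a logical qubit $A^i_c=B^i_c=\mathbb{C}^2$, and put $A_c^I=\bigotimes_{i\in I}A_c^i$, $B_c^I=\bigotimes_{i\in I}B_c^i$, $A_c=\bigotimes_i A_c^i$, $B_c=\bigotimes_i B_c^i$, $H_c=A_c\otimes B_c$. Let $\mathcal{U}(\cdot)$ denote unitary transformations and $\mathcal{O}(\cdot)$ those with real entries in the canonical basis. Let $\mathcal{A}_0=\{0,\frac\pi8,\frac\pi4\}$, $\mathcal{A}=\mathcal{A}_0\cup(\mathcal{A}_0+\frac\pi2)$ and $|a\rangle=\cos a\,|0\rangle+\sin a\,|1\rangle$. For every $i$ let $(P_{A^i}^a)_{a\in\mathcal{A}}$ and $(P_{B^i}^b)_{b\in\mathcal{A}}$ be orthogonal projectors on $A^i$ and $B^i$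 with $P_{A^i}^{a}+P_{A^i}^{a+\pi/2}=\mathrm{Id}$ and $P_{B^i}^{a}+P_{B^i}^{a+\pi/2}=\mathrm{Id}$ for $a\in\mathcal{A}_0$. For $a\in\mathcal{A}^I$ put $P_{A^I}^a=\bigotimes_{i\in I}P_{A^i}^{a^i}$ and $|a\rangle=\bigotimes_{i\in I}|a^i\rangle$; similarly for $B$. For $I=\{1,\dots,n\}$ write $P_A^a,P_B^b$. Let $|\phi^+\rangle=\frac1{\sqrt2}(|00\rangle+|11\rangle)$ and $|\Phi^+\rangle_I=2^{-|I|/2}\sum_{x\in\{0,1\}^I}|x\rangle\otimes|x\rangle\in A_c^I\otimes B_c^I$. *Simulation.* A vector $\psi$ simulates a logical state $\phi$ with respect to projectors $(P^w)_w$ labelled by logical states $|w\rangle$ if $\|P^w\psi\|^2=|\langle w|\phi\rangle|^2$ for every $w$. The label $(a,b)$ stands for $|a\rangle\otimes|b\rangle$. *Tensor equivalence.* Let $\mathbb{I}_H:H\to H_c\otimes H$, $\psi\mapsto|0\cdots0\rangle\otimes\psi$, and $\mathbb{P}_H=\mathbb{I}_H^\dagger$. For $U\in\mathcal{U}(H_c\otimes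 H)$, a subspace $S\subseteq H$ is $U$-equivalent to $H_c$ if, for all $w=(a,b)\in\mathcal{A}^n\times\mathcal{A}^n$ and $\psi\in S$, $(P_A^a\otimes P_B^b)\psi=\mathbb{P}_HU^\dagger(|w\rangle\langle w|\otimes\mathrm{Id}_H)U\,\mathbb{I}_H\psi$. A transformation $G\in\mathcal{U}(H)$ is tensor equivalent to $T\in\mathcal{U}(H_c)$ on $S$ if there are $U,V\in\mathcal{U}(H_c\otimes H)$, each of the form $\bigotimes_i U_{A^i}\otimes\bigotimes_i U_{B^i}$ with $U_{A^i}\in\mathcal{U}(A^i_c\otimes A^i)$ and $U_{B^i}\in\mathcal{U}(B^i_c\otimes B^i)$, such that $S$ is $U$-equivalent to $H_c$, $G(S)$ is $V$-equivalent to $H_c$, and for some $W\in\mathcal{U}(H)$ (not required to be a tensor product) $\mathbb{I}_HG\psi=V^\dagger(T\otimes W)U\,\mathbb{I}_H\psi$ for all $\psi\in S$. **Theorem.** Let $I^1,\dots,I^t\subseteq\{1,\dots,n\}$, $G_A^j\in\mathcal{U}(A^{I^j})$, $G_B^j\in\mathcal{U}(B^{I^j})$ and $T^j\in\mathcal{O}(A_c^{I^j})$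 for $j=1,\dots,t$. Let $\Psi\in A\otimes B$ be a state (a unit vector). Put $\Psi^0=\Psi$, $\Psi'^j=(G_A^j\otimes\mathrm{Id}_B)\Psi^{j-1}$ and $\Psi^j=(G_A^j\otimes G_B^j)\Psi^{j-1}$ for $j=1,\dots,t$. Assume: 1. for every $i=1,\dots,n$, $\Psi$ simulates $|\phi^+\rangle$ with respect to $(P_{A^i}^{a}\otimes P_{B^i}^{b})_{a,b\in\mathcal{A}}$; 2. for every $j=1,\dots,t$ and every $i\in I^j$, $\Psi^j$ simulates $|\phi^+\rangle$ with respect to $(P_{A^i}^{a}\otimes P_{B^i}^{b})_{a,b\in\mathcal{A}}$; 3. for every $j=1,\dots,t$, $\Psi'^j$ simulates $(T^j\otimes\mathrm{Id})|\Phi^+\rangle_{I^j}$ with respect to $(P_{A^{I^j}}^{a}\otimes P_{B^{I^j}}^{b})_{a,b\in\mathcal{A}^{I^j}}$. Then $G_A^tG_A^{t-1}\cdots G_A^1$ (extended by $\mathrm{Id}_B$) is tensor equivalent to $T^tT^{t-1}\cdots T^1$ (extended by $\mathrm{Id}_{B_c}$) on $S=\mathrm{span}\{(P_A^a\otimes P_B^b)\Psi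 : a,b\in\mathcal{A}^n\}$. -/

import Mathlib

noncomputable section

namespace SelfTest

/-! ## Hilbert spaces, tensor products and operators -/

/-- The Hilbert space with orthonormal basis indexed by `X` (an arbitrary, possibly infinite,
type), realised as `ℓ²(X, ℂ)`. The Hilbert space tensor product of `Hilb X` and `Hilb Y` is
`Hilb (X × Y)`, and that of a finite family `Hilb (α i)` is `Hilb (∀ i, α i)`. -/
abbrev Hilb (X : Type*) : Type _ := lp (fun _ : X => ℂ) 2

/-- Bounded operators on `Hilb X`. -/
abbrev Op (X : Type*) : Type _ := Hilb X →L[ℂ] Hilb X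

/-- The group of unitary transformations of `Hilb X`. -/
abbrev Uni (X : Type*) : Type _ := unitary (Op X)

theorem hilb_summable {X : Type*} (ψ : Hilb X) : Summable fun x => ‖ψ x‖ ^ 2 := by
  have h := (lp.memℓp ψ).summable (by norm_num)
  simpa using h

theorem hilb_memℓp {X : Type*} {f : X → ℂ} (h : Summable fun x => ‖f x‖ ^ 2) :
    Memℓp (E := fun _ : X => ℂ) f 2 := by
  apply memℓp_gen
  simpa using h

theorem hilb_norm_sq {X : Type*} (ψ : Hilb X) : ‖ψ‖ ^ 2 = ∑' x, ‖ψ x‖ ^ 2 := by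
  have h := lp.norm_rpow_eq_tsum (p := 2) (by norm_num) ψ
  simpa using h

/-- `⟨y|ψ⟩`, the vector of `Hilb X` with coordinates `x ↦ ψ (x, y)`, for a vector `ψ` of a space
`Hilb K` that is decomposed as `Hilb X ⊗ Hilb Y` by `e`. -/
def slice {K X Y : Type*} (e : K ≃ X × Y) (y : Y) (ψ : Hilb K) : Hilb X :=
  ⟨fun x => ψ (e.symm (x, y)), hilb_memℓp
    ((hilb_summable ψ).comp_injective
      (i := fun x => e.symm (x, y)) fun _ _ h => congrArg Prod.fst (e.symm.injective h))⟩

theorem slice_apply {K X Y : Type*} (e : K ≃ X × Y) (y : Y) (ψ : Hilb K) (x : X) :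
    slice e y ψ x = ψ (e.symm (x, y)) := rfl

theorem slice_norm_hasSum {K X Y : Type*} (e : K ≃ X × Y) (ψ : Hilb K) :
    HasSum (fun y => ‖slice e y ψ‖ ^ 2) (‖ψ‖ ^ 2) := by
  have hs : Summable fun p : Y × X => ‖ψ (e.symm (p.2, p.1))‖ ^ 2 :=
    (hilb_summable ψ).comp_injective
      (i := fun p : Y × X => e.symm (p.2, p.1))
      (((Equiv.prodComm Y X).trans e.symm).injective)
  have h1 : ∑' p : Y × X, ‖ψ (e.symm (p.2, p.1))‖ ^ 2 = ‖ψ‖ ^ 2 := by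
    rw [hilb_norm_sq]
    exact ((Equiv.prodComm Y X).trans e.symm).tsum_eq (fun k => ‖ψ k‖ ^ 2)
  have h2 : (fun y => ‖slice e y ψ‖ ^ 2)
      = fun y => ∑' x, ‖ψ (e.symm (x, y))‖ ^ 2 := by
    funext y
    rw [hilb_norm_sq]
    rfl
  rw [h2, ← h1]
  exact hs.hasSum.prod_fiberwise fun y => (hs.prod_factor y).hasSum

theorem ampl_summable {K X Y : Type*} (e : K ≃ X × Y) (g : Op X) (ψ : Hilb K) :
    Summable fun p : Y × X => ‖g (slice e p.1 ψ) p.2‖ ^ 2 := by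
  refine (summable_prod_of_nonneg fun p => by positivity).2 ⟨fun y => ?_, ?_⟩
  · exact hilb_summable (g (slice e y ψ))
  · refine Summable.of_nonneg_of_le (fun y => tsum_nonneg fun x => by positivity) (fun y => ?_)
      ((slice_norm_hasSum e ψ).summable.mul_left (‖g‖ ^ 2))
    have h := g.le_opNorm (slice e y ψ)
    have h3 : ∑' x, ‖g (slice e y ψ) x‖ ^ 2 = ‖g (slice e y ψ)‖ ^ 2 := (hilb_norm_sq _).symm
    calc ∑' x, ‖g (slice e y ψ) x‖ ^ 2 = ‖g (slice e y ψ)‖ ^ 2 := h3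
      _ ≤ (‖g‖ * ‖slice e y ψ‖) ^ 2 := by gcongr
      _ = ‖g‖ ^ 2 * ‖slice e y ψ‖ ^ 2 := by ring

theorem ampl_summable' {K X Y : Type*} (e : K ≃ X × Y) (g : Op X) (ψ : Hilb K) :
    Summable fun k : K => ‖g (slice e (e k).2 ψ) (e k).1‖ ^ 2 :=
  (ampl_summable e g ψ).comp_injective
    (i := fun k => ((e k).2, (e k).1)) (e.trans (Equiv.prodComm X Y)).injective

theorem ampl_norm_le {K X Y : Type*} (e : K ≃ X × Y) (g : Op X) (ψ : Hilb K) :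
    ‖(⟨fun k => g (slice e (e k).2 ψ) (e k).1, hilb_memℓp (ampl_summable' e g ψ)⟩ : Hilb K)‖
      ≤ ‖g‖ * ‖ψ‖ := by
  refine le_of_sq_le_sq ?_ (by positivity)
  rw [hilb_norm_sq]
  have h1 : ∑' k : K, ‖g (slice e (e k).2 ψ) (e k).1‖ ^ 2
      = ∑' p : Y × X, ‖g (slice e p.1 ψ) p.2‖ ^ 2 :=
    (e.trans (Equiv.prodComm X Y)).tsum_eq (fun p : Y × X => ‖g (slice e p.1 ψ) p.2‖ ^ 2)
  have h2 : ∑' p : Y × X, ‖g (slice e p.1 ψ) p.2‖ ^ 2 = ∑' y, ‖g (slice e y ψ)‖ ^ 2 := by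
    rw [(ampl_summable e g ψ).tsum_prod]
    congr 1
    funext y
    rw [hilb_norm_sq]
  have h3 : ∀ y, ‖g (slice e y ψ)‖ ^ 2 ≤ ‖g‖ ^ 2 * ‖slice e y ψ‖ ^ 2 := by
    intro y
    rw [← mul_pow]
    gcongr
    exact g.le_opNorm _
  have hs := (slice_norm_hasSum e ψ).mul_left (‖g‖ ^ 2)
  have hs' : Summable fun y => ‖g (slice e y ψ)‖ ^ 2 :=
    Summable.of_nonneg_of_le (fun y => by positivity) h3 hs.summable
  calc ∑' k : K, ‖g (slice e (e k).2 ψ) (e k).1‖ ^ 2 = ∑' y, ‖g (slice e y ψ)‖ ^ 2 := h1.trans h2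
    _ ≤ ∑' y, ‖g‖ ^ 2 * ‖slice e y ψ‖ ^ 2 := hs'.tsum_le_tsum h3 hs.summable
    _ = (‖g‖ * ‖ψ‖) ^ 2 := by rw [hs.tsum_eq]; ring

/-- The extension `g ⊗ Id` of the operator `g` on `Hilb X` to a space `Hilb K` that is decomposed
as `Hilb X ⊗ Hilb Y` by `e`: it acts by `g` on every slice. -/
def ampl {K X Y : Type*} (e : K ≃ X × Y) (g : Op X) : Op K :=
  LinearMap.mkContinuous
    { toFun := fun ψ =>
        (⟨fun k => g (slice e (e k).2 ψ) (e k).1, hilb_memℓp (ampl_summable' e g ψ)⟩ : Hilb K)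
      map_add' := by
        intro ψ φ
        ext k
        have h : slice e (e k).2 (ψ + φ) = slice e (e k).2 ψ + slice e (e k).2 φ := by
          ext x; rfl
        change g (slice e (e k).2 (ψ + φ)) (e k).1 = _
        rw [h, map_add]
        rfl
      map_smul' := by
        intro c ψ
        ext k
        have h : slice e (e k).2 (c • ψ) = c • slice e (e k).2 ψ := by
          ext x; rfl
        change g (slice e (e k).2 (c • ψ)) (e k).1 = _
        rw [h, map_smul]
        rfl }
    ‖g‖ (ampl_norm_le e g)

theorem ampl_apply {K X Y : Type*} (e : K ≃ X × Y) (g : Op X) (ψ : Hilb K) (k : K) :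
    ampl e g ψ k = g (slice e (e k).2 ψ) (e k).1 := rfl

/-- `S ⊗ Id` on `Hilb X ⊗ Hilb Y`. -/
def onLeft {X Y : Type*} (S : Op X) : Op (X × Y) := ampl (Equiv.refl (X × Y)) S

/-- `Id ⊗ T` on `Hilb X ⊗ Hilb Y`. -/
def onRight {X Y : Type*} (T : Op Y) : Op (X × Y) := ampl (Equiv.prodComm X Y) T

/-- `S ⊗ T = (S ⊗ Id) (Id ⊗ T)` on `Hilb X ⊗ Hilb Y`. -/
def tensorOp {X Y : Type*} (S : Op X) (T : Op Y) : Op (X × Y) := onLeft S * onRight T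

/-- The operator on `⨂ i, Hilb (α i)` that acts as `g` on the `i`-th factor and as the identity
on the other factors. -/
def onFactor {n : ℕ} {α : Fin n → Type*} (i : Fin n) (g : Op (α i)) : Op (∀ i, α i) :=
  ampl (Equiv.piSplitAt i α) g

/-- The operator on `⨂ i, Hilb (α i)` that acts as `g` on the factors in `I` and as the identity
on the other factors. -/
def onSubset {n : ℕ} {α : Fin n → Type*} (I : Finset (Fin n)) (g : Op (∀ i : I, α i)) :
    Op (∀ i, α i) :=
  ampl (Equiv.piEquivPiSubtypeProd (fun i => i ∈ I) α) g

/-- `⨂ i, g i` on `⨂ i, Hilb (α i)`, as the product of the (commuting) operators acting as `g i` on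
the `i`-th factor. -/
def piOp {n : ℕ} {α : Fin n → Type*} (g : ∀ i, Op (α i)) : Op (∀ i, α i) :=
  (List.ofFn fun i => onFactor i (g i)).prod

/-- `⨂ i ∈ I, g i`, extended by the identity on the factors outside `I`. -/
def piOpOn {n : ℕ} {α : Fin n → Type*} (I : Finset (Fin n)) (g : ∀ i : I, Op (α i)) :
    Op (∀ i, α i) :=
  piOp fun i => if h : i ∈ I then g ⟨i, h⟩ else 1

/-- The ordered product `g (j - 1) ⋯ g 1 g 0` of the first `j` operators of a list of `t`. -/
def compUpTo {X : Type*} {t : ℕ} (g : Fin t → Op X) (j : Fin (t + 1)) : Op X :=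
  Fin.induction (motive := fun _ => Op X) 1 (fun k M => g k * M) j

/-! ## Qubits -/

/-- The vector with given coordinates in a finite dimensional space. -/
def ofCoords {X : Type*} [Finite X] (f : X → ℂ) : Hilb X := ⟨f, Memℓp.all f⟩

/-- The one-qubit state `|a⟩ = cos a |0⟩ + sin a |1⟩`. -/
def qubitCoords (a : ℝ) : Fin 2 → ℂ := ![(Real.cos a : ℂ), (Real.sin a : ℂ)]

/-- The state `|a⟩ ⊗ |b⟩` of two qubits. -/
def pairKet (a b : ℝ) : Hilb (Fin 2 × Fin 2) :=
  ofCoords fun p => qubitCoords a p.1 * qubitCoords b p.2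

/-- The state `(⨂ i, |a i⟩) ⊗ (⨂ i, |b i⟩)` of two qubit registers indexed by `J`. -/
def registerKet {J : Type*} [Fintype J] (a b : J → ℝ) : Hilb ((J → Fin 2) × (J → Fin 2)) :=
  ofCoords fun p => (∏ i, qubitCoords (a i) (p.1 i)) * ∏ i, qubitCoords (b i) (p.2 i)

/-- The state `|X|^{-1/2} ∑ x, |x⟩ ⊗ |x⟩`. For `X = Fin 2` this is the EPR state `|φ⁺⟩`, and for
`X = (J → Fin 2)` it is the state `|Φ⁺⟩` of `|J|` EPR pairs. -/
def maxEntangled (X : Type*) [Fintype X] [DecidableEq X] : Hilb (X × X) :=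
  ofCoords fun p => if p.1 = p.2 then ((1 / Real.sqrt (Fintype.card X) : ℝ) : ℂ) else 0

/-- The operator has real entries in the canonical basis. The unitary transformations with this
property are the orthogonal transformations. -/
def IsRealOp {X : Type*} [DecidableEq X] (T : Op X) : Prop :=
  ∀ x y, (T (lp.single 2 y (1 : ℂ)) x).im = 0

/-- The angles `{0, π/8, π/4}`. -/
def angles₀ : Set ℝ := {0, Real.pi / 8, Real.pi / 4}

/-- The angles `a` and `a + π/2`, for `a ∈ {0, π/8, π/4}`. -/
def angles : Set ℝ := angles₀ ∪ (fun a => a + Real.pi / 2) '' angles₀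

/-- `(P a, P (a + π/2))` is an orthogonal measurement for every `a ∈ {0, π/8, π/4}`. The values of
`P` at other angles are never used. -/
structure IsMeasurementFamily {X : Type*} (P : ℝ → Op X) : Prop where
  proj : ∀ a ∈ angles, IsStarProjection (P a)
  add_eq_one : ∀ a ∈ angles₀, P a + P (a + Real.pi / 2) = 1

/-! ## Simulation -/

/-- `ψ ∈ Hilb K` simulates `φ ∈ Hilb N` with respect to the projectors `P w`, where the label `w`
stands for the state `ket w` on the logical side. -/
def Simulates {W K N : Type*} (P : W → Op K) (ket : W → Hilb N) (ψ : Hilb K) (φ : Hilb N) : Prop :=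
  ∀ w, ‖P w ψ‖ ^ 2 = ‖inner ℂ (ket w) φ‖ ^ 2

/-! ## Equivalence

The physical space is `H = Hilb K`, the logical space is `H_c = Hilb N` and `H_c ⊗ H` is
`Hilb (N × K)`. The element `o : N` is the label of the basis vector `|0⟩` of `H_c`. -/

theorem embed_summable {N K : Type*} [DecidableEq N] (o : N) (ψ : Hilb K) :
    Summable fun p : N × K => ‖if p.1 = o then ψ p.2 else 0‖ ^ 2 := by
  refine (Function.Injective.summable_iff (g := fun k : K => (o, k))
    (fun _ _ h => congrArg Prod.snd h) ?_).1 ?_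
  · rintro ⟨c, k⟩ h
    have hc : c ≠ o := by
      rintro rfl
      exact h ⟨k, rfl⟩
    simp [hc]
  · simpa [Function.comp_def] using hilb_summable ψ

/-- The embedding `ψ ↦ |0⟩ ⊗ ψ` of `H` into `H_c ⊗ H`. -/
def embed {N K : Type*} [DecidableEq N] (o : N) (ψ : Hilb K) : Hilb (N × K) :=
  ⟨fun p => if p.1 = o then ψ p.2 else 0, hilb_memℓp (embed_summable o ψ)⟩

/-- The reverse operation `ψ ↦ (⟨0| ⊗ Id) ψ` from `H_c ⊗ H` to `H`. -/
def unembed {N K : Type*} (o : N) (ψ : Hilb (N × K)) : Hilb K :=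
  slice (Equiv.prodComm N K) o ψ

/-- The subspace `S` of `H` is `U`-equivalent to `H_c`: for every label `w`, the projector `P w`
coincides on `S` with `ψ ↦ (⟨0| ⊗ Id) U† (|w⟩⟨w| ⊗ Id) U (|0⟩ ⊗ ψ)`. -/
def SubspaceEquiv {W N K : Type*} [DecidableEq N] (o : N) (P : W → Op K) (ket : W → Hilb N)
    (U : Uni (N × K)) (S : Submodule ℂ (Hilb K)) : Prop :=
  ∀ w, ∀ ψ ∈ S, P w ψ =
    unembed o ((star U : Uni (N × K)).1
      (onLeft (InnerProductSpace.rankOne ℂ (ket w) (ket w)) (U.1 (embed o ψ))))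

/-- The transformation `G` of `H` is `(U, V)`-equivalent to the transformation `T` of `H_c`
on `S`. -/
def GateEquiv {W N K : Type*} [DecidableEq N] (o : N) (P : W → Op K) (ket : W → Hilb N)
    (U V : Uni (N × K)) (G : Op K) (T : Op N) (S : Submodule ℂ (Hilb K)) : Prop :=
  SubspaceEquiv o P ket U S ∧
  SubspaceEquiv o P ket V (S.map (G : Hilb K →ₗ[ℂ] Hilb K)) ∧
  ∃ R : Uni K, ∀ ψ ∈ S,
    embed o (G ψ) = (star V : Uni (N × K)).1 (tensorOp T R.1 (U.1 (embed o ψ)))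

/-! ## Tensor equivalence on `⨂ i, (A i ⊗ B i)`, with one logical qubit for every factor -/

/-- The canonical identification of the basis of `(A_c ⊗ B_c) ⊗ (A ⊗ B)` with that of
`(⨂ i, (ℂ² ⊗ A i)) ⊗ (⨂ i, (ℂ² ⊗ B i))`. -/
def regroup {n : ℕ} (α β : Fin n → Type*) :
    ((Fin n → Fin 2) × (Fin n → Fin 2)) × ((∀ i, α i) × (∀ i, β i)) ≃
      (∀ i, Fin 2 × α i) × (∀ i, Fin 2 × β i) where
  toFun p := (fun i => (p.1.1 i, p.2.1 i), fun i => (p.1.2 i, p.2.2 i))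
  invFun q := ((fun i => (q.1 i).1, fun i => (q.2 i).1), (fun i => (q.1 i).2, fun i => (q.2 i).2))
  left_inv _ := rfl
  right_inv _ := rfl

/-- `U = (⨂ i, UA i) ⊗ (⨂ i, UB i)` for some unitary transformations `UA i` of `ℂ² ⊗ A i` and
`UB i` of `ℂ² ⊗ B i`. -/
def IsTensorUnitary {n : ℕ} {α β : Fin n → Type*}
    (U : Uni (((Fin n → Fin 2) × (Fin n → Fin 2)) × ((∀ i, α i) × (∀ i, β i)))) : Prop :=
  ∃ (UA : ∀ i, Uni (Fin 2 × α i)) (UB : ∀ i, Uni (Fin 2 × β i)),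
    U.1 = ampl ((regroup α β).trans (Equiv.prodPUnit.{0} _).symm)
      (tensorOp (piOp fun i => (UA i).1) (piOp fun i => (UB i).1))

/-- `G` is tensor equivalent to `T` on `S`: it is `(U, V)`-equivalent to `T` on `S` with respect to
the projectors `P_A^a ⊗ P_B^b` for some unitary transformations `U` and `V` that are tensor
products over all the factors `A i` and `B i`. -/
def TensorEquiv {n : ℕ} {α β : Fin n → Type*}
    (PA : ∀ i, ℝ → Op (α i)) (PB : ∀ i, ℝ → Op (β i))
    (G : Op ((∀ i, α i) × (∀ i, β i))) (T : Op ((Fin n → Fin 2) × (Fin n → Fin 2)))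
    (S : Submodule ℂ (Hilb ((∀ i, α i) × (∀ i, β i)))) : Prop :=
  ∃ U V : Uni (((Fin n → Fin 2) × (Fin n → Fin 2)) × ((∀ i, α i) × (∀ i, β i))),
    IsTensorUnitary U ∧ IsTensorUnitary V ∧
    GateEquiv (W := (Fin n → angles) × (Fin n → angles)) (fun _ => 0, fun _ => 0)
      (fun w => tensorOp (piOp fun i => PA i (w.1 i)) (piOp fun i => PB i (w.2 i)))
      (fun w => registerKet (fun i => (w.1 i : ℝ)) (fun i => (w.2 i : ℝ)))
      U V G T S

end SelfTest

end

open SelfTest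

/-!
The proof works with the components of the swap isometry. At a site with projectors `P a`, put
`X = 2 P (π/4) - 1` (`bitFlip`); the isometry `ψ ↦ |0⟩ ⊗ P 0 ψ + |1⟩ ⊗ X (1 - P 0) ψ` exchanges the
qubit encoded by the measurements with a fresh logical qubit. Its components are the operators
`kraus P x`, and it extends to a unitary transformation `swapOp P` of the site together with a
logical qubit. The tensor product of these unitaries over all the sites serves both as `U` and as
`V`.

*Measurements.* By the argument of Mayers and Yao (`isEPR_of_norm_sq`), the statistics of an EPR
pair force `P a ψ = Q a ψ` for the two sides of the pair, and they force the Pauli relations on `ψ`.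
The vectors that satisfy these relations form the subspace `good P`; it is stable under all
operators that commute with the measurements. On good vectors, `P a` is the pull-back `k† k` of the
projector on the logical state `|a⟩` along the swap isometry
(`IsMeasurementFamily.apply_eq_krausAt`), and the operators `kraus P x† * kraus P y` multiply like
the matrix units `|x⟩⟨y|`. So every matrix `σ` on the logical register of one side has a physical
counterpart `rep P σ`. On EPR pairs, `σ` on one side acts as its transpose on the other side
(`rep_apply_eq`).

*One gate.* Let `φ` contain EPR pairs at all sites and let `G` be a gate on the `A` side. The vector
`G φ` is good for both sides: for the `B` side as `G` commutes with its measurements, and for the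
`A` side as the gate of the `B` side turns `G φ` into the next state, which again contains EPR pairs
(`mem_goodN_of_apply_mem`). The statistics of `G φ` on product states with angles in `angles` are those of a state with real
coordinates. These statistics determine the swapped state (`exists_eq_smul_of_norm_eq`): a
multilinear map with values in a Hilbert space whose norm equals the absolute value of a real
multilinear form on all tuples of angles is this form times a fixed vector. This is the place where
the angle `π/4`, that is, a third vector besides the basis `|0⟩, |1⟩`, and the reality of the ideal
gates are used. Hence `G φ` is swapped to `(T ⊗ 1) |Φ⁺⟩ ⊗ χ`, which is equivalent to the relation
`rep σ (G φ) = G (rep (T† σ T) φ)` for all matrices `σ` (`rep_gate_apply` and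
`exists_krausN_eq_of_rep`).

*Sequences of gates.* These relations compose. The states `Ψs j` have also been acted upon by the
gates of the `B` side, but the latter commute with everything in the relations and are injective, so
they can be cancelled (`rep_compUpTo`). The states remain EPR pairs at all sites: on the sites
touched by a gate by hypothesis, and on the others since the gates commute with the measurements
(`isEPR_of_gates`).

*Conclusion.* Let `G` and `T` be the products of all the gates. Then `Ψ` is swapped to `|Φ⁺⟩ ⊗ χ₀`
and `G Ψ` to `(T ⊗ 1) |Φ⁺⟩ ⊗ χ`, with `‖χ₀‖ = ‖χ‖`. A unitary transformation that sends `χ₀` to `χ`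
is the operator required in the equivalence (`gateEquiv_of_components`). The generators of the
subspace are obtained from `Ψ` by operators `rep σ` and `rep τ` on the two sides, and moving these
to the `B` side, where they commute with `G`, settles all of them at once.
-/

noncomputable section

namespace SelfTest

/-! ### Operators on some of the tensor factors -/

theorem slice_add {K X Y : Type*} (e : K ≃ X × Y) (y : Y) (ψ φ : Hilb K) :
    slice e y (ψ + φ) = slice e y ψ + slice e y φ := by
  ext x; rfl

theorem slice_smul {K X Y : Type*} (e : K ≃ X × Y) (y : Y) (c : ℂ) (ψ : Hilb K) :
    slice e y (c • ψ) = c • slice e y ψ := by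
  ext x; rfl

theorem slice_norm_le {K X Y : Type*} (e : K ≃ X × Y) (y : Y) (ψ : Hilb K) :
    ‖slice e y ψ‖ ≤ ‖ψ‖ := by
  refine le_of_sq_le_sq ?_ (norm_nonneg _)
  exact le_hasSum (slice_norm_hasSum e ψ) y fun _ _ => by positivity

/-- `slice` as a bounded linear map. -/
def sliceL {K X Y : Type*} (e : K ≃ X × Y) (y : Y) : Hilb K →L[ℂ] Hilb X :=
  LinearMap.mkContinuous
    { toFun := slice e y, map_add' := slice_add e y, map_smul' := slice_smul e y } 1
    fun ψ => by simpa using slice_norm_le e y ψ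

theorem slice_ampl {K X Y : Type*} (e : K ≃ X × Y) (g : Op X) (y : Y) (ψ : Hilb K) :
    slice e y (ampl e g ψ) = g (slice e y ψ) := by
  ext x
  simp [slice_apply, ampl_apply]

theorem eq_of_slice_eq {K X Y : Type*} (e : K ≃ X × Y) {ψ φ : Hilb K}
    (h : ∀ y, slice e y ψ = slice e y φ) : ψ = φ := by
  ext k
  have := congrArg (fun v : Hilb X => v (e k).1) (h (e k).2)
  simpa [slice_apply] using this

theorem inner_hasSum_slice {K X Y : Type*} (e : K ≃ X × Y) (φ ψ : Hilb K) :
    HasSum (fun y => inner ℂ (slice e y φ) (slice e y ψ)) (inner ℂ φ ψ) := by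
  have h := lp.hasSum_inner (𝕜 := ℂ) φ ψ
  have h2 := (((Equiv.prodComm Y X).trans e.symm).hasSum_iff
    (f := fun k => inner ℂ (φ k) (ψ k))).2 h
  exact h2.prod_fiberwise fun y => lp.hasSum_inner (𝕜 := ℂ) (slice e y φ) (slice e y ψ)

theorem ampl_star {K X Y : Type*} (e : K ≃ X × Y) (g : Op X) :
    ampl e (star g) = star (ampl e g) := by
  rw [ContinuousLinearMap.star_eq_adjoint, ContinuousLinearMap.star_eq_adjoint,
    ContinuousLinearMap.eq_adjoint_iff]
  intro ψ φ
  refine (inner_hasSum_slice e _ _).unique ?_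
  simpa only [slice_ampl, ContinuousLinearMap.adjoint_inner_left]
    using inner_hasSum_slice e ψ (ampl e g φ)

/-- `g ↦ g ⊗ Id` as a homomorphism of star algebras. -/
def amplHom {K X Y : Type*} (e : K ≃ X × Y) : Op X →⋆ₐ[ℂ] Op K where
  toFun := ampl e
  map_one' := by ext ψ k; simp [ampl_apply, slice_apply]
  map_mul' g h := by
    ext ψ k
    simp [ampl_apply, slice_ampl]
  map_zero' := by ext ψ k; simp [ampl_apply]
  map_add' g h := by ext ψ k; simp [ampl_apply]
  commutes' c := by
    ext ψ k
    simp [ampl_apply, slice_apply, Algebra.algebraMap_eq_smul_one]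
  map_star' := ampl_star e

/-- `ampl e g` only depends on `g` and on the partition of the basis of `Hilb K` into the fibres of
`e` with their identification with `X`. -/
theorem ampl_congr {K X Y Y' : Type*} (e : K ≃ X × Y) (e' : K ≃ X × Y')
    (h : ∀ k x, e.symm (x, (e k).2) = e'.symm (x, (e' k).2)) (g : Op X) :
    ampl e g = ampl e' g := by
  ext ψ k
  have h1 : (e k).1 = (e' k).1 := by
    have := h k (e k).1
    rw [Prod.mk.eta, Equiv.symm_apply_apply, Equiv.eq_symm_apply] at this
    exact (congrArg Prod.fst this).symm
  have h2 : slice e (e k).2 ψ = slice e' (e' k).2 ψ := by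
    ext x
    simp only [slice_apply, h]
  rw [ampl_apply, ampl_apply, h1, h2]

theorem ampl_ampl {K X Y Z W : Type*} (e : K ≃ X × Y) (f : X ≃ Z × W) (g : Op Z) :
    ampl e (ampl f g) =
      ampl ((e.trans (f.prodCongr (Equiv.refl Y))).trans (Equiv.prodAssoc Z W Y)) g := by
  ext ψ k
  rfl

/-- Bounded operators are determined by their values on the canonical basis. -/
theorem op_ext_single {K : Type*} [DecidableEq K] {S R : Op K}
    (h : ∀ k, S (lp.single 2 k (1 : ℂ)) = R (lp.single 2 k (1 : ℂ))) : S = R := by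
  ext1 ψ
  have hs := lp.hasSum_single (p := 2) (by norm_num) ψ
  have h1 := hs.mapL S
  have h2 := hs.mapL R
  refine h1.unique ?_
  convert h2 using 2 with k
  have : lp.single (E := fun _ : K => ℂ) 2 k (ψ k) = ψ k • lp.single 2 k (1 : ℂ) := by
    rw [← lp.single_smul]; simp
  rw [this, map_smul, map_smul, h]

theorem slice_single {K X Y : Type*} [DecidableEq K] [DecidableEq X] [DecidableEq Y]
    (e : K ≃ X × Y) (y : Y) (k : K) :
    slice e y (lp.single 2 k (1 : ℂ)) =
      (if y = (e k).2 then (1 : ℂ) else 0) • lp.single 2 (e k).1 (1 : ℂ) := by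
  ext x
  rw [slice_apply, lp.single_apply]
  have : e.symm (x, y) = k ↔ x = (e k).1 ∧ y = (e k).2 := by
    rw [Equiv.symm_apply_eq, Prod.ext_iff]
  rw [lp.coeFn_smul, Pi.smul_apply, lp.single_apply]
  simp only [this, Pi.single_apply]
  by_cases h1 : x = (e k).1 <;> by_cases h2 : y = (e k).2 <;> simp [h1, h2]

/-- `g ⊗ Id` commutes with `Id ⊗ h`. -/
theorem ampl_commute {K X Y : Type*} (e : K ≃ X × Y) (g : Op X) (h : Op Y) :
    Commute (ampl e g) (ampl (e.trans (Equiv.prodComm X Y)) h) := by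
  classical
  have key : ∀ k, ampl e g (ampl (e.trans (Equiv.prodComm X Y)) h (lp.single 2 k (1 : ℂ))) =
      ampl (e.trans (Equiv.prodComm X Y)) h (ampl e g (lp.single 2 k (1 : ℂ))) := by
    intro k
    ext k'
    have h1 : slice e (e k').2
          (ampl (e.trans (Equiv.prodComm X Y)) h (lp.single 2 k (1 : ℂ))) =
        h (lp.single 2 (e k).2 (1 : ℂ)) (e k').2 • lp.single 2 (e k).1 (1 : ℂ) := by
      ext x
      rw [slice_apply, ampl_apply, slice_single, map_smul]
      by_cases hx : x = (e k).1 <;> simp [mul_comm, hx]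
    have h2 : slice (e.trans (Equiv.prodComm X Y)) (e k').1
          (ampl e g (lp.single 2 k (1 : ℂ))) =
        g (lp.single 2 (e k).1 (1 : ℂ)) (e k').1 • lp.single 2 (e k).2 (1 : ℂ) := by
      ext y
      rw [slice_apply, ampl_apply, slice_single, map_smul]
      by_cases hy : y = (e k).2 <;> simp [mul_comm, hy]
    have h3 : ∀ φ : Hilb K, ampl (e.trans (Equiv.prodComm X Y)) h φ k' =
        h (slice (e.trans (Equiv.prodComm X Y)) (e k').1 φ) (e k').2 := fun _ => rfl
    rw [ampl_apply, h1, h3, h2, map_smul, map_smul]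
    simp [mul_comm]
  exact op_ext_single key

theorem onLeft_commute_onRight {X Y : Type*} (S : Op X) (R : Op Y) :
    Commute (onLeft S : Op (X × Y)) (onRight R) :=
  ampl_commute (Equiv.refl (X × Y)) S R

theorem onFactor_commute {n : ℕ} {α : Fin n → Type*} {i j : Fin n} (hij : i ≠ j)
    (g : Op (α i)) (h : Op (α j)) : Commute (onFactor i g) (onFactor j h) := by
  -- the factor `j` is a factor of the complement of the factor `i`
  have key : onFactor j h = ampl ((Equiv.piSplitAt i α).trans (Equiv.prodComm _ _))
      (ampl (Equiv.piSplitAt (⟨j, hij.symm⟩ : {k // k ≠ i}) (fun k => α k)) h) := by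
    rw [ampl_ampl]
    refine ampl_congr _ _ (fun k x => ?_) h
    funext l
    by_cases hl : l = j
    · subst hl
      simp [hij.symm]
    · by_cases hi : l = i
      · subst hi
        simp [hl]
      · simp [hl, hi]
  rw [key]
  exact ampl_commute _ _ _

theorem onSubset_commute_onFactor {n : ℕ} {α : Fin n → Type*} {I : Finset (Fin n)} {i : Fin n}
    (hi : i ∉ I) (g : Op (∀ i : I, α i)) (h : Op (α i)) :
    Commute (onSubset I g) (onFactor i h) := by
  -- the factor `i` is a factor of the complement of the factors in `I`
  have key : onFactor i h =
      ampl ((Equiv.piEquivPiSubtypeProd (fun i => i ∈ I) α).trans (Equiv.prodComm _ _))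
      (ampl (Equiv.piSplitAt (⟨i, hi⟩ : {k // ¬ k ∈ I}) (fun k => α k)) h) := by
    rw [ampl_ampl]
    refine ampl_congr _ _ (fun k x => ?_) h
    funext l
    by_cases hl : l = i
    · subst hl
      simp [hi]
    · by_cases hI : l ∈ I
      · simp [hl, hI]
      · simp [hl, hI]
  rw [key]
  exact ampl_commute _ _ _

/-! ### Ordered products of families indexed by `Fin n` -/

/-- The ordered product `f 0 * f 1 * ⋯ * f (n - 1)`. -/
def seqProd {M : Type*} [Monoid M] {n : ℕ} (f : Fin n → M) : M := (List.ofFn f).prod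

theorem seqProd_succ {M : Type*} [Monoid M] {n : ℕ} (f : Fin (n + 1) → M) :
    seqProd f = f 0 * seqProd fun i => f i.succ := by
  simp [seqProd, List.ofFn_succ]

theorem seqProd_zero {M : Type*} [Monoid M] (f : Fin 0 → M) : seqProd f = 1 := by
  simp [seqProd]

theorem map_seqProd {M M' F : Type*} [Monoid M] [Monoid M'] [FunLike F M M']
    [MonoidHomClass F M M'] (φ : F) {n : ℕ} (f : Fin n → M) :
    φ (seqProd f) = seqProd fun i => φ (f i) := by
  rw [seqProd, seqProd, map_list_prod, List.map_ofFn]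
  rfl

theorem commute_seqProd {M : Type*} [Monoid M] {n : ℕ} {x : M} {f : Fin n → M}
    (h : ∀ i, Commute x (f i)) : Commute x (seqProd f) := by
  refine Commute.list_prod_right _ _ fun y hy => ?_
  obtain ⟨i, rfl⟩ := (List.mem_ofFn' _ _).1 hy
  exact h i

theorem seqProd_mul {M : Type*} [Monoid M] {n : ℕ} {f g : Fin n → M}
    (h : ∀ i j, i ≠ j → Commute (f i) (g j)) :
    (seqProd fun i => f i * g i) = seqProd f * seqProd g := by
  induction n with
  | zero => simp [seqProd_zero]
  | succ n ih =>
    rw [seqProd_succ, seqProd_succ f, seqProd_succ g,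
      ih fun i j hij => h i.succ j.succ fun e => hij (Fin.succ_injective _ e)]
    have hc : Commute (g 0) (seqProd fun i => f i.succ) :=
      commute_seqProd fun i => (h i.succ 0 (Fin.succ_ne_zero i)).symm
    simp only [mul_assoc]
    rw [← mul_assoc (g 0), hc.eq, mul_assoc]

theorem seqProd_star {M : Type*} [Monoid M] [StarMul M] {n : ℕ} {f : Fin n → M}
    (h : ∀ i j, i ≠ j → Commute (f i) (f j)) :
    star (seqProd f) = seqProd fun i => star (f i) := by
  induction n with
  | zero => simp [seqProd_zero]
  | succ n ih =>
    rw [seqProd_succ, seqProd_succ, star_mul,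
      ih fun i j hij => h i.succ j.succ fun e => hij (Fin.succ_injective _ e)]
    exact (commute_seqProd fun i => (h 0 i.succ (Fin.succ_ne_zero i).symm).star_star).symm.eq

theorem seqProd_smul {M : Type*} [Semiring M] [Algebra ℂ M] {n : ℕ} (c : Fin n → ℂ)
    (f : Fin n → M) : (seqProd fun i => c i • f i) = (∏ i, c i) • seqProd f := by
  induction n with
  | zero => simp [seqProd_zero]
  | succ n ih =>
    rw [seqProd_succ, seqProd_succ f, ih, Fin.prod_univ_succ, smul_mul_smul_comm]

theorem sum_fin_succ_arrow {κ E : Type*} [Fintype κ] [AddCommMonoid E] {n : ℕ}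
    (F : (Fin (n + 1) → κ) → E) :
    ∑ c, F c = ∑ x, ∑ c : Fin n → κ, F (Fin.cons x c) := by
  rw [← (Fin.consEquiv fun _ => κ).sum_comp, Fintype.sum_prod_type]
  rfl

theorem seqProd_sum {M κ : Type*} [Semiring M] [Fintype κ] {n : ℕ} (f : Fin n → κ → M) :
    (seqProd fun i => ∑ x, f i x) = ∑ c : Fin n → κ, seqProd fun i => f i (c i) := by
  induction n with
  | zero => simp [seqProd_zero]
  | succ n ih =>
    rw [seqProd_succ, ih, sum_fin_succ_arrow, Finset.sum_mul_sum]
    simp [seqProd_succ]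

/-- The factors of an ordered product can be replaced by operators with the same value at `v`, as
each of them can be moved to the right of the factors that have been replaced. -/
theorem seqProd_apply_congr {K : Type*} {n : ℕ} {f g : Fin n → Op K} {v : Hilb K}
    (hfg : ∀ i j, i ≠ j → Commute (f i) (g j)) (hgg : ∀ i j, i ≠ j → Commute (g i) (g j))
    (hv : ∀ i, f i v = g i v) : (seqProd f : Op K) v = (seqProd g : Op K) v := by
  induction n with
  | zero => simp [seqProd_zero]
  | succ n ih =>
    rw [seqProd_succ, seqProd_succ g]
    have h0 : ∀ i : Fin n, (0 : Fin (n + 1)) ≠ i.succ := fun i => (Fin.succ_ne_zero i).symm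
    have h1 : Commute (f 0) (seqProd fun i => g i.succ) :=
      commute_seqProd fun i => hfg 0 i.succ (h0 i)
    have h2 : Commute (g 0) (seqProd fun i => g i.succ) :=
      commute_seqProd fun i => hgg 0 i.succ (h0 i)
    have hi := ih (f := fun i => f i.succ) (g := fun i => g i.succ)
      (fun i j hij => hfg i.succ j.succ fun e => hij (Fin.succ_injective _ e))
      (fun i j hij => hgg i.succ j.succ fun e => hij (Fin.succ_injective _ e))
      (fun i => hv i.succ)
    calc (f 0 * seqProd fun i => f i.succ : Op K) v
        = (f 0 * seqProd fun i => g i.succ) v := congrArg (f 0) hi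
      _ = ((seqProd fun i => g i.succ) * f 0 : Op K) v := by rw [h1.eq]
      _ = ((seqProd fun i => g i.succ) * g 0 : Op K) v :=
          congrArg (seqProd fun i => g i.succ : Op K) (hv 0)
      _ = (g 0 * seqProd fun i => g i.succ : Op K) v := by rw [h2.eq]

/-! ### Rigidity of real multilinear forms -/

theorem zero_mem_angles₀ : (0 : ℝ) ∈ angles₀ := by simp [angles₀]

theorem pi_div_eight_mem_angles₀ : Real.pi / 8 ∈ angles₀ := by simp [angles₀]

theorem pi_div_four_mem_angles₀ : Real.pi / 4 ∈ angles₀ := by simp [angles₀]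

theorem mem_angles {a : ℝ} (ha : a ∈ angles₀) : a ∈ angles := Or.inl ha

theorem add_mem_angles {a : ℝ} (ha : a ∈ angles₀) : a + Real.pi / 2 ∈ angles :=
  Or.inr ⟨a, ha, rfl⟩

/-- The angle of the basis vector `|x⟩` of `ℂ²`. -/
def basisAngle (x : Fin 2) : angles :=
  if x = 0 then ⟨0, mem_angles zero_mem_angles₀⟩
  else ⟨0 + Real.pi / 2, add_mem_angles zero_mem_angles₀⟩

theorem qubitCoords_basisAngle (x y : Fin 2) :
    qubitCoords (basisAngle x) y = if x = y then 1 else 0 := by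
  fin_cases x <;> fin_cases y <;> simp [basisAngle, qubitCoords]

theorem qubitCoords_pi_div_four (y : Fin 2) :
    qubitCoords (Real.pi / 4) y = (Real.sqrt 2 / 2 : ℝ) := by
  fin_cases y <;> simp [qubitCoords]

/-- Two vectors `x` and `y` agree if `r x + s y` is as long as in the case of equal unit vectors:
this is the equality case of the inequality of Cauchy and Schwarz. -/
theorem eq_of_norm_add_eq {E : Type*} [NormedAddCommGroup E] [InnerProductSpace ℂ E] {x y : E}
    {r s : ℝ} (hr : r ≠ 0) (hs : s ≠ 0) (hx : ‖(r : ℂ) • x‖ = ‖(r : ℂ)‖)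
    (hy : ‖(s : ℂ) • y‖ = ‖(s : ℂ)‖) (hxy : ‖(r : ℂ) • x + (s : ℂ) • y‖ = ‖(r : ℂ) + (s : ℂ)‖) :
    x = y := by
  have hr' : ‖(r : ℂ)‖ ≠ 0 := by simpa using hr
  have hs' : ‖(s : ℂ)‖ ≠ 0 := by simpa using hs
  have hx1 : ‖x‖ = 1 := by
    rw [norm_smul] at hx
    exact (mul_eq_left₀ hr').1 hx
  have hy1 : ‖y‖ = 1 := by
    rw [norm_smul] at hy
    exact (mul_eq_left₀ hs').1 hy
  have h := @norm_add_sq ℂ E _ _ _ ((r : ℂ) • x) ((s : ℂ) • y)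
  rw [hxy, hx, hy, inner_smul_left, inner_smul_right, ← Complex.ofReal_add, Complex.norm_real,
    Complex.norm_real, Complex.norm_real, Complex.conj_ofReal] at h
  simp only [Real.norm_eq_abs, sq_abs, Complex.re_ofReal_mul, RCLike.re_to_complex] at h
  have h1 : (inner ℂ x y : ℂ).re = 1 := by
    have : r * s * ((inner ℂ x y : ℂ).re - 1) = 0 := by linarith
    rcases mul_eq_zero.1 this with h | h
    · exact absurd h (mul_ne_zero hr hs)
    · linarith
  have h2 := @norm_sub_sq ℂ E _ _ _ x y
  rw [hx1, hy1, RCLike.re_to_complex, h1] at h2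
  have : ‖x - y‖ ^ 2 = 0 := by rw [h2]; norm_num
  exact sub_eq_zero.1 (norm_eq_zero.1 (pow_eq_zero_iff (two_ne_zero)|>.1 this))

/-- A multilinear form on qubits with values in a Hilbert space whose norm agrees with the absolute
value of a real multilinear form on all tuples of angles is that form times a fixed vector. The
values at `|0⟩` and `|1⟩` in the first variable are of this form by induction, and so is the value
at the angle `π/4`, which relates their vectors to each other. -/
theorem exists_eq_smul_of_norm_eq {E : Type*} [NormedAddCommGroup E] [InnerProductSpace ℂ E]
    {m : ℕ} (f : (Fin m → Fin 2) → E) (g : (Fin m → Fin 2) → ℝ)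
    (h : ∀ a : Fin m → angles, ‖∑ c, (∏ i, qubitCoords (a i) (c i)) • f c‖ =
      ‖∑ c, (∏ i, qubitCoords (a i) (c i)) * (g c : ℂ)‖) :
    ∃ χ : E, ∀ c, f c = (g c : ℂ) • χ := by
  induction m with
  | zero =>
    have h0 : ∀ c, ‖f c‖ = ‖(g c : ℂ)‖ := by
      intro c
      have h0 := h default
      simp only [Finset.univ_unique, Finset.univ_eq_empty, Finset.prod_empty, one_smul, one_mul,
        Finset.sum_singleton] at h0
      convert h0
    by_cases hg : g Fin.elim0 = 0
    · refine ⟨0, fun c => ?_⟩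
      have hc := h0 Fin.elim0
      rw [hg, Complex.ofReal_zero, norm_zero, norm_eq_zero] at hc
      rw [smul_zero, Subsingleton.elim c Fin.elim0, hc]
    · refine ⟨((g Fin.elim0 : ℂ))⁻¹ • f Fin.elim0, fun c => ?_⟩
      rw [Subsingleton.elim c Fin.elim0, smul_inv_smul₀ (by exact_mod_cast hg)]
  | succ m ih =>
    -- the norm condition, with the first variable separated from the others
    have h' : ∀ (a₀ : angles) (a : Fin m → angles),
        ‖∑ c, (∏ i, qubitCoords (a i) (c i)) •
          (qubitCoords a₀ 0 • f (Fin.cons 0 c) + qubitCoords a₀ 1 • f (Fin.cons 1 c))‖ =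
        ‖∑ c, (∏ i, qubitCoords (a i) (c i)) *
          (qubitCoords a₀ 0 * g (Fin.cons 0 c) + qubitCoords a₀ 1 * g (Fin.cons 1 c))‖ := by
      intro a₀ a
      have := h (Fin.cons a₀ a)
      rw [sum_fin_succ_arrow, sum_fin_succ_arrow] at this
      simp only [Fin.sum_univ_two, Fin.prod_univ_succ, Fin.cons_zero, Fin.cons_succ] at this
      rw [← Finset.sum_add_distrib, ← Finset.sum_add_distrib] at this
      convert this using 3
      · simp only [smul_add, smul_smul, mul_comm]
      · ring
    have h0 : ∀ x : Fin 2, ∃ χ : E, ∀ c, f (Fin.cons x c) = (g (Fin.cons x c) : ℂ) • χ := by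
      intro x
      refine ih _ _ fun a => ?_
      have := h' (basisAngle x) a
      simp only [qubitCoords_basisAngle] at this
      fin_cases x <;> simpa using this
    obtain ⟨χ₀, hχ₀⟩ := h0 0
    obtain ⟨χ₁, hχ₁⟩ := h0 1
    have hs : ((Real.sqrt 2 / 2 : ℝ) : ℂ) ≠ 0 := by
      rw [Complex.ofReal_ne_zero]; positivity
    have hp : ∀ a : Fin m → angles,
        ‖∑ c, (∏ i, qubitCoords (a i) (c i)) • (f (Fin.cons 0 c) + f (Fin.cons 1 c))‖ =
        ‖∑ c, (∏ i, qubitCoords (a i) (c i)) *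
          ((g (Fin.cons 0 c) + g (Fin.cons 1 c) : ℝ) : ℂ)‖ := by
      intro a
      have := h' ⟨Real.pi / 4, mem_angles pi_div_four_mem_angles₀⟩ a
      simp only [qubitCoords_pi_div_four, ← smul_add, ← mul_add,
        fun (z : ℂ) (x : E) => smul_comm z ((Real.sqrt 2 / 2 : ℝ) : ℂ) x] at this
      simp only [fun z w : ℂ => mul_left_comm z ((Real.sqrt 2 / 2 : ℝ) : ℂ) w] at this
      rw [← Finset.smul_sum, ← Finset.mul_sum, norm_smul, norm_mul] at this
      simpa using mul_left_cancel₀ (norm_ne_zero_iff.2 hs) this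
    -- the first variable at the angle `π/4`
    obtain ⟨χp, hχp⟩ := ih _ _ hp
    have key : ∃ χ : E, ∀ c, f (Fin.cons 0 c) = (g (Fin.cons 0 c) : ℂ) • χ ∧
        f (Fin.cons 1 c) = (g (Fin.cons 1 c) : ℂ) • χ := by
      by_cases hc : ∃ c, g (Fin.cons 0 c) ≠ 0 ∧ g (Fin.cons 1 c) ≠ 0
      · -- at a common point `c` of the supports the norms force `χ₀ = χ₁`
        obtain ⟨c, hc0, hc1⟩ := hc
        have hev : ∀ a₀ : angles,
            ‖qubitCoords a₀ 0 • f (Fin.cons 0 c) + qubitCoords a₀ 1 • f (Fin.cons 1 c)‖ =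
            ‖qubitCoords a₀ 0 * (g (Fin.cons 0 c) : ℂ) +
              qubitCoords a₀ 1 * (g (Fin.cons 1 c) : ℂ)‖ := by
          intro a₀
          have := h' a₀ fun i => basisAngle (c i)
          -- the basis states single out the coordinate `c`
          have hpr : ∀ d : Fin m → Fin 2, ∏ i, qubitCoords (basisAngle (c i)) (d i) =
              if c = d then 1 else 0 := by
            intro d
            simp only [qubitCoords_basisAngle, Finset.prod_ite_zero, funext_iff]
            simp
          simpa [hpr, Finset.sum_add_distrib] using this
        have e : χ₀ = χ₁ := by
          refine eq_of_norm_add_eq hc0 hc1 ?_ ?_ ?_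
          · have := hev (basisAngle 0)
            rw [← hχ₀]
            simpa [qubitCoords_basisAngle] using this
          · have := hev (basisAngle 1)
            rw [← hχ₁]
            simpa [qubitCoords_basisAngle] using this
          · have := hev ⟨Real.pi / 4, mem_angles pi_div_four_mem_angles₀⟩
            simp only [qubitCoords_pi_div_four, ← smul_add, ← mul_add] at this
            rw [norm_smul, norm_mul] at this
            rw [← hχ₀, ← hχ₁]
            exact mul_left_cancel₀ (norm_ne_zero_iff.2 hs) this
        exact ⟨χ₀, fun c => ⟨hχ₀ c, e ▸ hχ₁ c⟩⟩
      · -- for disjoint supports, both vectors are equal to `χp`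
        push Not at hc
        by_cases h1 : ∃ c, g (Fin.cons 0 c) ≠ 0
        · by_cases h2 : ∃ c, g (Fin.cons 1 c) ≠ 0
          · obtain ⟨c, h1⟩ := h1
            obtain ⟨d, h2⟩ := h2
            have h3 := hχp c
            have h4 := hχp d
            have hd : g (Fin.cons 0 d) = 0 := by
              by_contra hd
              exact h2 (hc d hd)
            rw [hχ₀, hχ₁, hc c h1] at h3
            rw [hχ₀, hχ₁, hd] at h4
            simp only [Complex.ofReal_zero, zero_smul, add_zero, zero_add] at h3 h4
            have e0 : χ₀ = χp := smul_right_injective E (Complex.ofReal_ne_zero.2 h1) h3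
            have e1 : χ₁ = χp := smul_right_injective E (Complex.ofReal_ne_zero.2 h2) h4
            exact ⟨χp, fun c => ⟨e0 ▸ hχ₀ c, e1 ▸ hχ₁ c⟩⟩
          · push Not at h2
            exact ⟨χ₀, fun c => ⟨hχ₀ c, by rw [hχ₁, h2]; simp⟩⟩
        · push Not at h1
          exact ⟨χ₁, fun c => ⟨by rw [hχ₀, h1]; simp, hχ₁ c⟩⟩
    obtain ⟨χ, hχ⟩ := key
    refine ⟨χ, fun c => ?_⟩
    rw [← Fin.cons_self_tail c]
    generalize hx : c 0 = x
    fin_cases x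
    · exact (hχ _).1
    · exact (hχ _).2

/-! ### One site: the Kraus operators of the swap isometry -/

/-- The reflection `P^{π/4} - P^{3π/4}`, the physical counterpart of the bit flip. -/
def bitFlip {K : Type*} (P : ℝ → Op K) : Op K := (2 : ℂ) • P (Real.pi / 4) - 1

/-- The components of the isometry `ψ ↦ |0⟩ ⊗ P⁰ ψ + |1⟩ ⊗ X P^{π/2} ψ` that swaps the encoded qubit
with a logical qubit prepared in the state `|0⟩`. Here `X` is `bitFlip P`. -/
def kraus {K : Type*} (P : ℝ → Op K) (x : Fin 2) : Op K :=
  if x = 0 then P 0 else bitFlip P * (1 - P 0)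

/-- The component of the swap isometry along the state `|a⟩` of the logical qubit. -/
def krausAt {K : Type*} (P : ℝ → Op K) (a : ℝ) : Op K := ∑ x, qubitCoords a x • kraus P x

/-- The physical counterpart of the matrix unit `|x⟩⟨y|`. -/
def matUnit {K : Type*} (P : ℝ → Op K) (x y : Fin 2) : Op K := star (kraus P x) * kraus P y

/-- The vectors on which the bit flip `X` anticommutes with `Z = P⁰ - P^{π/2}`, that is, its
diagonal blocks vanish, and the observable of the angle `π/8` is `(Z + X) / √2`. -/
def good {K : Type*} (P : ℝ → Op K) : Submodule ℂ (Hilb K) :=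
  LinearMap.ker (((1 - P 0) * bitFlip P * (1 - P 0) : Op K) : Hilb K →ₗ[ℂ] Hilb K) ⊓
  LinearMap.ker ((P 0 * bitFlip P * P 0 : Op K) : Hilb K →ₗ[ℂ] Hilb K) ⊓
  LinearMap.ker ((((Real.sqrt 2 : ℝ) : ℂ) • ((2 : ℂ) • P (Real.pi / 8) - 1) -
    ((2 : ℂ) • P 0 - 1) - bitFlip P : Op K) : Hilb K →ₗ[ℂ] Hilb K)

theorem mem_good {K : Type*} {P : ℝ → Op K} {v : Hilb K} :
    v ∈ good P ↔ ((1 - P 0) * bitFlip P * (1 - P 0)) v = 0 ∧ (P 0 * bitFlip P * P 0) v = 0 ∧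
      (((Real.sqrt 2 : ℝ) : ℂ) • ((2 : ℂ) • P (Real.pi / 8) - 1) -
        ((2 : ℂ) • P 0 - 1) - bitFlip P) v = 0 := by
  rw [good, Submodule.mem_inf, Submodule.mem_inf, and_assoc]
  rfl

theorem op_mul_apply {K : Type*} (S R : Op K) (v : Hilb K) : (S * R) v = S (R v) := rfl

theorem op_add_apply {K : Type*} (S R : Op K) (v : Hilb K) : (S + R) v = S v + R v := rfl

theorem one_apply_op {K : Type*} (v : Hilb K) : (1 : Op K) v = v := rfl

theorem op_smul_apply {K : Type*} (c : ℂ) (S : Op K) (v : Hilb K) : (c • S) v = c • S v := rfl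

theorem commute_bitFlip {K : Type*} {P : ℝ → Op K} {Y : Op K} (h : ∀ a, Commute Y (P a)) :
    Commute Y (bitFlip P) :=
  ((h _).smul_right _).sub_right (Commute.one_right Y)

theorem commute_kraus {K : Type*} {P : ℝ → Op K} {Y : Op K} (h : ∀ a, Commute Y (P a))
    (x : Fin 2) : Commute Y (kraus P x) := by
  unfold kraus
  split_ifs
  · exact h 0
  · exact (commute_bitFlip h).mul_right ((Commute.one_right Y).sub_right (h 0))

theorem commute_krausAt {K : Type*} {P : ℝ → Op K} {Y : Op K} (h : ∀ a, Commute Y (P a))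
    (a : ℝ) : Commute Y (krausAt P a) :=
  Commute.sum_right _ _ _ fun x _ => (commute_kraus h x).smul_right _

/-- Operators that commute with the measurements preserve good vectors. -/
theorem apply_mem_good {K : Type*} {P : ℝ → Op K} {Y : Op K} (h : ∀ a, Commute Y (P a))
    {v : Hilb K} (hv : v ∈ good P) : Y v ∈ good P := by
  have hX := commute_bitFlip h
  have h1 := Commute.one_right Y
  have key : ∀ R : Op K, Commute Y R → R v = 0 → R (Y v) = 0 := by
    intro R hR hv
    calc R (Y v) = (R * Y) v := rfl
      _ = (Y * R) v := by rw [hR.eq]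
      _ = Y (R v) := rfl
      _ = 0 := by rw [hv, map_zero]
  obtain ⟨ha, hb, hc⟩ := mem_good.1 hv
  refine mem_good.2 ⟨key _ ?_ ha, key _ ?_ hb, key _ ?_ hc⟩
  · exact ((h1.sub_right (h 0)).mul_right hX).mul_right (h1.sub_right (h 0))
  · exact ((h 0).mul_right hX).mul_right (h 0)
  · exact ((((((h _).smul_right _).sub_right h1).smul_right _).sub_right
      (((h _).smul_right _).sub_right h1)).sub_right hX)

section Site

variable {K : Type*} {P Q : ℝ → Op K}

theorem IsMeasurementFamily.apply_apply (hP : IsMeasurementFamily P) {a : ℝ} (ha : a ∈ angles)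
    (v : Hilb K) : P a (P a v) = P a v := by
  have h := (hP.proj a ha).isIdempotentElem.eq
  exact congrArg (fun T : Op K => T v) h

theorem IsMeasurementFamily.star_eq (hP : IsMeasurementFamily P) {a : ℝ} (ha : a ∈ angles) :
    star (P a) = P a :=
  (hP.proj a ha).isSelfAdjoint.star_eq

theorem IsMeasurementFamily.add_apply (hP : IsMeasurementFamily P) {a : ℝ} (ha : a ∈ angles₀)
    (v : Hilb K) : P (a + Real.pi / 2) v = v - P a v := by
  have h := congrArg (fun T : Op K => T v) (hP.add_eq_one a ha)
  exact eq_sub_of_add_eq' h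

theorem bitFlip_apply (v : Hilb K) : bitFlip P v = (2 : ℂ) • P (Real.pi / 4) v - v := rfl

theorem IsMeasurementFamily.bitFlip_bitFlip (hP : IsMeasurementFamily P) (v : Hilb K) :
    bitFlip P (bitFlip P v) = v := by
  simp only [bitFlip_apply, map_sub, map_smul,
    hP.apply_apply (mem_angles pi_div_four_mem_angles₀)]
  module

theorem IsMeasurementFamily.star_bitFlip (hP : IsMeasurementFamily P) :
    star (bitFlip P) = bitFlip P := by
  simp [bitFlip, hP.star_eq (mem_angles pi_div_four_mem_angles₀)]

theorem kraus_zero_apply (v : Hilb K) : kraus P 0 v = P 0 v := rfl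

theorem kraus_one_apply (v : Hilb K) : kraus P 1 v = bitFlip P (v - P 0 v) := rfl

theorem IsMeasurementFamily.star_kraus_zero_apply (hP : IsMeasurementFamily P) (v : Hilb K) :
    star (kraus P 0) v = P 0 v := by
  simp [kraus, hP.star_eq (mem_angles zero_mem_angles₀)]

theorem IsMeasurementFamily.star_kraus_one_apply (hP : IsMeasurementFamily P) (v : Hilb K) :
    star (kraus P 1) v = bitFlip P v - P 0 (bitFlip P v) := by
  simp [kraus, hP.star_eq (mem_angles zero_mem_angles₀), hP.star_bitFlip]

theorem IsMeasurementFamily.commute_star_kraus (hP : IsMeasurementFamily P) {Y : Op K}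
    (h : ∀ a, Commute Y (P a)) (x : Fin 2) : Commute Y (star (kraus P x)) := by
  have h0 := hP.star_eq (mem_angles zero_mem_angles₀)
  unfold kraus
  split_ifs
  · rw [h0]
    exact h 0
  · rw [star_mul, star_sub, star_one, h0, hP.star_bitFlip]
    exact ((Commute.one_right Y).sub_right (h 0)).mul_right (commute_bitFlip h)

theorem IsMeasurementFamily.commute_matUnit (hP : IsMeasurementFamily P) {Y : Op K}
    (h : ∀ a, Commute Y (P a)) (x y : Fin 2) : Commute Y (matUnit P x y) :=
  (hP.commute_star_kraus h x).mul_right (commute_kraus h y)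

theorem IsMeasurementFamily.sum_star_kraus_mul_kraus (hP : IsMeasurementFamily P) :
    ∑ x, star (kraus P x) * kraus P x = 1 := by
  have h0 := mem_angles zero_mem_angles₀
  ext1 v
  simp only [Fin.sum_univ_two, op_add_apply, op_mul_apply,
    hP.star_kraus_zero_apply, hP.star_kraus_one_apply, kraus_zero_apply, kraus_one_apply,
    hP.bitFlip_bitFlip, hP.apply_apply h0, map_sub]
  simp

/-- The relations satisfied by a vector in `good P`, in the form in which they are used. -/
theorem good_apply {v : Hilb K} (hv : v ∈ good P) :
    P 0 (bitFlip P (P 0 v)) = 0 ∧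
    P 0 (bitFlip P v) = bitFlip P v - bitFlip P (P 0 v) ∧
    ((Real.sqrt 2 : ℝ) : ℂ) • ((2 : ℂ) • P (Real.pi / 8) v - v) =
      (2 : ℂ) • P 0 v - v + bitFlip P v := by
  obtain ⟨h1, h2, h3⟩ := mem_good.1 hv
  have h1' : bitFlip P (v - P 0 v) - P 0 (bitFlip P (v - P 0 v)) = 0 := h1
  have h2' : P 0 (bitFlip P (P 0 v)) = 0 := h2
  have h3' : ((Real.sqrt 2 : ℝ) : ℂ) • ((2 : ℂ) • P (Real.pi / 8) v - v) -
      ((2 : ℂ) • P 0 v - v) - bitFlip P v = 0 := h3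
  refine ⟨h2', ?_, ?_⟩
  · simp only [map_sub, h2', sub_zero] at h1'
    exact (sub_eq_zero.1 h1').symm
  · rw [sub_sub, sub_eq_zero] at h3'
    exact h3'

/-- On good vectors, the matrix units of the encoded qubit are swapped to those of the logical
qubit. -/
theorem IsMeasurementFamily.kraus_matUnit (hP : IsMeasurementFamily P) {v : Hilb K}
    (hv : v ∈ good P) (z x y : Fin 2) :
    (kraus P z * matUnit P x y) v = (if z = x then (1 : ℂ) else 0) • kraus P y v := by
  obtain ⟨h1, h2, -⟩ := good_apply hv
  have h0 := mem_angles zero_mem_angles₀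
  change kraus P z (star (kraus P x) (kraus P y v)) = _
  fin_cases z <;> fin_cases x <;> fin_cases y <;>
  simp [hP.star_kraus_zero_apply, hP.star_kraus_one_apply, kraus_zero_apply, kraus_one_apply,
    hP.bitFlip_bitFlip, hP.apply_apply h0, h1, h2]

theorem qubitCoords_real (a : ℝ) (x : Fin 2) : star (qubitCoords a x) = qubitCoords a x := by
  fin_cases x
  · exact Complex.conj_ofReal _
  · exact Complex.conj_ofReal _

theorem star_krausAt_apply (a : ℝ) (v : Hilb K) :
    star (krausAt P a) v = ∑ x, qubitCoords a x • star (kraus P x) v := by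
  simp only [krausAt, star_sum, star_smul, qubitCoords_real]
  simp

/-- On good vectors, `P a` is the pull-back of the projector on `|a⟩` along the swap isometry. -/
theorem IsMeasurementFamily.apply_eq_krausAt (hP : IsMeasurementFamily P) {v : Hilb K}
    (hv : v ∈ good P) {a : ℝ} (ha : a ∈ angles) :
    P a v = (star (krausAt P a) * krausAt P a) v := by
  obtain ⟨h1, h2, h3⟩ := good_apply hv
  have h0 := mem_angles zero_mem_angles₀
  have key : ∀ a, (star (krausAt P a) * krausAt P a) v =
      ((Real.cos a ^ 2 : ℝ) : ℂ) • P 0 v + ((Real.cos a * Real.sin a : ℝ) : ℂ) • bitFlip P v +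
        ((Real.sin a ^ 2 : ℝ) : ℂ) • (v - P 0 v) := by
    intro a
    rw [op_mul_apply, star_krausAt_apply]
    simp only [krausAt, Fin.sum_univ_two, qubitCoords, op_add_apply,
      op_smul_apply, map_add, map_smul, map_sub, hP.star_kraus_zero_apply,
      hP.star_kraus_one_apply, kraus_zero_apply, kraus_one_apply, hP.bitFlip_bitFlip,
      hP.apply_apply h0, h1, h2, Matrix.cons_val_zero, Matrix.cons_val_one]
    push_cast
    module
  have h2' : ((Real.sqrt 2 : ℝ) : ℂ) * ((Real.sqrt 2 : ℝ) : ℂ) = 2 := by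
    rw [← Complex.ofReal_mul, Real.mul_self_sqrt (by norm_num)]
    norm_num
  -- `P a v` as if `P a` were the matrix `|a⟩⟨a|`, in terms of `|0⟩⟨0|` and of the bit flip
  have key0 : ∀ a ∈ angles₀, P a v = ((Real.cos a ^ 2 : ℝ) : ℂ) • P 0 v +
      ((Real.cos a * Real.sin a : ℝ) : ℂ) • bitFlip P v +
        ((Real.sin a ^ 2 : ℝ) : ℂ) • (v - P 0 v) := by
    intro a ha
    rcases ha with rfl | rfl | rfl
    · simp
    · have hc : Real.cos (Real.pi / 8) ^ 2 = 1 / 2 + Real.sqrt 2 / 4 := by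
        rw [Real.cos_sq, show 2 * (Real.pi / 8) = Real.pi / 4 by ring, Real.cos_pi_div_four]
        ring
      have hs : Real.sin (Real.pi / 8) ^ 2 = 1 / 2 - Real.sqrt 2 / 4 := by
        rw [Real.sin_sq, hc]
        ring
      have hcs : Real.cos (Real.pi / 8) * Real.sin (Real.pi / 8) = Real.sqrt 2 / 4 := by
        have := Real.sin_two_mul (Real.pi / 8)
        rw [show 2 * (Real.pi / 8) = Real.pi / 4 by ring, Real.sin_pi_div_four] at this
        linarith
      rw [hc, hs, hcs]
      have hX : bitFlip P v = ((Real.sqrt 2 : ℝ) : ℂ) • ((2 : ℂ) • P (Real.pi / 8) v - v) -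
          ((2 : ℂ) • P 0 v - v) := by rw [h3]; abel
      rw [hX]
      push_cast
      have h4 : ((Real.sqrt 2 : ℝ) : ℂ) / 4 * ((Real.sqrt 2 : ℝ) : ℂ) = 1 / 2 := by
        rw [div_mul_eq_mul_div, h2']; norm_num
      rw [smul_sub (((Real.sqrt 2 : ℝ) : ℂ) / 4), smul_smul, h4]
      module
    · rw [Real.cos_pi_div_four, Real.sin_pi_div_four, bitFlip_apply]
      have : (Real.sqrt 2 / 2) ^ 2 = 1 / 2 := by
        rw [div_pow, Real.sq_sqrt (by norm_num)]; norm_num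
      rw [← sq, this]
      push_cast
      module
  rw [key]
  rcases ha with ha | ⟨a, ha, rfl⟩
  · exact key0 a ha
  · have hc : ((Real.cos a ^ 2 : ℝ) : ℂ) = 1 - ((Real.sin a ^ 2 : ℝ) : ℂ) := by
      rw [Real.cos_sq']; push_cast; ring
    simp only [Real.cos_add_pi_div_two, Real.sin_add_pi_div_two]
    rw [hP.add_apply ha, key0 a ha, hc]
    push_cast
    module

/-! ### One pair of sites: vectors that contain an EPR pair -/

/-- The two measurements act alike on `ψ`, and `ψ` is good for both of them, as for an EPR pair. -/
structure IsEPR (P Q : ℝ → Op K) (ψ : Hilb K) : Prop where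
  apply_eq : ∀ a ∈ angles, P a ψ = Q a ψ
  left : ψ ∈ good P
  right : ψ ∈ good Q

theorem IsEPR.symm {ψ : Hilb K} (h : IsEPR P Q ψ) : IsEPR Q P ψ :=
  ⟨fun a ha => (h.apply_eq a ha).symm, h.right, h.left⟩

theorem IsEPR.map {ψ : Hilb K} (h : IsEPR P Q ψ) {Y : Op K} (hYP : ∀ a, Commute Y (P a))
    (hYQ : ∀ a, Commute Y (Q a)) : IsEPR P Q (Y ψ) where
  apply_eq a ha := by
    have h1 := congrArg (fun T : Op K => T ψ) (hYP a).eq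
    have h2 := congrArg (fun T : Op K => T ψ) (hYQ a).eq
    change Y (P a ψ) = P a (Y ψ) at h1
    change Y (Q a ψ) = Q a (Y ψ) at h2
    rw [← h1, ← h2, h.apply_eq a ha]
  left := apply_mem_good hYP h.left
  right := apply_mem_good hYQ h.right

theorem commute_apply {S R : Op K} (h : Commute S R) (v : Hilb K) : S (R v) = R (S v) :=
  congrArg (fun T : Op K => T v) h.eq

theorem IsEPR.bitFlip_eq {ψ : Hilb K} (h : IsEPR P Q ψ) : bitFlip P ψ = bitFlip Q ψ := by
  rw [bitFlip_apply, bitFlip_apply, h.apply_eq _ (mem_angles pi_div_four_mem_angles₀)]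

theorem IsEPR.matUnit_zero_one {ψ : Hilb K} (h : IsEPR P Q ψ) (hP : IsMeasurementFamily P)
    (hQ : IsMeasurementFamily Q) (hPQ : ∀ a b, Commute (P a) (Q b)) :
    matUnit P 0 1 ψ = matUnit Q 1 0 ψ := by
  obtain ⟨h1, h2, -⟩ := good_apply h.left
  obtain ⟨h3, h4, -⟩ := good_apply h.right
  have h0 := mem_angles zero_mem_angles₀
  have hX : bitFlip P (Q 0 ψ) = Q 0 (bitFlip P ψ) :=
    commute_apply (commute_bitFlip fun a => (hPQ a 0).symm).symm ψ
  change star (kraus P 0) (kraus P 1 ψ) = star (kraus Q 1) (kraus Q 0 ψ)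
  rw [hP.star_kraus_zero_apply, hQ.star_kraus_one_apply, kraus_one_apply, kraus_zero_apply, h3,
    map_sub, map_sub, h1, h2, h.apply_eq 0 h0, hX, h.bitFlip_eq, h4]
  abel

/-- On an EPR pair, a matrix unit on one side acts as its transpose on the other side. -/
theorem IsEPR.matUnit_eq {ψ : Hilb K} (h : IsEPR P Q ψ) (hP : IsMeasurementFamily P)
    (hQ : IsMeasurementFamily Q) (hPQ : ∀ a b, Commute (P a) (Q b)) (x y : Fin 2) :
    matUnit P x y ψ = matUnit Q y x ψ := by
  have h0 := mem_angles zero_mem_angles₀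
  fin_cases x <;> fin_cases y
  · change star (kraus P 0) (kraus P 0 ψ) = star (kraus Q 0) (kraus Q 0 ψ)
    rw [hP.star_kraus_zero_apply, hQ.star_kraus_zero_apply, kraus_zero_apply, kraus_zero_apply,
      hP.apply_apply h0, hQ.apply_apply h0, h.apply_eq 0 h0]
  · exact h.matUnit_zero_one hP hQ hPQ
  · exact (h.symm.matUnit_zero_one hQ hP fun a b => (hPQ b a).symm).symm
  · change star (kraus P 1) (kraus P 1 ψ) = star (kraus Q 1) (kraus Q 1 ψ)
    rw [hP.star_kraus_one_apply, hQ.star_kraus_one_apply, kraus_one_apply, kraus_one_apply,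
      hP.bitFlip_bitFlip, hQ.bitFlip_bitFlip, map_sub, map_sub, hP.apply_apply h0,
      hQ.apply_apply h0, h.apply_eq 0 h0]

theorem inner_pairKet_maxEntangled (a b : ℝ) :
    inner ℂ (pairKet a b) (maxEntangled (Fin 2)) = ((Real.cos (a - b) / Real.sqrt 2 : ℝ) : ℂ) := by
  rw [lp.inner_eq_tsum, tsum_fintype, Fintype.sum_prod_type]
  simp only [pairKet, maxEntangled, ofCoords, qubitCoords, Fin.sum_univ_two, Real.cos_sub]
  simp [← Complex.cos_conj, ← Complex.sin_conj, Complex.conj_ofReal]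
  ring

/-- If the observable of the angle `π/8` is `(Z + X) / √2` on `ψ` and acts on `ψ` like an operator
that commutes with `Z` and `X`, then `Z` and `X` anticommute on `ψ`. -/
theorem mem_good_of_apply_eq {ψ : Hilb K} (hP : IsMeasurementFamily P)
    (hPQ : ∀ a b, Commute (P a) (Q b)) (hψ : P (Real.pi / 8) ψ = Q (Real.pi / 8) ψ)
    (hrel : ((Real.sqrt 2 : ℝ) : ℂ) • ((2 : ℂ) • P (Real.pi / 8) ψ - ψ) =
      (2 : ℂ) • P 0 ψ - ψ + bitFlip P ψ) : ψ ∈ good P := by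
  have h0 := mem_angles zero_mem_angles₀
  have h8 := mem_angles pi_div_eight_mem_angles₀
  set r : ℂ := ((Real.sqrt 2 : ℝ) : ℂ) with hr
  have s2 : r * r = 2 := by
    rw [hr, ← Complex.ofReal_mul, Real.mul_self_sqrt (by norm_num)]
    norm_num
  set D : Op K := (2 : ℂ) • P (Real.pi / 8) - 1 with hD
  set D' : Op K := (2 : ℂ) • Q (Real.pi / 8) - 1 with hD'
  set Z : Op K := (2 : ℂ) • P 0 - 1 with hZ
  set X : Op K := bitFlip P with hX
  have hDψ : D ψ = D' ψ := by
    change (2 : ℂ) • P (Real.pi / 8) ψ - ψ = (2 : ℂ) • Q (Real.pi / 8) ψ - ψ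
    rw [hψ]
  have hrel' : r • D ψ = Z ψ + X ψ := hrel
  have hDD : D (D ψ) = ψ := by
    change (2 : ℂ) • P (Real.pi / 8) ((2 : ℂ) • P (Real.pi / 8) ψ - ψ) -
      ((2 : ℂ) • P (Real.pi / 8) ψ - ψ) = ψ
    rw [map_sub, map_smul, hP.apply_apply h8]
    module
  have hZZ : Z (Z ψ) = ψ := by
    change (2 : ℂ) • P 0 ((2 : ℂ) • P 0 ψ - ψ) - ((2 : ℂ) • P 0 ψ - ψ) = ψ
    rw [map_sub, map_smul, hP.apply_apply h0]
    module
  have hXX : X (X ψ) = ψ := hP.bitFlip_bitFlip ψ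
  have hc : ∀ a, Commute D' (P a) := fun a =>
    ((hPQ a _).symm.smul_left _).sub_left (Commute.one_left _)
  have hcX : ∀ v, D' (X v) = X (D' v) := commute_apply (commute_bitFlip hc)
  have hcZ : ∀ v, D' (Z v) = Z (D' v) :=
    commute_apply (((hc 0).smul_right _).sub_right (Commute.one_right _))
  have hcD : ∀ v, D' (D v) = D (D' v) :=
    commute_apply (((hc _).smul_right _).sub_right (Commute.one_right _))
  -- `2 ψ = (√2 D)² ψ = (Z + X)² ψ`, as one factor `D` can be moved to the other side
  have h2 : (2 : ℂ) • ψ = (2 : ℂ) • ψ + (Z (X ψ) + X (Z ψ)) := by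
    calc (2 : ℂ) • ψ = r • r • D (D ψ) := by rw [hDD, smul_smul, s2]
      _ = r • D' (r • D ψ) := by rw [map_smul, hcD, ← hDψ]
      _ = Z (r • D ψ) + X (r • D ψ) := by
          rw [hrel', map_add, hcX, hcZ, ← hDψ, smul_add, ← map_smul Z,
            ← map_smul X, hrel']
      _ = (2 : ℂ) • ψ + (Z (X ψ) + X (Z ψ)) := by
          rw [hrel', map_add, map_add, hZZ, hXX]
          module
  have h3 : P 0 (X ψ) + X (P 0 ψ) = X ψ := by
    have h4 : (2 : ℂ) • P 0 (X ψ) - X ψ + X ((2 : ℂ) • P 0 ψ - ψ) = 0 := left_eq_add.1 h2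
    rw [map_sub, map_smul] at h4
    have h5 : (2 : ℂ) • (P 0 (X ψ) + X (P 0 ψ) - X ψ) = 0 := by rw [← h4]; module
    exact sub_eq_zero.1 ((smul_eq_zero.1 h5).resolve_left two_ne_zero)
  have h4 : P 0 (X (P 0 ψ)) = 0 := by
    have h5 := congrArg (P 0) h3
    rw [map_add, hP.apply_apply h0] at h5
    exact add_eq_left.1 h5
  refine mem_good.2 ⟨?_, h4, ?_⟩
  · change X (ψ - P 0 ψ) - P 0 (X (ψ - P 0 ψ)) = 0
    have h5 : X ψ - X (P 0 ψ) = P 0 (X ψ) := sub_eq_of_eq_add h3.symm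
    rw [map_sub, h5, hP.apply_apply h0, sub_self]
  · change r • D ψ - Z ψ - X ψ = 0
    rw [hrel']
    abel

/-- The Mayers-Yao argument: the statistics of an EPR pair determine how the measurements act. -/
theorem isEPR_of_norm_sq {ψ : Hilb K} (hP : IsMeasurementFamily P)
    (hQ : IsMeasurementFamily Q) (hPQ : ∀ a b, Commute (P a) (Q b))
    (h : ∀ a ∈ angles, ∀ b ∈ angles, ‖P a (Q b ψ)‖ ^ 2 = Real.cos (a - b) ^ 2 / 2) :
    IsEPR P Q ψ := by
  have hsa : ∀ a ∈ angles, ∀ v w, inner ℂ (P a v) w = inner ℂ v (P a w) := by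
    intro a ha v w
    conv_lhs => rw [← hP.star_eq ha, ContinuousLinearMap.star_eq_adjoint,
      ContinuousLinearMap.adjoint_inner_left]
  have hsb : ∀ a ∈ angles, ∀ v w, inner ℂ (Q a v) w = inner ℂ v (Q a w) := by
    intro a ha v w
    conv_lhs => rw [← hQ.star_eq ha, ContinuousLinearMap.star_eq_adjoint,
      ContinuousLinearMap.adjoint_inner_left]
  have hz : ∀ a, Real.cos (a - (a + Real.pi / 2)) = 0 := by
    intro a
    rw [show a - (a + Real.pi / 2) = -(Real.pi / 2) by ring, Real.cos_neg, Real.cos_pi_div_two]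
  -- the outcomes for the same angle are perfectly correlated
  have eq0 : ∀ a ∈ angles₀, P a ψ = Q a ψ := by
    intro a ha
    have h1 : P a (Q (a + Real.pi / 2) ψ) = 0 := by
      have := h a (mem_angles ha) _ (add_mem_angles ha)
      rw [hz] at this
      simpa using this
    have h2 : P (a + Real.pi / 2) (Q a ψ) = 0 := by
      have := h _ (add_mem_angles ha) a (mem_angles ha)
      rw [← Real.cos_neg, neg_sub, hz] at this
      simpa using this
    rw [hQ.add_apply ha, map_sub, sub_eq_zero] at h1
    rw [hP.add_apply ha, sub_eq_zero] at h2
    rw [h1, ← h2]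
  have eq1 : ∀ a ∈ angles, P a ψ = Q a ψ := by
    rintro a (ha | ⟨a, ha, rfl⟩)
    · exact eq0 a ha
    · simp only [hP.add_apply ha, hQ.add_apply ha, eq0 a ha]
  have gram : ∀ a ∈ angles, ∀ b ∈ angles,
      inner ℂ (P a ψ) (P b ψ) = ((Real.cos (a - b) ^ 2 / 2 : ℝ) : ℂ) := by
    intro a ha b hb
    have e := inner_self_eq_norm_sq_to_K (𝕜 := ℂ) (P a (Q b ψ))
    rw [← h a ha b hb, Complex.ofReal_pow]
    refine Eq.trans ?_ e
    rw [hsa a ha (Q b ψ), hP.apply_apply ha, commute_apply (hPQ a b), hsb b hb,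
      hQ.apply_apply hb, ← commute_apply (hPQ a b), ← hsa a ha, ← eq1 b hb]
  have hself : ∀ a ∈ angles, inner ℂ (P a ψ) ψ = 1 / 2 := by
    intro a ha
    have := gram a ha a ha
    rw [hsa a ha, hP.apply_apply ha, ← hsa a ha] at this
    rw [this]
    simp
  have hself' : ∀ a ∈ angles, inner ℂ ψ (P a ψ) = 1 / 2 := by
    intro a ha
    rw [← hsa a ha, hself a ha]
  have h0 := mem_angles zero_mem_angles₀
  have h8 := mem_angles pi_div_eight_mem_angles₀
  have h4 := mem_angles pi_div_four_mem_angles₀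
  have hnorm : inner ℂ ψ ψ = (1 : ℂ) := by
    have h1 := hself' _ (add_mem_angles zero_mem_angles₀)
    rw [hP.add_apply zero_mem_angles₀, inner_sub_right, hself' 0 h0] at h1
    linear_combination h1
  -- the vectors `A ψ`, for the observables `A = 2 P a - 1`
  have gram' : ∀ a ∈ angles, ∀ b ∈ angles,
      inner ℂ ((2 : ℂ) • P a ψ - ψ) ((2 : ℂ) • P b ψ - ψ) =
        ((Real.cos (2 * (a - b)) : ℝ) : ℂ) := by
    intro a ha b hb
    simp only [inner_sub_left, inner_sub_right, inner_smul_left, inner_smul_right, gram a ha b hb,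
      hself a ha, hself' b hb, hnorm, Real.cos_two_mul]
    simp [map_ofNat]
    ring
  have s2 : ((Real.sqrt 2 : ℝ) : ℂ) * ((Real.sqrt 2 : ℝ) : ℂ) = 2 := by
    rw [← Complex.ofReal_mul, Real.mul_self_sqrt (by norm_num)]
    norm_num
  -- their Gram matrix is that of vectors in a plane at the angles `0`, `π/4` and `π/2`, of which
  -- the second is the normalised sum of the others
  have rel : ((Real.sqrt 2 : ℝ) : ℂ) • ((2 : ℂ) • P (Real.pi / 8) ψ - ψ) -
      ((2 : ℂ) • P 0 ψ - ψ) - ((2 : ℂ) • P (Real.pi / 4) ψ - ψ) = 0 := by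
    rw [← inner_self_eq_zero (𝕜 := ℂ)]
    have c1 : Real.cos (2 * (Real.pi / 8)) = Real.sqrt 2 / 2 := by
      rw [← Real.cos_pi_div_four]; congr 1; ring
    have c2 : Real.cos (2 * (Real.pi / 8 - Real.pi / 4)) = Real.sqrt 2 / 2 := by
      rw [← Real.cos_pi_div_four, ← Real.cos_neg]; congr 1; ring
    have c3 : Real.cos (2 * (Real.pi / 4 - Real.pi / 8)) = Real.sqrt 2 / 2 := by
      rw [← Real.cos_pi_div_four]; congr 1; ring
    have c4 : Real.cos (2 * (Real.pi / 4)) = 0 := by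
      rw [← Real.cos_pi_div_two]; congr 1; ring
    have g00 := gram' _ h0 _ h0
    have g08 := gram' _ h0 _ h8
    have g04 := gram' _ h0 _ h4
    have g80 := gram' _ h8 _ h0
    have g88 := gram' _ h8 _ h8
    have g84 := gram' _ h8 _ h4
    have g40 := gram' _ h4 _ h0
    have g48 := gram' _ h4 _ h8
    have g44 := gram' _ h4 _ h4
    simp only [zero_sub, sub_zero, mul_neg, Real.cos_neg, c1, c2, c3, c4, sub_self, mul_zero,
      Real.cos_zero] at g00 g08 g04 g80 g88 g84 g40 g48 g44
    generalize (2 : ℂ) • P 0 ψ - ψ = z0 at *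
    generalize (2 : ℂ) • P (Real.pi / 8) ψ - ψ = z8 at *
    generalize (2 : ℂ) • P (Real.pi / 4) ψ - ψ = z4 at *
    simp only [inner_sub_left, inner_sub_right, inner_smul_left, inner_smul_right,
      Complex.conj_ofReal, g00, g08, g04, g80, g88, g84, g40, g48, g44]
    push_cast
    linear_combination (-1 : ℂ) * s2
  have rel' : ((Real.sqrt 2 : ℝ) : ℂ) • ((2 : ℂ) • P (Real.pi / 8) ψ - ψ) =
      (2 : ℂ) • P 0 ψ - ψ + bitFlip P ψ := by
    rw [sub_sub, sub_eq_zero] at rel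
    exact rel
  refine ⟨eq1, mem_good_of_apply_eq hP hPQ (eq1 _ h8) rel',
    mem_good_of_apply_eq hQ (fun a b => (hPQ b a).symm) (eq1 _ h8).symm ?_⟩
  rw [bitFlip_apply, eq1 _ h8, eq1 _ h0, eq1 _ h4] at rel'
  exact rel'

end Site

/-! ### Several sites -/

theorem seqProd_eq_zero {M : Type*} [Semiring M] {n : ℕ} {f : Fin n → M} {i : Fin n}
    (h : f i = 0) : seqProd f = 0 := by
  rw [seqProd, List.prod_eq_zero]
  rw [List.mem_ofFn']
  exact ⟨i, h⟩

theorem seqProd_one {M : Type*} [Monoid M] {n : ℕ} : (seqProd fun _ : Fin n => (1 : M)) = 1 := by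
  induction n with
  | zero => exact seqProd_zero _
  | succ n ih => rw [seqProd_succ, ih, one_mul]

/-- The ordered product of a family indexed by a subset of `Fin n`. -/
def subProd {M : Type*} [Monoid M] {n : ℕ} (I : Finset (Fin n)) (g : I → M) : M :=
  seqProd fun i => if h : i ∈ I then g ⟨i, h⟩ else 1

theorem commute_subProd {M : Type*} [Monoid M] {n : ℕ} {I : Finset (Fin n)} {x : M} {g : I → M}
    (h : ∀ i, Commute x (g i)) : Commute x (subProd I g) := by
  refine commute_seqProd fun i => ?_
  split_ifs with hi
  · exact h _
  · exact Commute.one_right x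

theorem subProd_mul {M : Type*} [Monoid M] {n : ℕ} {I : Finset (Fin n)} {f g : I → M}
    (h : ∀ i j, i ≠ j → Commute (f i) (g j)) :
    (subProd I fun i => f i * g i) = subProd I f * subProd I g := by
  rw [subProd, subProd, subProd, ← seqProd_mul]
  · congr 1
    funext i
    split_ifs <;> simp
  · intro i j hij
    split_ifs with h1 h2
    · exact h _ _ fun e => hij (congrArg Subtype.val e)
    · exact Commute.one_right _
    · exact Commute.one_left _
    · exact Commute.one_left _

theorem subProd_star {M : Type*} [Monoid M] [StarMul M] {n : ℕ} {I : Finset (Fin n)} {f : I → M}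
    (h : ∀ i j, i ≠ j → Commute (f i) (f j)) :
    star (subProd I f) = subProd I fun i => star (f i) := by
  rw [subProd, subProd, seqProd_star]
  · congr 1
    funext i
    split_ifs <;> simp
  · intro i j hij
    split_ifs with h1 h2
    · exact h _ _ fun e => hij (congrArg Subtype.val e)
    · exact Commute.one_right _
    · exact Commute.one_left _
    · exact Commute.one_left _

theorem subProd_smul {M : Type*} [Semiring M] [Algebra ℂ M] {n : ℕ} {I : Finset (Fin n)}
    (c : I → ℂ) (f : I → M) : (subProd I fun i => c i • f i) = (∏ i, c i) • subProd I f := by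
  have h : ∏ i, c i = ∏ i : Fin n, if h : i ∈ I then c ⟨i, h⟩ else 1 := by
    refine Fintype.prod_of_injective Subtype.val Subtype.val_injective _ _ (fun i hi => ?_) ?_
    · rw [dif_neg]
      simpa using hi
    · simp
  rw [subProd, subProd, h, ← seqProd_smul]
  congr 1
  funext i
  split_ifs <;> simp

theorem subProd_sum {M κ : Type*} [Semiring M] [Fintype κ] [Nonempty κ] {n : ℕ}
    {I : Finset (Fin n)} (f : I → κ → M) :
    (subProd I fun i => ∑ x, f i x) = ∑ c : I → κ, subProd I fun i => f i (c i) := by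
  classical
  obtain ⟨x₀⟩ := ‹Nonempty κ›
  -- the factors outside `I` are sums with the only nonzero term `1` at `x₀`
  let F : Fin n → κ → M := fun i x => if h : i ∈ I then f ⟨i, h⟩ x else if x = x₀ then 1 else 0
  have h1 : (subProd I fun i => ∑ x, f i x) = seqProd fun i => ∑ x, F i x := by
    rw [subProd]
    congr 1
    funext i
    by_cases h : i ∈ I <;> simp [F, h]
  rw [h1, seqProd_sum]
  let e : (I → κ) → Fin n → κ := fun c i => if h : i ∈ I then c ⟨i, h⟩ else x₀
  refine (Fintype.sum_of_injective e ?_ _ _ ?_ ?_).symm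
  · intro c c' h
    funext i
    have := congrFun h i
    simpa [e] using this
  · intro c hc
    by_contra hne
    refine hc ⟨fun i => c i, ?_⟩
    funext i
    by_cases h : i ∈ I
    · simp [e, h]
    · have : c i = x₀ := by
        by_contra hx
        exact hne (seqProd_eq_zero (i := i) (by simp [F, h, hx]))
      simp [e, h, this]
  · intro c
    rw [subProd]
    congr 1
    funext i
    by_cases h : i ∈ I <;> simp [F, e, h]

theorem subProd_apply_congr {K : Type*} {n : ℕ} {I : Finset (Fin n)} {f g : I → Op K}
    {v : Hilb K} (hfg : ∀ i j, i ≠ j → Commute (f i) (g j))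
    (hgg : ∀ i j, i ≠ j → Commute (g i) (g j)) (hv : ∀ i, f i v = g i v) :
    (subProd I f : Op K) v = (subProd I g : Op K) v := by
  refine seqProd_apply_congr ?_ ?_ ?_
  · intro i j hij
    split_ifs with h1 h2
    · exact hfg _ _ fun e => hij (congrArg Subtype.val e)
    · exact Commute.one_right _
    · exact Commute.one_left _
    · exact Commute.one_left _
  · intro i j hij
    split_ifs with h1 h2
    · exact hgg _ _ fun e => hij (congrArg Subtype.val e)
    · exact Commute.one_right _
    · exact Commute.one_left _
    · exact Commute.one_left _
  · intro i
    split_ifs with h1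
    · exact hv _
    · rfl

theorem subProd_univ {M : Type*} [Monoid M] {n : ℕ} (g : Fin n → M) :
    (subProd Finset.univ fun i : (Finset.univ : Finset (Fin n)) => g i) = seqProd g := by
  simp [subProd]

/-- Measurements on one side, one for each site, such that different sites commute. -/
structure IsSiteFamily {K : Type*} {n : ℕ} (P : Fin n → ℝ → Op K) : Prop where
  meas : ∀ i, IsMeasurementFamily (P i)
  comm : ∀ i j, i ≠ j → ∀ a b, Commute (P i a) (P j b)

/-- The component along `|c⟩` of the tensor product of the swap isometries of all sites. -/
def krausN {K : Type*} {n : ℕ} (P : Fin n → ℝ → Op K) (c : Fin n → Fin 2) : Op K :=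
  seqProd fun i => kraus (P i) (c i)

/-- The physical counterpart of the matrix unit `|c⟩⟨d|` of a register of qubits. -/
def matUnitN {K : Type*} {n : ℕ} (P : Fin n → ℝ → Op K) (c d : Fin n → Fin 2) : Op K :=
  seqProd fun i => matUnit (P i) (c i) (d i)

/-- The vectors that are good at every site. -/
def goodN {K : Type*} {n : ℕ} (P : Fin n → ℝ → Op K) : Submodule ℂ (Hilb K) := ⨅ i, good (P i)

theorem mem_goodN {K : Type*} {n : ℕ} {P : Fin n → ℝ → Op K} {v : Hilb K} :
    v ∈ goodN P ↔ ∀ i, v ∈ good (P i) := Submodule.mem_iInf _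

theorem apply_mem_goodN {K : Type*} {n : ℕ} {P : Fin n → ℝ → Op K} {Y : Op K}
    (h : ∀ i a, Commute Y (P i a)) {v : Hilb K} (hv : v ∈ goodN P) : Y v ∈ goodN P :=
  mem_goodN.2 fun i => apply_mem_good (h i) (mem_goodN.1 hv i)

theorem commute_krausN {K : Type*} {n : ℕ} {P : Fin n → ℝ → Op K} {Y : Op K}
    (h : ∀ i a, Commute Y (P i a)) (c : Fin n → Fin 2) : Commute Y (krausN P c) :=
  commute_seqProd fun i => commute_kraus (h i) (c i)

/-- The physical counterpart of a matrix on a register of qubits. -/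
def rep {K : Type*} {n : ℕ} (P : Fin n → ℝ → Op K)
    (σ : Matrix (Fin n → Fin 2) (Fin n → Fin 2) ℂ) : Op K :=
  ∑ c, ∑ d, σ c d • matUnitN P c d

section OneSide

variable {K : Type*} {n : ℕ} {P : Fin n → ℝ → Op K}

theorem IsSiteFamily.commute_matUnitN (hP : IsSiteFamily P) {Y : Op K}
    (h : ∀ i a, Commute Y (P i a)) (c d : Fin n → Fin 2) : Commute Y (matUnitN P c d) :=
  commute_seqProd fun i => (hP.meas i).commute_matUnit (h i) _ _

theorem IsSiteFamily.commute_rep (hP : IsSiteFamily P) {Y : Op K}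
    (h : ∀ i a, Commute Y (P i a)) (σ : Matrix (Fin n → Fin 2) (Fin n → Fin 2) ℂ) :
    Commute Y (rep P σ) :=
  Commute.sum_right _ _ _ fun c _ => Commute.sum_right _ _ _ fun d _ =>
    (hP.commute_matUnitN h c d).smul_right _

theorem IsSiteFamily.kraus_kraus (hP : IsSiteFamily P) {i j : Fin n} (hij : i ≠ j) (x y : Fin 2) :
    Commute (kraus (P i) x) (kraus (P j) y) :=
  commute_kraus (fun b => (commute_kraus (fun a => (hP.comm i j hij a b).symm) x).symm) y

theorem IsSiteFamily.star_kraus_kraus (hP : IsSiteFamily P) {i j : Fin n} (hij : i ≠ j)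
    (x y : Fin 2) : Commute (star (kraus (P i) x)) (kraus (P j) y) :=
  ((hP.meas i).commute_star_kraus
    (fun a => (commute_kraus (fun b => hP.comm i j hij a b) y).symm) x).symm

theorem IsSiteFamily.kraus_matUnit_comm (hP : IsSiteFamily P) {i j : Fin n} (hij : i ≠ j)
    (z x y : Fin 2) : Commute (kraus (P i) z) (matUnit (P j) x y) :=
  (hP.star_kraus_kraus hij.symm x z).symm.mul_right (hP.kraus_kraus hij z y)

theorem IsSiteFamily.matUnit_matUnit (hP : IsSiteFamily P) {i j : Fin n} (hij : i ≠ j)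
    (z w x y : Fin 2) : Commute (matUnit (P i) z w) (matUnit (P j) x y) :=
  (hP.meas j).commute_matUnit
    (fun b => ((hP.meas i).commute_matUnit (fun a => (hP.comm i j hij a b).symm) z w).symm) x y

theorem IsSiteFamily.krausAt_krausAt (hP : IsSiteFamily P) {i j : Fin n} (hij : i ≠ j)
    (a b : ℝ) : Commute (krausAt (P i) a) (krausAt (P j) b) :=
  commute_krausAt (fun t => (commute_krausAt (fun s => (hP.comm i j hij s t).symm) a).symm) b

theorem IsSiteFamily.star_krausAt_krausAt (hP : IsSiteFamily P) {i j : Fin n} (hij : i ≠ j)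
    (a b : ℝ) : Commute (star (krausAt (P i) a)) (krausAt (P j) b) := by
  refine commute_krausAt (fun t => ?_) b
  simp only [krausAt, star_sum, star_smul]
  refine Commute.sum_left _ _ _ fun x _ => Commute.smul_left ?_ _
  exact ((hP.meas i).commute_star_kraus (fun s => (hP.comm i j hij s t).symm) x).symm

theorem IsSiteFamily.matUnitN_eq (hP : IsSiteFamily P) (c d : Fin n → Fin 2) :
    matUnitN P c d = star (krausN P c) * krausN P d := by
  rw [krausN, krausN, seqProd_star fun i j hij => hP.kraus_kraus hij _ _, ← seqProd_mul]
  · rfl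
  · exact fun i j hij => hP.star_kraus_kraus hij _ _

theorem IsSiteFamily.krausN_matUnitN (hP : IsSiteFamily P) {v : Hilb K} (hv : v ∈ goodN P)
    (e c d : Fin n → Fin 2) :
    krausN P e (matUnitN P c d v) = (if e = c then (1 : ℂ) else 0) • krausN P d v := by
  have h1 : krausN P e * matUnitN P c d =
      seqProd fun i => kraus (P i) (e i) * matUnit (P i) (c i) (d i) :=
    (seqProd_mul fun i j hij => hP.kraus_matUnit_comm hij _ _ _).symm
  have h2 : (if e = c then (1 : ℂ) else 0) • krausN P d =
      seqProd fun i => (if e i = c i then (1 : ℂ) else 0) • kraus (P i) (d i) := by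
    rw [seqProd_smul, Finset.prod_ite_zero]
    simp [funext_iff, krausN]
  rw [← op_mul_apply, h1, ← op_smul_apply, h2]
  refine seqProd_apply_congr (fun i j hij => ?_) (fun i j hij => ?_) fun i => ?_
  · exact (((hP.kraus_kraus hij _ _).mul_left
      ((hP.kraus_matUnit_comm hij.symm _ _ _).symm)).smul_right _)
  · exact ((hP.kraus_kraus hij _ _).smul_right _).smul_left _
  · exact (hP.meas i).kraus_matUnit (mem_goodN.1 hv i) _ _ _

theorem IsSiteFamily.sum_star_krausN (hP : IsSiteFamily P) :
    ∑ c, star (krausN P c) * krausN P c = 1 := by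
  have h : ∀ i, ∑ x, matUnit (P i) x x = 1 := fun i => (hP.meas i).sum_star_kraus_mul_kraus
  simp only [← hP.matUnitN_eq, matUnitN]
  rw [← seqProd_sum fun i x => matUnit (P i) x x]
  simp only [h, seqProd_one]

/-- The swap isometry is injective. -/
theorem IsSiteFamily.eq_of_krausN_eq (hP : IsSiteFamily P) {v w : Hilb K}
    (h : ∀ c, krausN P c v = krausN P c w) : v = w := by
  have key : ∀ u : Hilb K, u = ∑ c, star (krausN P c) (krausN P c u) := by
    intro u
    conv_lhs => rw [← one_apply_op u, ← hP.sum_star_krausN]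
    simp
  rw [key v, key w]
  simp only [h]

/-- On good vectors, the swap isometry intertwines `rep P σ` with the matrix `σ`. -/
theorem IsSiteFamily.krausN_rep (hP : IsSiteFamily P) {v : Hilb K} (hv : v ∈ goodN P)
    (σ : Matrix (Fin n → Fin 2) (Fin n → Fin 2) ℂ) (e : Fin n → Fin 2) :
    krausN P e (rep P σ v) = ∑ d, σ e d • krausN P d v := by
  have h : rep P σ v = ∑ c, ∑ d, σ c d • matUnitN P c d v := by
    simp [rep]
  rw [h]
  simp only [map_sum, map_smul, hP.krausN_matUnitN hv]
  rw [Finset.sum_comm]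
  simp

/-- On good vectors, the projector of an outcome is a positive operator built from the component of
the swap isometries along the state of that outcome. -/
theorem IsSiteFamily.subProd_apply (hP : IsSiteFamily P) {v : Hilb K} (hv : v ∈ goodN P)
    (I : Finset (Fin n)) (a : I → angles) :
    (subProd I fun i => P i (a i) : Op K) v =
      (star (subProd I fun i => krausAt (P i) (a i) : Op K) *
        (subProd I fun i => krausAt (P i) (a i) : Op K)) v := by
  have hne : ∀ {i j : I}, i ≠ j → (i : Fin n) ≠ j := fun h e => h (Subtype.ext e)
  rw [subProd_star fun i j hij => hP.krausAt_krausAt (hne hij) _ _,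
    ← subProd_mul fun i j hij => hP.star_krausAt_krausAt (hne hij) _ _]
  have hc : ∀ {i j : I}, i ≠ j → ∀ s t, Commute (P i s) (krausAt (P j) t) :=
    fun hij s t => commute_krausAt (fun b => hP.comm _ _ (hne hij) s b) t
  have hc' : ∀ {i j : I}, i ≠ j → ∀ s ∈ angles, ∀ t, Commute (P i s) (star (krausAt (P j) t)) := by
    intro i j hij s hs t
    rw [← (hP.meas i).star_eq hs]
    exact (hc hij s t).star_star
  refine subProd_apply_congr (fun i j hij => ?_) (fun i j hij => ?_) fun i => ?_
  · exact (hc' hij _ (a i).2 _).mul_right (hc hij _ _)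
  · have h1 := hP.star_krausAt_krausAt (hne hij) (a i) (a j)
    have h2 := hP.star_krausAt_krausAt (hne hij.symm) (a j) (a i)
    have h3 := hP.krausAt_krausAt (hne hij) (a i) (a j)
    exact (h3.star_star.mul_right h1).mul_left (h2.symm.mul_right h3)
  · exact (hP.meas i).apply_eq_krausAt (mem_goodN.1 hv i) (a i).2

theorem IsSiteFamily.isStarProjection_subProd (hP : IsSiteFamily P)
    (I : Finset (Fin n)) (a : I → angles) :
    IsStarProjection (subProd I fun i => P i (a i) : Op K) := by
  have hc : ∀ i j : I, i ≠ j → Commute (P i (a i)) (P j (a j)) :=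
    fun i j hij => hP.comm _ _ (fun e => hij (Subtype.ext e)) _ _
  refine ⟨?_, ?_⟩
  · rw [IsIdempotentElem, ← subProd_mul hc]
    simp only [((hP.meas _).proj _ (a _).2).isIdempotentElem.eq]
  · rw [IsSelfAdjoint, subProd_star hc]
    simp only [((hP.meas _).star_eq (a _).2)]

theorem subProd_krausAt (I : Finset (Fin n)) (a : I → ℝ) :
    (subProd I fun i => krausAt (P i) (a i) : Op K) =
      ∑ c : I → Fin 2, (∏ i, qubitCoords (a i) (c i)) • subProd I fun i => kraus (P i) (c i) := by
  simp only [krausAt]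
  rw [subProd_sum fun (i : I) x => qubitCoords (a i) x • kraus (P i) x]
  simp only [subProd_smul]

end OneSide

/-! ### Two sides: how a gate acts on a register of EPR pairs -/

theorem norm_apply_eq_of_projection {K : Type*} {R k : Op K} (hR : IsStarProjection R)
    {v : Hilb K} (h : R v = (star k * k) v) : ‖R v‖ = ‖k v‖ := by
  have h1 : inner ℂ (R v) (R v) = inner ℂ (k v) (k v) := by
    have e1 : inner ℂ (R v) (R v) = inner ℂ v (R v) := by
      conv_lhs => rw [← hR.isSelfAdjoint.star_eq, ContinuousLinearMap.star_eq_adjoint,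
        ContinuousLinearMap.adjoint_inner_left, ← ContinuousLinearMap.star_eq_adjoint,
        hR.isSelfAdjoint.star_eq, ← op_mul_apply, hR.isIdempotentElem.eq]
    rw [e1, h, op_mul_apply, ContinuousLinearMap.star_eq_adjoint,
      ContinuousLinearMap.adjoint_inner_right]
  rw [inner_self_eq_norm_sq_to_K, inner_self_eq_norm_sq_to_K] at h1
  have h2 : ‖R v‖ ^ 2 = ‖k v‖ ^ 2 := by exact_mod_cast h1
  exact (sq_eq_sq₀ (norm_nonneg _) (norm_nonneg _)).1 h2

/-- `exists_eq_smul_of_norm_eq` for a bipartite register of qubits. -/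
theorem exists_eq_smul_of_norm_eq₂ {E J : Type*} [NormedAddCommGroup E]
    [InnerProductSpace ℂ E] [Fintype J] [DecidableEq J] (f : (J → Fin 2) → (J → Fin 2) → E)
    (g : (J → Fin 2) → (J → Fin 2) → ℝ)
    (h : ∀ a b : J → angles,
      ‖∑ c, ∑ d, ((∏ i, qubitCoords (a i) (c i)) * ∏ i, qubitCoords (b i) (d i)) • f c d‖ =
      ‖∑ c, ∑ d, ((∏ i, qubitCoords (a i) (c i)) * ∏ i, qubitCoords (b i) (d i)) *
        (g c d : ℂ)‖) :
    ∃ χ : E, ∀ c d, f c d = (g c d : ℂ) • χ := by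
  let e : Fin (Fintype.card (J ⊕ J)) ≃ J ⊕ J := (Fintype.equivFin _).symm
  let ε : (Fin (Fintype.card (J ⊕ J)) → Fin 2) ≃ (J → Fin 2) × (J → Fin 2) :=
    (e.arrowCongr (Equiv.refl _)).trans (Equiv.sumArrowEquivProdArrow J J (Fin 2))
  have hp : ∀ (a : Fin (Fintype.card (J ⊕ J)) → angles) (c d : J → Fin 2),
      ∏ i, qubitCoords (a i) (ε.symm (c, d) i) =
        (∏ j, qubitCoords (a (e.symm (Sum.inl j))) (c j)) *
          ∏ j, qubitCoords (a (e.symm (Sum.inr j))) (d j) := by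
    intro a c d
    rw [← e.symm.prod_comp, Fintype.prod_sum_type]
    simp [ε, Equiv.sumArrowEquivProdArrow]
  obtain ⟨χ, hχ⟩ := exists_eq_smul_of_norm_eq (fun x => f (ε x).1 (ε x).2)
    (fun x => g (ε x).1 (ε x).2) fun a => by
      have := h (fun j => a (e.symm (Sum.inl j))) fun j => a (e.symm (Sum.inr j))
      rw [← ε.symm.sum_comp, ← ε.symm.sum_comp, Fintype.sum_prod_type, Fintype.sum_prod_type]
      simpa only [hp, Equiv.apply_symm_apply] using this
  refine ⟨χ, fun c d => ?_⟩
  simpa using hχ (ε.symm (c, d))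

section TwoSides

variable {K : Type*} {n : ℕ} {PA PB : Fin n → ℝ → Op K}

theorem commute_krausN_krausN (hAB : ∀ i j a b, Commute (PA i a) (PB j b))
    (c d : Fin n → Fin 2) : Commute (krausN PA c) (krausN PB d) :=
  commute_krausN (fun j b => (commute_krausN (fun i a => (hAB i j a b).symm) c).symm) d

/-- On EPR pairs, the counterpart of a matrix on one side acts as that of the transposed matrix on
the other side. -/
theorem rep_apply_eq (hA : IsSiteFamily PA) (hB : IsSiteFamily PB)
    (hAB : ∀ i j a b, Commute (PA i a) (PB j b)) {φ : Hilb K}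
    (hφ : ∀ i, IsEPR (PA i) (PB i) φ) (σ : Matrix (Fin n → Fin 2) (Fin n → Fin 2) ℂ) :
    rep PA σ φ = rep PB σ.transpose φ := by
  have h : ∀ c d, matUnitN PA c d φ = matUnitN PB d c φ := by
    intro c d
    refine seqProd_apply_congr (fun i j _ => ?_) (fun i j hij => hB.matUnit_matUnit hij _ _ _ _)
      fun i => (hφ i).matUnit_eq (hA.meas i) (hB.meas i) (hAB i i) _ _
    exact (hB.meas j).commute_matUnit
      (fun b => ((hA.meas i).commute_matUnit (fun a => (hAB i j a b).symm) _ _).symm) _ _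
  have e1 : rep PA σ φ = ∑ c, ∑ d, σ c d • matUnitN PA c d φ := by simp [rep]
  have e2 : rep PB σ.transpose φ = ∑ d, ∑ c, σ c d • matUnitN PB d c φ := by
    simp [rep, Matrix.transpose_apply]
  rw [e1, e2, Finset.sum_comm]
  simp only [h]

/-- On an EPR pair, the two swap isometries produce an EPR pair of logical qubits. -/
theorem IsEPR.kraus_kraus {P Q : ℝ → Op K} {ψ : Hilb K} (h : IsEPR P Q ψ)
    (hP : IsMeasurementFamily P) (hQ : IsMeasurementFamily Q)
    (hPQ : ∀ a b, Commute (P a) (Q b)) (x y : Fin 2) :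
    kraus P x (kraus Q y ψ) = (if x = y then (1 : ℂ) else 0) • kraus P 0 (kraus Q 0 ψ) := by
  have hc : ∀ z w v, kraus P z (kraus Q w v) = kraus Q w (kraus P z v) := fun z w v =>
    commute_apply (commute_kraus
      (fun b => (commute_kraus (fun a => (hPQ a b).symm) z).symm) w) v
  have h1 : kraus Q y ψ = kraus Q 0 (matUnit Q 0 y ψ) := by
    have := hQ.kraus_matUnit h.right 0 0 y
    simpa using this.symm
  rw [h1, ← h.matUnit_eq hP hQ hPQ y 0, hc]
  have h2 := hP.kraus_matUnit h.left x y 0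
  rw [op_mul_apply] at h2
  rw [h2, map_smul, ← hc]

/-- The statistics of the outcomes on the sites in `I` determine the components of the swapped
state along these sites. -/
theorem exists_subProd_kraus_eq (hA : IsSiteFamily PA) (hB : IsSiteFamily PB)
    (hAB : ∀ i j a b, Commute (PA i a) (PB j b)) {I : Finset (Fin n)} {ψ : Hilb K}
    (hgA : ψ ∈ goodN PA) (hgB : ψ ∈ goodN PB) (g : (I → Fin 2) → (I → Fin 2) → ℝ)
    (hstat : ∀ a b : I → angles,
      ‖(subProd I fun i => PA i (a i) : Op K) ((subProd I fun i => PB i (b i) : Op K) ψ)‖ =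
      ‖∑ c, ∑ d, ((∏ i, qubitCoords (a i) (c i)) * ∏ i, qubitCoords (b i) (d i)) *
        (g c d : ℂ)‖) :
    ∃ χ : Hilb K, ∀ c d, (subProd I fun i => kraus (PA i) (c i) : Op K)
      ((subProd I fun i => kraus (PB i) (d i) : Op K) ψ) = (g c d : ℂ) • χ := by
  refine exists_eq_smul_of_norm_eq₂ _ g fun a b => ?_
  rw [← hstat a b]
  have pA := hA.isStarProjection_subProd I a
  have pB := hB.isStarProjection_subProd I b
  have eA := fun (v : Hilb K) (hv : v ∈ goodN PA) => hA.subProd_apply hv I a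
  have eB := fun (v : Hilb K) (hv : v ∈ goodN PB) => hB.subProd_apply hv I b
  have hk := subProd_krausAt (P := PA) I fun i => (a i : ℝ)
  have hl := subProd_krausAt (P := PB) I fun i => (b i : ℝ)
  have hcA : ∀ (j : Fin n) (t : ℝ),
      Commute (subProd I fun i => krausAt (PA i) (a i) : Op K) (PB j t) := by
    intro j t
    refine Commute.symm (commute_subProd fun i => commute_krausAt (fun s => ?_) _)
    exact (hAB i j s t).symm
  have hcB : ∀ (i : Fin n) (s : ℝ), Commute (subProd I fun j => PB j (b j) : Op K) (PA i s) := by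
    intro i s
    exact Commute.symm (commute_subProd fun j => hAB i j s _)
  have hcAB : Commute (subProd I fun i => krausAt (PA i) (a i) : Op K)
      (subProd I fun j => PB j (b j) : Op K) := commute_subProd fun j => hcA j _
  have hcc : ∀ c d : I → Fin 2, Commute (subProd I fun i => kraus (PA i) (c i) : Op K)
      (subProd I fun j => kraus (PB j) (d j) : Op K) := by
    intro c d
    refine commute_subProd fun j => commute_kraus (fun t => ?_) _
    refine Commute.symm (commute_subProd fun i => commute_kraus (fun s => ?_) _)
    exact (hAB i j s t).symm
  generalize (subProd I fun i => PA i (a i) : Op K) = RA at *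
  generalize (subProd I fun i => PB i (b i) : Op K) = RB at *
  generalize (subProd I fun i => krausAt (PA i) (a i) : Op K) = kA at *
  generalize (subProd I fun i => krausAt (PB i) (b i) : Op K) = kB at *
  rw [norm_apply_eq_of_projection pA (eA _ (apply_mem_goodN hcB hgA)), commute_apply hcAB,
    norm_apply_eq_of_projection pB (eB _ (apply_mem_goodN hcA hgB)), hk, hl]
  congr 1
  simp only [sum_apply, op_smul_apply, map_sum, map_smul, Finset.smul_sum, smul_smul]
  refine Finset.sum_congr rfl fun c _ => Finset.sum_congr rfl fun d _ => ?_
  rw [commute_apply (hcc c d), mul_comm]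

/-- The matrix of a gate that acts as `g` on the qubits in `I` and as the identity on the others. -/
def extendMatrix {n : ℕ} (I : Finset (Fin n)) (g : (I → Fin 2) → (I → Fin 2) → ℂ) :
    Matrix (Fin n → Fin 2) (Fin n → Fin 2) ℂ :=
  fun c d => if ∀ i ∉ I, c i = d i then g (fun i => c i) (fun i => d i) else 0

/-- If the components along the sites in `I` are those of a gate applied to EPR pairs, and the other
sites contain EPR pairs, then the components along all sites are those of the extended gate. -/
theorem exists_krausN_eq (hA : IsSiteFamily PA) (hB : IsSiteFamily PB)
    (hAB : ∀ i j a b, Commute (PA i a) (PB j b)) {I : Finset (Fin n)} {ψ χ : Hilb K}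
    (hI : ∀ i ∉ I, IsEPR (PA i) (PB i) ψ) (g : (I → Fin 2) → (I → Fin 2) → ℂ)
    (hχ : ∀ c d, (subProd I fun i => kraus (PA i) (c i) : Op K)
      ((subProd I fun i => kraus (PB i) (d i) : Op K) ψ) = g c d • χ) :
    ∃ χ' : Hilb K, ∀ c d, krausN PA c (krausN PB d ψ) = extendMatrix I g c d • χ' := by
  have hcAB : ∀ i j x y, Commute (kraus (PA i) x) (kraus (PB j) y) := fun i j x y =>
    commute_kraus (fun t => Commute.symm (commute_kraus (fun s => (hAB i j s t).symm) x)) y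
  have hcA : ∀ i j, i ≠ j → ∀ x y, Commute (kraus (PA i) x) (kraus (PA j) y) :=
    fun i j hij x y => hA.kraus_kraus hij x y
  have hcB : ∀ i j, i ≠ j → ∀ x y, Commute (kraus (PB i) x) (kraus (PB j) y) :=
    fun i j hij x y => hB.kraus_kraus hij x y
  have hkk : ∀ i j, i ≠ j → ∀ x y z w, Commute (kraus (PA i) x * kraus (PB i) y)
      (kraus (PA j) z * kraus (PB j) w) := fun i j hij x y z w =>
    ((hcA i j hij x z).mul_right (hcAB i j x w)).mul_left
      ((hcAB j i z y).symm.mul_right (hcB i j hij y w))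
  -- the sites outside `I` contribute a scalar `δ i` and the operator `h i`
  let h : Fin n → Op K := fun i => if i ∈ I then 1 else kraus (PA i) 0 * kraus (PB i) 0
  refine ⟨(seqProd h : Op K) χ, fun c d => ?_⟩
  let δ : Fin n → ℂ := fun i => if i ∈ I then 1 else if c i = d i then 1 else 0
  let a : Fin n → Op K := fun i => if i ∈ I then kraus (PA i) (c i) else 1
  let b : Fin n → Op K := fun i => if i ∈ I then kraus (PB i) (d i) else 1
  have h1 : krausN PA c * krausN PB d = seqProd fun i => kraus (PA i) (c i) * kraus (PB i) (d i) :=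
    (seqProd_mul fun i j _ => hcAB i j _ _).symm
  have h2 : (seqProd fun i => kraus (PA i) (c i) * kraus (PB i) (d i) : Op K) ψ =
      (seqProd fun i => δ i • (h i * (a i * b i)) : Op K) ψ := by
    have e : ∀ i, δ i • (h i * (a i * b i)) = if i ∈ I then kraus (PA i) (c i) * kraus (PB i) (d i)
        else (if c i = d i then (1 : ℂ) else 0) • (kraus (PA i) 0 * kraus (PB i) 0) := by
      intro i
      by_cases hi : i ∈ I <;> simp [δ, h, a, b, hi]
    simp only [e]
    refine seqProd_apply_congr (fun i j hij => ?_) (fun i j hij => ?_) fun i => ?_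
    · split_ifs
      · exact hkk i j hij _ _ _ _
      · exact (hkk i j hij _ _ _ _).smul_right _
      · exact (hkk i j hij _ _ _ _).smul_right _
    · have hs : ∀ x y z w (r s : ℂ), Commute (r • (kraus (PA i) x * kraus (PB i) y))
          (s • (kraus (PA j) z * kraus (PB j) w)) := fun x y z w r s =>
        ((hkk i j hij x y z w).smul_right s).smul_left r
      split_ifs
      all_goals first
        | exact hkk i j hij _ _ _ _
        | exact (hkk i j hij _ _ _ _).smul_right _
        | exact (hkk i j hij _ _ _ _).smul_left _
        | exact hs _ _ _ _ _ _
    · split_ifs with hi hcd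
      · rfl
      · simpa [hcd] using (hI i hi).kraus_kraus (hA.meas i) (hB.meas i) (hAB i i) (c i) (d i)
      · simpa [hcd] using (hI i hi).kraus_kraus (hA.meas i) (hB.meas i) (hAB i i) (c i) (d i)
  have h3 : (seqProd fun i => δ i • (h i * (a i * b i)) : Op K) =
      (∏ i, δ i) • (seqProd h * (seqProd a * seqProd b)) := by
    rw [seqProd_smul, seqProd_mul, seqProd_mul]
    · intro i j _
      by_cases hi : i ∈ I <;> by_cases hj : j ∈ I <;> simp [a, b, hi, hj, hcAB]
    · intro i j hij
      by_cases hi : i ∈ I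
      · simp [h, hi]
      · by_cases hj : j ∈ I
        · simpa [h, a, b, hi, hj] using hkk i j hij _ _ _ _
        · simp [a, b, hj]
  have h4 : ∏ i, δ i = if ∀ i ∉ I, c i = d i then 1 else 0 := by
    have : ∀ i, δ i = if i ∉ I → c i = d i then 1 else 0 := by
      intro i
      by_cases hi : i ∈ I <;> simp [δ, hi]
    simp only [this, Finset.prod_ite_zero]
    simp
  have h5 : seqProd a = subProd I fun i => kraus (PA i) (c i) := rfl
  have h6 : seqProd b = subProd I fun i => kraus (PB i) (d i) := rfl
  rw [← op_mul_apply, h1, h2, h3, op_smul_apply, op_mul_apply, op_mul_apply, h5, h6,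
    hχ (fun i => c i) (fun i => d i), map_smul, smul_smul, h4, extendMatrix]
  split_ifs <;> simp

/-- Components of the form `M (|Φ⁺⟩ ⊗ χ)` yield the intertwining relation of a gate on one side. -/
theorem rep_gate_apply (hA : IsSiteFamily PA) (hB : IsSiteFamily PB)
    (hAB : ∀ i j a b, Commute (PA i a) (PB j b)) {G : Op K} (hG : ∀ i a, Commute G (PB i a))
    {φ χ : Hilb K} (hφ : ∀ i, IsEPR (PA i) (PB i) φ) (hgA : G φ ∈ goodN PA)
    (M : Matrix (Fin n → Fin 2) (Fin n → Fin 2) ℂ) (hM : M * M.conjTranspose = 1)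
    (hχ : ∀ c d, krausN PA c (krausN PB d (G φ)) = M c d • χ)
    (σ : Matrix (Fin n → Fin 2) (Fin n → Fin 2) ℂ) :
    rep PA σ (G φ) = G (rep PA (M.conjTranspose * σ * M) φ) := by
  have hgB : G φ ∈ goodN PB := apply_mem_goodN hG (mem_goodN.2 fun i => (hφ i).right)
  have hcR : ∀ d v, krausN PB d (rep PA σ v) = rep PA σ (krausN PB d v) := fun d v =>
    commute_apply (hA.commute_rep (fun i a =>
      Commute.symm (commute_krausN (fun j b => hAB i j a b) d)) σ) v
  have hAv : ∀ d, krausN PB d (G φ) ∈ goodN PA := fun d =>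
    apply_mem_goodN (fun i a => Commute.symm (commute_krausN (fun j b => hAB i j a b) d)) hgA
  -- the matrix on the right is moved to the `B` side, past the gate, before components are compared
  rw [rep_apply_eq hA hB hAB hφ, commute_apply (hB.commute_rep hG _)]
  refine hB.eq_of_krausN_eq fun y => hA.eq_of_krausN_eq fun x => ?_
  rw [hcR, hA.krausN_rep (hAv y), hB.krausN_rep hgB, map_sum]
  simp only [map_smul, hχ, smul_smul, ← Finset.sum_smul, Matrix.transpose_apply]
  congr 1
  have h1 : ∑ d, σ x d * M d y = (σ * M) x y := rfl
  have h2 : ∑ d, (M.conjTranspose * σ * M) d y * M x d = (σ * M) x y := by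
    have : (M * (M.conjTranspose * σ * M)) x y = (σ * M) x y := by
      rw [← Matrix.mul_assoc, ← Matrix.mul_assoc, hM, Matrix.one_mul]
    rw [← this, Matrix.mul_apply]
    exact Finset.sum_congr rfl fun d _ => mul_comm _ _
  rw [h1, h2]

/-- Conversely, the intertwining relation determines the components up to a single vector. -/
theorem exists_krausN_eq_of_rep (hA : IsSiteFamily PA) (hB : IsSiteFamily PB)
    (hAB : ∀ i j a b, Commute (PA i a) (PB j b)) {G : Op K} (hG : ∀ i a, Commute G (PB i a))
    {φ : Hilb K} (hφ : ∀ i, IsEPR (PA i) (PB i) φ) (hgA : G φ ∈ goodN PA)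
    (M : Matrix (Fin n → Fin 2) (Fin n → Fin 2) ℂ)
    (hrel : ∀ σ, rep PA σ (G φ) = G (rep PA (M.conjTranspose * σ * M) φ)) :
    ∃ χ : Hilb K, ∀ c d, krausN PA c (krausN PB d (G φ)) = M c d • χ := by
  have hgB : G φ ∈ goodN PB := apply_mem_goodN hG (mem_goodN.2 fun i => (hφ i).right)
  have hc : ∀ c d v, krausN PA c (krausN PB d v) = krausN PB d (krausN PA c v) :=
    fun c d v => commute_apply (commute_krausN_krausN hAB c d) v
  let o : Fin n → Fin 2 := fun _ => 0
  refine ⟨∑ d, star (M o d) • krausN PA o (krausN PB d (G φ)), fun c y => ?_⟩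
  -- the matrix unit `|o⟩⟨c|` moves the component along `|c⟩` to that along `|o⟩`
  have h1 := hrel (Matrix.single o c 1)
  rw [rep_apply_eq hA hB hAB hφ, commute_apply (hB.commute_rep hG _)] at h1
  have h2 := congrArg (fun v => krausN PB y (krausN PA o v)) h1
  simp only [hA.krausN_rep hgA] at h2
  rw [← hc o y (rep PB _ (G φ)), hB.krausN_rep hgB] at h2
  have h3 : ∀ d, (M.conjTranspose * Matrix.single o c (1 : ℂ) * M) d y = star (M o d) * M c y := by
    intro d
    simp [Matrix.mul_apply, Matrix.single_apply, ite_and]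
  simp only [Matrix.transpose_apply, h3, Matrix.single_apply] at h2
  simp only [true_and, ite_smul, one_smul, zero_smul, Finset.sum_ite_eq, Finset.mem_univ, if_true,
    map_sum, map_smul] at h2
  rw [hc, h2, Finset.smul_sum]
  refine Finset.sum_congr rfl fun d _ => ?_
  rw [smul_smul, mul_comm]

/-- An injective operator that commutes with the measurements reflects good vectors. -/
theorem mem_goodN_of_apply_mem {P : Fin n → ℝ → Op K} {Y : Op K} (h : ∀ i a, Commute Y (P i a))
    (hY : Function.Injective Y) {v : Hilb K} (hv : Y v ∈ goodN P) : v ∈ goodN P := by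
  refine mem_goodN.2 fun i => ?_
  have hX := commute_bitFlip (h i)
  have h1 := Commute.one_right Y
  have key : ∀ R : Op K, Commute Y R → R (Y v) = 0 → R v = 0 := by
    intro R hR hv
    refine hY ?_
    rw [commute_apply hR, hv, map_zero]
  obtain ⟨ha, hb, hc⟩ := mem_good.1 (mem_goodN.1 hv i)
  refine mem_good.2 ⟨key _ ?_ ha, key _ ?_ hb, key _ ?_ hc⟩
  · exact ((h1.sub_right (h i 0)).mul_right hX).mul_right (h1.sub_right (h i 0))
  · exact ((h i 0).mul_right hX).mul_right (h i 0)
  · exact ((((((h i _).smul_right _).sub_right h1).smul_right _).sub_right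
      (((h i _).smul_right _).sub_right h1)).sub_right hX)

end TwoSides

/-! ### Sequences of gates -/

theorem compUpTo_zero {X : Type*} {t : ℕ} (g : Fin t → Op X) : compUpTo g 0 = 1 := rfl

theorem compUpTo_succ {X : Type*} {t : ℕ} (g : Fin t → Op X) (j : Fin t) :
    compUpTo g j.succ = g j * compUpTo g j.castSucc := by
  simp [compUpTo, Fin.induction_succ]

theorem commute_compUpTo {X : Type*} {t : ℕ} {g : Fin t → Op X} {Y : Op X}
    (h : ∀ j, Commute Y (g j)) (j : Fin (t + 1)) : Commute Y (compUpTo g j) := by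
  induction j using Fin.induction with
  | zero => exact Commute.one_right Y
  | succ j ih => rw [compUpTo_succ]; exact (h j).mul_right ih

theorem compUpTo_injective {X : Type*} {t : ℕ} {g : Fin t → Op X}
    (h : ∀ j, Function.Injective (g j)) (j : Fin (t + 1)) : Function.Injective (compUpTo g j) := by
  induction j using Fin.induction with
  | zero => exact fun _ _ e => e
  | succ j ih => rw [compUpTo_succ]; exact (h j).comp ih

theorem map_compUpTo {X Y : Type*} {t : ℕ} (φ : Op X →⋆ₐ[ℂ] Op Y) (g : Fin t → Op X)
    (j : Fin (t + 1)) : φ (compUpTo g j) = compUpTo (fun k => φ (g k)) j := by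
  induction j using Fin.induction with
  | zero => simp [compUpTo_zero]
  | succ j ih => rw [compUpTo_succ, compUpTo_succ, map_mul, ih]

theorem compUpTo_mem_unitary {X : Type*} {t : ℕ} {g : Fin t → Op X}
    (h : ∀ j, g j ∈ unitary (Op X)) (j : Fin (t + 1)) : compUpTo g j ∈ unitary (Op X) := by
  induction j using Fin.induction with
  | zero => exact one_mem _
  | succ j ih => rw [compUpTo_succ]; exact mul_mem (h j) ih

/-- The matrix of an operator in the canonical basis. -/
def opMatrix {N : Type*} [DecidableEq N] (T : Op N) : Matrix N N ℂ :=
  fun x y => T (lp.single 2 y (1 : ℂ)) x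

theorem op_apply_eq_sum {N : Type*} [Fintype N] [DecidableEq N] (T : Op N) (v : Hilb N)
    (x : N) : T v x = ∑ y, opMatrix T x y * v y := by
  have h : v = ∑ y, v y • lp.single (E := fun _ : N => ℂ) 2 y (1 : ℂ) := by
    ext x
    rw [lp.coeFn_sum, Finset.sum_apply]
    simp [Pi.single_apply]
  conv_lhs => rw [h, map_sum, lp.coeFn_sum, Finset.sum_apply]
  refine Finset.sum_congr rfl fun y _ => ?_
  rw [map_smul, lp.coeFn_smul, Pi.smul_apply, smul_eq_mul, mul_comm]
  rfl

theorem opMatrix_mul {N : Type*} [Fintype N] [DecidableEq N] (S T : Op N) :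
    opMatrix (S * T) = opMatrix S * opMatrix T := by
  ext x y
  rw [Matrix.mul_apply]
  exact op_apply_eq_sum S _ x

theorem opMatrix_one {N : Type*} [DecidableEq N] : opMatrix (1 : Op N) = 1 := by
  ext x y
  simp [opMatrix, Pi.single_apply, Matrix.one_apply]

theorem opMatrix_star {N : Type*} [DecidableEq N] (T : Op N) :
    opMatrix (star T) = (opMatrix T).conjTranspose := by
  ext x y
  have h := ContinuousLinearMap.adjoint_inner_right T (lp.single (E := fun _ : N => ℂ) 2 x (1 : ℂ))
    (lp.single (E := fun _ : N => ℂ) 2 y (1 : ℂ))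
  rw [lp.inner_single_left, lp.inner_single_right] at h
  simpa [opMatrix, Matrix.conjTranspose_apply, ContinuousLinearMap.star_eq_adjoint] using h

theorem opMatrix_mul_conjTranspose {N : Type*} [Fintype N] [DecidableEq N] {T : Op N}
    (hT : T ∈ unitary (Op N)) : opMatrix T * (opMatrix T).conjTranspose = 1 := by
  rw [← opMatrix_star, ← opMatrix_mul, (Unitary.mem_iff.1 hT).2, opMatrix_one]

theorem op_injective_of_mem_unitary {X : Type*} {g : Op X} (hg : g ∈ unitary (Op X)) :
    Function.Injective g := by
  intro v w h
  have h1 : star g (g v) = star g (g w) := by rw [h]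
  rwa [← op_mul_apply, ← op_mul_apply, (Unitary.mem_iff.1 hg).1] at h1

section Gates

variable {K : Type*} {n t : ℕ} {PA PB : Fin n → ℝ → Op K}

/-- All states of the sequence contain EPR pairs at all sites, since a gate does not change the
pairs that it does not touch. -/
theorem isEPR_of_gates {I : Fin t → Finset (Fin n)} {G H : Fin t → Op K}
    (hGA : ∀ j, ∀ i ∉ I j, ∀ a, Commute (G j) (PA i a)) (hGB : ∀ j i a, Commute (G j) (PB i a))
    (hHA : ∀ j i a, Commute (H j) (PA i a)) (hHB : ∀ j, ∀ i ∉ I j, ∀ a, Commute (H j) (PB i a))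
    {Ψs : Fin (t + 1) → Hilb K} (hsucc : ∀ j : Fin t, Ψs j.succ = G j (H j (Ψs j.castSucc)))
    (h₁ : ∀ i, IsEPR (PA i) (PB i) (Ψs 0))
    (h₂ : ∀ j : Fin t, ∀ i ∈ I j, IsEPR (PA i) (PB i) (Ψs j.succ)) (j : Fin (t + 1)) :
    ∀ i, IsEPR (PA i) (PB i) (Ψs j) := by
  induction j using Fin.induction with
  | zero => exact h₁
  | succ j ih =>
    intro i
    by_cases hi : i ∈ I j
    · exact h₂ j i hi
    · rw [hsucc]
      exact ((ih i).map (hHA j i) (hHB j i hi)).map (hGA j i hi) (hGB j i)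

/-- The intertwining relations of single gates, each on the state on which that gate acts, combine
to the intertwining relation of the product of the gates `G j` on the initial state. The gates `H j`
of the other side drop out, as they commute with the relations. -/
theorem rep_compUpTo (hA : IsSiteFamily PA) {G H : Fin t → Op K}
    (hHA : ∀ j i a, Commute (H j) (PA i a)) (hGH : ∀ j k, Commute (G j) (H k))
    (hH : ∀ j, Function.Injective (H j)) (T : Fin t → Op (Fin n → Fin 2))
    {Ψs : Fin (t + 1) → Hilb K} (hsucc : ∀ j : Fin t, Ψs j.succ = G j (H j (Ψs j.castSucc)))
    (hgood : ∀ j, Ψs j ∈ goodN PA)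
    (hrel : ∀ j σ, rep PA σ (G j (Ψs j.castSucc)) =
      G j (rep PA ((opMatrix (T j)).conjTranspose * σ * opMatrix (T j)) (Ψs j.castSucc)))
    (j : Fin (t + 1)) :
    compUpTo G j (Ψs 0) ∈ goodN PA ∧ ∀ σ, rep PA σ (compUpTo G j (Ψs 0)) =
      compUpTo G j (rep PA ((opMatrix (compUpTo T j)).conjTranspose * σ * opMatrix (compUpTo T j))
        (Ψs 0)) := by
  have hcH : ∀ (j : Fin (t + 1)) i a, Commute (compUpTo H j) (PA i a) := fun j i a =>
    Commute.symm (commute_compUpTo (fun k => (hHA k i a).symm) j)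
  have hcG : ∀ (k : Fin t) (j : Fin (t + 1)), Commute (compUpTo H j) (G k) := fun k j =>
    Commute.symm (commute_compUpTo (fun l => hGH k l) j)
  -- the gates of the two sides can be separated
  have hst : ∀ j, Ψs j = compUpTo H j (compUpTo G j (Ψs 0)) := by
    intro j
    induction j using Fin.induction with
    | zero => rfl
    | succ j ih =>
      rw [hsucc, ih, compUpTo_succ, compUpTo_succ, op_mul_apply, op_mul_apply,
        commute_apply (hcG j _), commute_apply (hGH j j)]
  refine ⟨mem_goodN_of_apply_mem (hcH j) (compUpTo_injective hH j) (hst j ▸ hgood j), ?_⟩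
  induction j using Fin.induction with
  | zero =>
    intro σ
    simp only [compUpTo_zero, opMatrix_one, Matrix.conjTranspose_one, Matrix.one_mul,
      Matrix.mul_one]
    rfl
  | succ j ih =>
    intro σ
    have h1 := hrel j σ
    have hR := fun τ v => commute_apply (hA.commute_rep (hcH j.castSucc) τ) v
    have hG := fun v => commute_apply (hcG j j.castSucc) v
    rw [hst j.castSucc, ← hG, ← hR, ← hR, ← hG] at h1
    have h2 := compUpTo_injective hH _ h1
    rw [compUpTo_succ, op_mul_apply, op_mul_apply, h2, ih, compUpTo_succ, opMatrix_mul,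
      Matrix.conjTranspose_mul]
    simp only [Matrix.mul_assoc]

end Gates

/-! ### The measurements and gates on the tensor factors -/

theorem onLeft_eq_amplHom {X Y : Type*} (S : Op X) :
    (onLeft S : Op (X × Y)) = amplHom (Equiv.refl (X × Y)) S := rfl

theorem onRight_eq_amplHom {X Y : Type*} (S : Op Y) :
    (onRight S : Op (X × Y)) = amplHom (Equiv.prodComm X Y) S := rfl

theorem IsMeasurementFamily.map {X K : Type*} {P : ℝ → Op X} (hP : IsMeasurementFamily P)
    (φ : Op X →⋆ₐ[ℂ] Op K) : IsMeasurementFamily fun a => φ (P a) where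
  proj a ha := (hP.proj a ha).map φ
  add_eq_one a ha := by rw [← map_add, hP.add_eq_one a ha, map_one]

theorem onLeft_commute_onLeft {X Y : Type*} {S R : Op X} (h : Commute S R) :
    Commute (onLeft S : Op (X × Y)) (onLeft R) :=
  h.map (amplHom (Equiv.refl (X × Y)))

theorem onRight_commute_onRight {X Y : Type*} {S R : Op Y} (h : Commute S R) :
    Commute (onRight S : Op (X × Y)) (onRight R) :=
  h.map (amplHom (Equiv.prodComm X Y))

theorem onLeft_piOp {n : ℕ} {α : Fin n → Type*} {Y : Type*} (g : ∀ i, Op (α i)) :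
    (onLeft (piOp g) : Op ((∀ i, α i) × Y)) = seqProd fun i => onLeft (onFactor i (g i)) :=
  map_seqProd (amplHom (Equiv.refl ((∀ i, α i) × Y))) _

theorem onRight_piOp {n : ℕ} {α : Fin n → Type*} {Y : Type*} (g : ∀ i, Op (α i)) :
    (onRight (piOp g) : Op (Y × (∀ i, α i))) = seqProd fun i => onRight (onFactor i (g i)) :=
  map_seqProd (amplHom (Equiv.prodComm Y (∀ i, α i))) _

theorem onFactor_one {n : ℕ} {α : Fin n → Type*} (i : Fin n) :
    onFactor i (1 : Op (α i)) = 1 := map_one (amplHom (Equiv.piSplitAt i α))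

theorem onLeft_piOpOn {n : ℕ} {α : Fin n → Type*} {Y : Type*} (I : Finset (Fin n))
    (g : ∀ i : I, Op (α i)) : (onLeft (piOpOn I g) : Op ((∀ i, α i) × Y)) =
      subProd I fun i => onLeft (onFactor (i : Fin n) (g i)) := by
  rw [piOpOn, onLeft_piOp, subProd]
  congr 1
  funext i
  split_ifs
  · rfl
  · rw [onFactor_one, onLeft_eq_amplHom, map_one]

theorem onRight_piOpOn {n : ℕ} {α : Fin n → Type*} {Y : Type*} (I : Finset (Fin n))
    (g : ∀ i : I, Op (α i)) : (onRight (piOpOn I g) : Op (Y × (∀ i, α i))) =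
      subProd I fun i => onRight (onFactor (i : Fin n) (g i)) := by
  rw [piOpOn, onRight_piOp, subProd]
  congr 1
  funext i
  split_ifs
  · rfl
  · rw [onFactor_one, onRight_eq_amplHom, map_one]

theorem isSiteFamily_onLeft {n : ℕ} {α : Fin n → Type*} {Y : Type*} {P : ∀ i, ℝ → Op (α i)}
    (hP : ∀ i, IsMeasurementFamily (P i)) :
    IsSiteFamily fun i a => (onLeft (onFactor i (P i a)) : Op ((∀ i, α i) × Y)) where
  meas i := ((hP i).map (amplHom (Equiv.piSplitAt i α))).map (amplHom (Equiv.refl _))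
  comm _ _ hij _ _ := onLeft_commute_onLeft (onFactor_commute hij _ _)

theorem isSiteFamily_onRight {n : ℕ} {α : Fin n → Type*} {Y : Type*} {P : ∀ i, ℝ → Op (α i)}
    (hP : ∀ i, IsMeasurementFamily (P i)) :
    IsSiteFamily fun i a => (onRight (onFactor i (P i a)) : Op (Y × (∀ i, α i))) where
  meas i := ((hP i).map (amplHom (Equiv.piSplitAt i α))).map (amplHom (Equiv.prodComm _ _))
  comm _ _ hij _ _ := onRight_commute_onRight (onFactor_commute hij _ _)

theorem ampl_mem_unitary {K X Y : Type*} (e : K ≃ X × Y) {g : Op X}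
    (hg : g ∈ unitary (Op X)) : ampl e g ∈ unitary (Op K) :=
  Unitary.map_mem (amplHom e) hg

theorem opMatrix_onSubset {n : ℕ} (I : Finset (Fin n)) (T : Op (I → Fin 2)) :
    opMatrix (onSubset (α := fun _ => Fin 2) I T) = extendMatrix I (opMatrix T) := by
  ext c d
  have e : extendMatrix I (opMatrix T) c d = if ∀ i ∉ I, c i = d i then
      opMatrix T (fun i => c i) (fun i => d i) else 0 := rfl
  rw [e, opMatrix, onSubset, ampl_apply, slice_single, map_smul]
  have h : ((Equiv.piEquivPiSubtypeProd (fun i => i ∈ I) fun _ => Fin 2) c).2 =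
      ((Equiv.piEquivPiSubtypeProd (fun i => i ∈ I) fun _ => Fin 2) d).2 ↔
      ∀ i ∉ I, c i = d i := by
    simp [funext_iff]
  by_cases hcd : ∀ i ∉ I, c i = d i
  · rw [if_pos (h.2 hcd), if_pos hcd, one_smul]
    rfl
  · rw [if_neg (fun e => hcd (h.1 e)), if_neg hcd, zero_smul]
    rfl

theorem isEPR_of_simulates {K : Type*} {P Q : ℝ → Op K} {ψ : Hilb K} (hP : IsMeasurementFamily P)
    (hQ : IsMeasurementFamily Q) (hPQ : ∀ a b, Commute (P a) (Q b))
    (h : Simulates (W := angles × angles) (fun w => P w.1 * Q w.2) (fun w => pairKet w.1 w.2) ψ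
      (maxEntangled (Fin 2))) : IsEPR P Q ψ := by
  refine isEPR_of_norm_sq hP hQ hPQ fun a ha b hb => ?_
  have h1 := h (⟨a, ha⟩, ⟨b, hb⟩)
  simp only [inner_pairKet_maxEntangled, Complex.norm_real, Real.norm_eq_abs, sq_abs] at h1
  rw [div_pow, Real.sq_sqrt (by norm_num)] at h1
  exact h1

theorem inner_registerKet_onLeft {J : Type*} [Fintype J] [DecidableEq J] (T : Op (J → Fin 2))
    (hT : IsRealOp T) (a b : J → ℝ) :
    inner ℂ (registerKet a b) (onLeft T (maxEntangled (J → Fin 2))) =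
      ∑ c, ∑ d, ((∏ i, qubitCoords (a i) (c i)) * ∏ i, qubitCoords (b i) (d i)) *
        (((opMatrix T c d).re / Real.sqrt (Fintype.card (J → Fin 2)) : ℝ) : ℂ) := by
  have hre : ∀ c d, opMatrix T c d = ((opMatrix T c d).re : ℂ) := fun c d =>
    Complex.ext (Complex.ofReal_re _).symm ((hT c d).trans (Complex.ofReal_im _).symm)
  rw [lp.inner_eq_tsum, tsum_fintype, Fintype.sum_prod_type]
  refine Finset.sum_congr rfl fun c _ => Finset.sum_congr rfl fun d _ => ?_
  have h1 : onLeft T (maxEntangled (J → Fin 2)) (c, d) =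
      (((opMatrix T c d).re / Real.sqrt (Fintype.card (J → Fin 2)) : ℝ) : ℂ) := by
    rw [onLeft, ampl_apply, op_apply_eq_sum]
    have : ∀ y, (slice (Equiv.refl _) ((Equiv.refl ((J → Fin 2) × (J → Fin 2))) (c, d)).2
        (maxEntangled (J → Fin 2))) y =
        if y = d then ((1 / Real.sqrt (Fintype.card (J → Fin 2)) : ℝ) : ℂ) else 0 := fun y => rfl
    simp only [this, mul_ite, mul_zero, Finset.sum_ite_eq', Finset.mem_univ, if_true]
    change opMatrix T c d * _ = _
    rw [hre c d]
    push_cast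
    simp [div_eq_mul_inv]
  have h2 : registerKet a b (c, d) =
      (∏ i, qubitCoords (a i) (c i)) * ∏ i, qubitCoords (b i) (d i) := rfl
  have hq : ∀ s x, starRingEnd ℂ (qubitCoords s x) = qubitCoords s x := qubitCoords_real
  rw [h1, h2, RCLike.inner_apply', map_mul, map_prod, map_prod]
  simp only [hq]

/-! ### Block operators and the swap unitaries -/

theorem slice_embed {N K : Type*} [DecidableEq N] (o c : N) (ψ : Hilb K) :
    slice (Equiv.prodComm N K) c (embed o ψ) = if c = o then ψ else 0 := by
  ext k
  have h : slice (Equiv.prodComm N K) c (embed o ψ) k = if c = o then ψ k else 0 := rfl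
  rw [h]
  split_ifs <;> rfl

theorem norm_embed {N K : Type*} [DecidableEq N] (o : N) (ψ : Hilb K) : ‖embed o ψ‖ = ‖ψ‖ := by
  have h := slice_norm_hasSum (Equiv.prodComm N K) (embed o ψ)
  have h2 : HasSum (fun c => ‖slice (Equiv.prodComm N K) c (embed o ψ)‖ ^ 2) (‖ψ‖ ^ 2) := by
    convert hasSum_single o ?_ using 1
    · rw [slice_embed, if_pos rfl]
    · intro c hc
      rw [slice_embed, if_neg hc]
      simp
  exact (sq_eq_sq₀ (norm_nonneg _) (norm_nonneg _)).1 (h.unique h2)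

theorem embed_add {N K : Type*} [DecidableEq N] (o : N) (ψ φ : Hilb K) :
    embed o (ψ + φ) = embed o ψ + embed o φ := by
  refine eq_of_slice_eq (Equiv.prodComm N K) fun c => ?_
  rw [slice_add, slice_embed, slice_embed, slice_embed]
  split_ifs <;> simp

theorem embed_smul {N K : Type*} [DecidableEq N] (o : N) (r : ℂ) (ψ : Hilb K) :
    embed o (r • ψ) = r • embed o ψ := by
  refine eq_of_slice_eq (Equiv.prodComm N K) fun c => ?_
  rw [slice_smul, slice_embed, slice_embed]
  split_ifs <;> simp

/-- `embed` as a bounded linear map. -/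
def embedL {N : Type*} (K : Type*) [DecidableEq N] (o : N) : Hilb K →L[ℂ] Hilb (N × K) :=
  LinearMap.mkContinuous
    { toFun := embed o, map_add' := embed_add o, map_smul' := embed_smul o } 1
    fun ψ => by simpa using (norm_embed o ψ).le

theorem inner_eq_sum_slice {N K : Type*} [Fintype N] (φ ψ : Hilb (N × K)) :
    inner ℂ φ ψ = ∑ c, inner ℂ (slice (Equiv.prodComm N K) c φ)
      (slice (Equiv.prodComm N K) c ψ) :=
  (inner_hasSum_slice (Equiv.prodComm N K) φ ψ).unique (hasSum_fintype _)

section Block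

variable {N X : Type*} [Fintype N] [DecidableEq N]

/-- The operator on `Hilb N ⊗ Hilb X` with given blocks in `Op X`. -/
def blockOp (u : N → N → Op X) : Op (N × X) :=
  ∑ c, ∑ d, (embedL X c).comp ((u c d).comp (sliceL (Equiv.prodComm N X) d))

theorem slice_sum {K X Y ι : Type*} (e : K ≃ X × Y) (y : Y) (s : Finset ι) (f : ι → Hilb K) :
    slice e y (∑ i ∈ s, f i) = ∑ i ∈ s, slice e y (f i) :=
  map_sum (sliceL e y) f s

theorem slice_blockOp (u : N → N → Op X) (c : N) (y : Hilb (N × X)) :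
    slice (Equiv.prodComm N X) c (blockOp u y) =
      ∑ d, u c d (slice (Equiv.prodComm N X) d y) := by
  have h : blockOp u y = ∑ c, ∑ d, embed c (u c d (slice (Equiv.prodComm N X) d y)) := by
    simp only [blockOp, sum_apply]
    rfl
  rw [h]
  simp only [slice_sum, slice_embed]
  rw [Finset.sum_comm]
  simp

theorem blockOp_mul (u v : N → N → Op X) :
    blockOp u * blockOp v = blockOp fun c d => ∑ k, u c k * v k d := by
  ext1 y
  refine eq_of_slice_eq (Equiv.prodComm N X) fun c => ?_
  rw [op_mul_apply]
  simp only [slice_blockOp, map_sum, sum_apply, op_mul_apply]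
  rw [Finset.sum_comm]

theorem blockOp_one : blockOp (fun c d : N => if c = d then (1 : Op X) else 0) = 1 := by
  ext1 y
  refine eq_of_slice_eq (Equiv.prodComm N X) fun c => ?_
  rw [slice_blockOp, Finset.sum_eq_single c]
  · simp
  · intro d _ hd
    simp [hd.symm]
  · simp

theorem blockOp_star (u : N → N → Op X) :
    star (blockOp u) = blockOp fun c d => star (u d c) := by
  rw [ContinuousLinearMap.star_eq_adjoint, eq_comm, ContinuousLinearMap.eq_adjoint_iff]
  intro x y
  simp only [inner_eq_sum_slice, slice_blockOp, sum_inner, inner_sum,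
    ContinuousLinearMap.star_eq_adjoint, ContinuousLinearMap.adjoint_inner_left]
  rw [Finset.sum_comm]

end Block

/-- The swap unitary: its column over the state `|0⟩` of the logical qubit is the swap isometry. -/
def swapOp {X : Type*} (P : ℝ → Op X) : Op (Fin 2 × X) :=
  blockOp fun c d => (if c = 0 then 1 else bitFlip P) * (if c = d then P 0 else 1 - P 0)

theorem swapOp_mem_unitary {X : Type*} {P : ℝ → Op X} (hP : IsMeasurementFamily P) :
    swapOp P ∈ unitary (Op (Fin 2 × X)) := by
  have h0 := mem_angles zero_mem_angles₀
  have hp : P 0 * P 0 = P 0 := (hP.proj 0 h0).isIdempotentElem.eq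
  have hX : bitFlip P * bitFlip P = 1 := by
    ext1 v
    exact hP.bitFlip_bitFlip v
  let B : Fin 2 → Op X := fun c => if c = 0 then 1 else bitFlip P
  let R : Fin 2 → Fin 2 → Op X := fun c d => if c = d then P 0 else 1 - P 0
  have hBs : ∀ c, star (B c) = B c := by
    intro c
    simp only [B]
    split_ifs
    · exact star_one _
    · exact hP.star_bitFlip
  have hRs : ∀ c d, star (R c d) = R c d := by
    intro c d
    simp only [R]
    split_ifs
    · exact hP.star_eq h0
    · rw [star_sub, star_one, hP.star_eq h0]
  have hBB : ∀ c, B c * B c = 1 := by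
    intro c
    simp only [B]
    split_ifs
    · exact one_mul 1
    · exact hX
  have hsymm : ∀ c d, R c d = R d c := by
    intro c d
    simp only [R, eq_comm]
  have hRR : ∀ c d, ∑ k, R k c * R k d = if c = d then 1 else 0 := by
    intro c d
    rw [Fin.sum_univ_two]
    fin_cases c <;> fin_cases d <;> simp [R, mul_sub, sub_mul, hp]
  have h : swapOp P = blockOp fun c d => B c * R c d := rfl
  rw [Unitary.mem_iff, h, blockOp_star, blockOp_mul, blockOp_mul]
  refine ⟨?_, ?_⟩
  · rw [← blockOp_one]
    congr 1
    funext c d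
    rw [← hRR c d]
    refine Finset.sum_congr rfl fun k _ => ?_
    rw [star_mul, hBs, hRs, mul_assoc, ← mul_assoc (B k), hBB, one_mul]
  · rw [← blockOp_one]
    congr 1
    funext c d
    have : ∀ k, B c * R c k * star (B d * R d k) = B c * (R k c * R k d) * B d := by
      intro k
      rw [star_mul, hBs, hRs, hsymm c k, hsymm d k]
      simp only [mul_assoc]
    simp only [this]
    rw [← Finset.sum_mul, ← Finset.mul_sum, hRR]
    split_ifs with hcd
    · rw [hcd, mul_one, hBB]
    · simp

/-- If each of the operators `V s` acts on the qubit `s` by blocks `w s`, then their product sends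
`|0⋯0⟩ ⊗ ψ` to the vector whose components are given by products of the blocks over `|0⟩`. -/
theorem slice_list_prod {ι L K : Type*} [Fintype ι] [DecidableEq ι]
    (sl : (ι → Fin 2) → Hilb L → Hilb K) (V : ι → Op L) (w : ι → Fin 2 → Fin 2 → Op K)
    (hstep : ∀ z s y, sl z (V s y) = ∑ x, w s (z s) x (sl (Function.update z s x) y))
    {y₀ : Hilb L} {ψ : Hilb K} (h0 : ∀ z, sl z y₀ = if ∀ s, z s = 0 then ψ else 0)
    (l : List ι) (hl : l.Nodup) (z : ι → Fin 2) :
    sl z ((l.map V).prod y₀) =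
      if ∀ s ∉ l, z s = 0 then (l.map fun s => w s (z s) 0).prod ψ else 0 := by
  induction l generalizing z with
  | nil => simp [h0]
  | cons s l ih =>
    obtain ⟨hs, hl'⟩ := List.nodup_cons.1 hl
    rw [List.map_cons, List.prod_cons, op_mul_apply, hstep, Fin.sum_univ_two, ih hl', ih hl']
    have h1 : ¬ ∀ r ∉ l, Function.update z s 1 r = 0 := fun h => by
      have := h s hs
      simp at this
    have h2 : (∀ r ∉ l, Function.update z s 0 r = 0) ↔ ∀ r ∉ s :: l, z r = 0 := by
      constructor
      · intro h r hr
        rw [List.mem_cons, not_or] at hr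
        simpa [Function.update_of_ne hr.1] using h r hr.2
      · intro h r hr
        by_cases hrs : r = s
        · simp [hrs]
        · rw [Function.update_of_ne hrs]
          exact h r (by simp [hrs, hr])
    rw [if_neg h1, map_zero, add_zero]
    by_cases hc : ∀ r ∉ s :: l, z r = 0
    · rw [if_pos (h2.2 hc), if_pos hc, List.map_cons, List.prod_cons, op_mul_apply]
      congr 2
      refine congrArg List.prod (List.map_congr_left fun r hr => ?_)
      rw [Function.update_of_ne]
      rintro rfl
      exact hs hr
    · rw [if_neg (fun h => hc (h2.1 h)), if_neg hc, map_zero]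

theorem kraus_map {X K : Type*} (φ : Op X →⋆ₐ[ℂ] Op K) (P : ℝ → Op X) (x : Fin 2) :
    kraus (fun a => φ (P a)) x = φ (kraus P x) := by
  unfold kraus bitFlip
  split_ifs <;> simp

theorem kraus_eq_mul {X : Type*} (P : ℝ → Op X) (x : Fin 2) :
    kraus P x = (if x = 0 then 1 else bitFlip P) * (if x = 0 then P 0 else 1 - P 0) := by
  unfold kraus
  split_ifs
  · rw [one_mul]
  · rfl

section Regroup

variable {n : ℕ} {α β : Fin n → Type*}

/-- The operators on `⨂ i (ℂ² ⊗ A i) ⊗ ⨂ i (ℂ² ⊗ B i)` as operators on `(A_c ⊗ B_c) ⊗ (A ⊗ B)`. -/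
def regroupHom (α β : Fin n → Type*) :
    Op ((∀ i, Fin 2 × α i) × (∀ i, Fin 2 × β i)) →⋆ₐ[ℂ]
      Op (((Fin n → Fin 2) × (Fin n → Fin 2)) × ((∀ i, α i) × (∀ i, β i))) :=
  amplHom ((regroup α β).trans (Equiv.prodPUnit.{0} _).symm)

theorem piSplitAt_symm_eq_update {γ : Fin n → Type*} (i : Fin n) (f : ∀ j, γ j) (x : γ i) :
    (Equiv.piSplitAt i γ).symm (x, (Equiv.piSplitAt i γ f).2) = Function.update f i x := by
  funext j
  by_cases h : j = i
  · subst h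
    simp
  · simp [h]

/-- A block operator on the `i`-th factor of the `A` side, in terms of the components along the
logical registers. -/
theorem slice_regroup_left (i : Fin n) (u : Fin 2 → Fin 2 → Op (α i)) (c d : Fin n → Fin 2)
    (y : Hilb (((Fin n → Fin 2) × (Fin n → Fin 2)) × ((∀ i, α i) × (∀ i, β i)))) :
    slice (Equiv.prodComm _ _) (c, d)
        (regroupHom α β (onLeft (onFactor (α := fun i => Fin 2 × α i) i (blockOp u))) y) =
      ∑ x, onLeft (onFactor i (u (c i) x))
        (slice (Equiv.prodComm _ _) (Function.update c i x, d) y) := by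
  ext k
  obtain ⟨a, b⟩ := k
  let z : Hilb (Fin 2 × α i) :=
    slice (Equiv.piSplitAt i fun i => Fin 2 × α i)
      (Equiv.piSplitAt i (fun i => Fin 2 × α i) fun j => (c j, a j)).2
      (slice (Equiv.refl _) (fun j => (d j, b j))
        (slice ((regroup α β).trans (Equiv.prodPUnit.{0} _).symm) PUnit.unit y))
  have h1 : slice (Equiv.prodComm _ _) (c, d)
        (regroupHom α β (onLeft (onFactor (α := fun i => Fin 2 × α i) i (blockOp u))) y) (a, b) =
      slice (Equiv.prodComm _ _) (c i) (blockOp u z) (a i) := rfl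
  rw [h1, slice_blockOp, lp.coeFn_sum, lp.coeFn_sum, Finset.sum_apply, Finset.sum_apply]
  refine Finset.sum_congr rfl fun x _ => ?_
  have h2 : slice (Equiv.prodComm _ _) x z = slice (Equiv.piSplitAt i α)
      (Equiv.piSplitAt i α a).2 (slice (Equiv.refl _) b
        (slice (Equiv.prodComm _ _) (Function.update c i x, d) y)) := by
    ext a'
    have e1 : slice (Equiv.prodComm _ _) x z a' =
        y ((regroup α β).symm ((Equiv.piSplitAt i fun i => Fin 2 × α i).symm ((x, a'),
          (Equiv.piSplitAt i (fun i => Fin 2 × α i) fun j => (c j, a j)).2),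
            fun j => (d j, b j))) := rfl
    have e2 : slice (Equiv.piSplitAt i α)
      (Equiv.piSplitAt i α a).2 (slice (Equiv.refl _) b
        (slice (Equiv.prodComm _ _) (Function.update c i x, d) y)) a' =
        y ((Function.update c i x, d),
          ((Equiv.piSplitAt i α).symm (a', (Equiv.piSplitAt i α a).2), b)) := rfl
    rw [e1, e2, piSplitAt_symm_eq_update, piSplitAt_symm_eq_update]
    refine congrArg (fun k => y k) ?_
    refine Prod.ext (Prod.ext ?_ rfl) (Prod.ext ?_ rfl)
    · funext j
      by_cases h : j = i
      · subst h; simp [regroup]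
      · simp [regroup, h]
    · funext j
      by_cases h : j = i
      · subst h; simp [regroup]
      · simp [regroup, h]
  rw [h2]
  rfl

/-- A block operator on the `i`-th factor of the `B` side, in terms of the components along the
logical registers. -/
theorem slice_regroup_right (i : Fin n) (u : Fin 2 → Fin 2 → Op (β i)) (c d : Fin n → Fin 2)
    (y : Hilb (((Fin n → Fin 2) × (Fin n → Fin 2)) × ((∀ i, α i) × (∀ i, β i)))) :
    slice (Equiv.prodComm _ _) (c, d)
        (regroupHom α β (onRight (onFactor (α := fun i => Fin 2 × β i) i (blockOp u))) y) =
      ∑ x, onRight (onFactor i (u (d i) x))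
        (slice (Equiv.prodComm _ _) (c, Function.update d i x) y) := by
  ext k
  obtain ⟨a, b⟩ := k
  let z : Hilb (Fin 2 × β i) :=
    slice (Equiv.piSplitAt i fun i => Fin 2 × β i)
      (Equiv.piSplitAt i (fun i => Fin 2 × β i) fun j => (d j, b j)).2
      (slice (Equiv.prodComm _ _) (fun j => (c j, a j))
        (slice ((regroup α β).trans (Equiv.prodPUnit.{0} _).symm) PUnit.unit y))
  have h1 : slice (Equiv.prodComm _ _) (c, d)
        (regroupHom α β (onRight (onFactor (α := fun i => Fin 2 × β i) i (blockOp u))) y) (a, b) =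
      slice (Equiv.prodComm _ _) (d i) (blockOp u z) (b i) := rfl
  rw [h1, slice_blockOp, lp.coeFn_sum, lp.coeFn_sum, Finset.sum_apply, Finset.sum_apply]
  refine Finset.sum_congr rfl fun x _ => ?_
  have h2 : slice (Equiv.prodComm _ _) x z = slice (Equiv.piSplitAt i β)
      (Equiv.piSplitAt i β b).2 (slice (Equiv.prodComm _ _) a
        (slice (Equiv.prodComm _ _) (c, Function.update d i x) y)) := by
    ext b'
    have e1 : slice (Equiv.prodComm _ _) x z b' =
        y ((regroup α β).symm (fun j => (c j, a j), (Equiv.piSplitAt i fun i => Fin 2 × β i).symm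
          ((x, b'), (Equiv.piSplitAt i (fun i => Fin 2 × β i) fun j => (d j, b j)).2))) := rfl
    have e2 : slice (Equiv.piSplitAt i β)
      (Equiv.piSplitAt i β b).2 (slice (Equiv.prodComm _ _) a
        (slice (Equiv.prodComm _ _) (c, Function.update d i x) y)) b' =
        y ((c, Function.update d i x),
          (a, (Equiv.piSplitAt i β).symm (b', (Equiv.piSplitAt i β b).2))) := rfl
    rw [e1, e2, piSplitAt_symm_eq_update, piSplitAt_symm_eq_update]
    refine congrArg (fun k => y k) ?_
    refine Prod.ext (Prod.ext rfl ?_) (Prod.ext rfl ?_)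
    · funext j
      by_cases h : j = i
      · subst h; simp [regroup]
      · simp [regroup, h]
    · funext j
      by_cases h : j = i
      · subst h; simp [regroup]
      · simp [regroup, h]
  rw [h2]
  rfl

/-- The components of the image of `|0⋯0⟩ ⊗ ψ` under the tensor product of the swap unitaries. -/
theorem slice_regroup_swap (PA : ∀ i, ℝ → Op (α i)) (PB : ∀ i, ℝ → Op (β i))
    (c d : Fin n → Fin 2) (ψ : Hilb ((∀ i, α i) × (∀ i, β i))) :
    slice (Equiv.prodComm _ _) (c, d) (regroupHom α β
        (tensorOp (piOp fun i => swapOp (PA i)) (piOp fun i => swapOp (PB i)))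
        (embed (fun _ => 0, fun _ => 0) ψ)) =
      krausN (fun i a => onLeft (onFactor i (PA i a))) c
        (krausN (fun i a => onRight (onFactor i (PB i a))) d ψ) := by
  -- the factors of both sides, as a single list of operators acting on one qubit each
  let V : Fin n ⊕ Fin n →
      Op (((Fin n → Fin 2) × (Fin n → Fin 2)) × ((∀ i, α i) × (∀ i, β i))) :=
    Sum.elim
      (fun i => regroupHom α β (onLeft (onFactor (α := fun i => Fin 2 × α i) i (swapOp (PA i)))))
      (fun i => regroupHom α β (onRight (onFactor (α := fun i => Fin 2 × β i) i (swapOp (PB i)))))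
  let w : Fin n ⊕ Fin n → Fin 2 → Fin 2 → Op ((∀ i, α i) × (∀ i, β i)) :=
    Sum.elim
      (fun i x y => onLeft (onFactor i ((if x = 0 then 1 else bitFlip (PA i)) *
        (if x = y then PA i 0 else 1 - PA i 0))))
      (fun i x y => onRight (onFactor i ((if x = 0 then 1 else bitFlip (PB i)) *
        (if x = y then PB i 0 else 1 - PB i 0))))
  let l : List (Fin n ⊕ Fin n) := (List.finRange n).map Sum.inl ++ (List.finRange n).map Sum.inr
  have hl : l.Nodup := by
    refine List.Nodup.append ?_ ?_ ?_
    · exact (List.nodup_finRange n).map Sum.inl_injective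
    · exact (List.nodup_finRange n).map Sum.inr_injective
    · intro s h1 h2
      obtain ⟨i, -, rfl⟩ := List.mem_map.1 h1
      obtain ⟨j, -, h⟩ := List.mem_map.1 h2
      cases h
  have hprod : regroupHom α β
      (tensorOp (piOp fun i => swapOp (PA i)) (piOp fun i => swapOp (PB i))) = (l.map V).prod := by
    rw [tensorOp, map_mul, onLeft_piOp, onRight_piOp, map_seqProd, map_seqProd, List.map_append,
      List.prod_append, List.map_map, List.map_map]
    simp only [seqProd, List.ofFn_eq_map]
    rfl
  have key := slice_list_prod (fun z y => slice (Equiv.prodComm _ _)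
      ((fun i => z (Sum.inl i), fun i => z (Sum.inr i)) : (Fin n → Fin 2) × (Fin n → Fin 2)) y)
    V w ?_ (y₀ := embed (fun _ => 0, fun _ => 0) ψ) (ψ := ψ) ?_ l hl (Sum.elim c d)
  · rw [hprod]
    refine Eq.trans key ?_
    rw [if_pos]
    · rw [List.map_append, List.prod_append, List.map_map, List.map_map, op_mul_apply]
      have hA : (List.map ((fun s => w s (Sum.elim c d s) 0) ∘ Sum.inl) (List.finRange n)).prod =
          krausN (fun i a => (onLeft (onFactor i (PA i a)) :
            Op ((∀ i, α i) × (∀ i, β i)))) c := by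
        rw [krausN, seqProd, List.ofFn_eq_map]
        refine congrArg List.prod (List.map_congr_left fun i _ => ?_)
        have := kraus_map ((amplHom (Equiv.refl ((∀ i, α i) × (∀ i, β i)))).comp
          (amplHom (Equiv.piSplitAt i α))) (PA i) (c i)
        rw [kraus_eq_mul (PA i)] at this
        exact this.symm
      have hB : (List.map ((fun s => w s (Sum.elim c d s) 0) ∘ Sum.inr) (List.finRange n)).prod =
          krausN (fun i a => (onRight (onFactor i (PB i a)) :
            Op ((∀ i, α i) × (∀ i, β i)))) d := by
        rw [krausN, seqProd, List.ofFn_eq_map]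
        refine congrArg List.prod (List.map_congr_left fun i _ => ?_)
        have := kraus_map ((amplHom (Equiv.prodComm (∀ i, α i) (∀ i, β i))).comp
          (amplHom (Equiv.piSplitAt i β))) (PB i) (d i)
        rw [kraus_eq_mul (PB i)] at this
        exact this.symm
      rw [hA, hB]
    · intro s hs
      refine absurd ?_ hs
      cases s <;> simp [l]
  · intro z s y
    cases s with
    | inl i =>
      refine (slice_regroup_left i _ _ _ y).trans (Finset.sum_congr rfl fun x _ => ?_)
      have e1 : (fun j => Function.update z (Sum.inl i) x (Sum.inl j)) =
          Function.update (fun j => z (Sum.inl j)) i x := by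
        funext j
        by_cases h : j = i
        · subst h; simp
        · simp [h]
      simp only [e1]
      rfl
    | inr i =>
      refine (slice_regroup_right i _ _ _ y).trans (Finset.sum_congr rfl fun x _ => ?_)
      have e1 : (fun j => Function.update z (Sum.inr i) x (Sum.inr j)) =
          Function.update (fun j => z (Sum.inr j)) i x := by
        funext j
        by_cases h : j = i
        · subst h; simp
        · simp [h]
      simp only [e1]
      rfl
  · intro z
    have e : ((fun i => z (Sum.inl i), fun i => z (Sum.inr i)) :
        (Fin n → Fin 2) × (Fin n → Fin 2)) = (fun _ => 0, fun _ => 0) ↔ ∀ s, z s = 0 := by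
      simp [Prod.ext_iff, funext_iff]
    rw [slice_embed]
    by_cases h : ∀ s, z s = 0
    · rw [if_pos (e.2 h), if_pos h]
    · rw [if_neg (fun h' => h (e.1 h')), if_neg h]

end Regroup

/-! ### Equivalence of the physical and the logical register -/

/-- The unitary group acts transitively on the vectors of a given length. -/
theorem exists_unitary_apply_eq {E : Type*} [NormedAddCommGroup E] [InnerProductSpace ℂ E]
    [CompleteSpace E] {x y : E} (h : ‖x‖ = ‖y‖) : ∃ R : unitary (E →L[ℂ] E), R.1 x = y := by
  -- after multiplication by a phase `u`, the inner product is real and a reflection suffices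
  obtain ⟨u, hu, hr⟩ : ∃ u : ℂ, ‖u‖ = 1 ∧ inner ℂ (u • x) y = inner ℂ y (u • x) := by
    by_cases h0 : inner ℂ x y = (0 : ℂ)
    · refine ⟨1, by simp, ?_⟩
      rw [one_smul, h0, ← inner_conj_symm, h0, map_zero]
    · refine ⟨inner ℂ x y / ‖(inner ℂ x y : ℂ)‖, ?_, ?_⟩
      · rw [norm_div, Complex.norm_real, norm_norm, div_self (norm_ne_zero_iff.2 h0)]
      · rw [inner_smul_left, inner_smul_right, ← inner_conj_symm y x, map_div₀,
          Complex.conj_ofReal]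
        ring
  have hx : ‖u • x‖ = ‖y‖ := by rw [norm_smul, hu, one_mul, h]
  let ρ : E ≃ₗᵢ[ℂ] E := (ℂ ∙ (u • x - y))ᗮ.reflection
  have hρ : ρ (u • x) = y := by
    have e1 : ρ (u • x - y) = -(u • x - y) :=
      Submodule.reflection_orthogonalComplement_singleton_eq_neg _
    have e2 : ρ (u • x + y) = u • x + y := by
      refine Submodule.reflection_mem_subspace_eq_self ?_
      rw [Submodule.mem_orthogonal_singleton_iff_inner_right, inner_sub_left, inner_add_right,
        inner_add_right, inner_self_eq_norm_sq_to_K, inner_self_eq_norm_sq_to_K, hx, hr]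
      ring
    have e3 : (2 : ℂ) • ρ (u • x) = (2 : ℂ) • y := by
      have : (2 : ℂ) • (u • x) = (u • x - y) + (u • x + y) := by module
      rw [← map_smul, this, map_add, e1, e2]
      module
    exact smul_right_injective E (two_ne_zero) e3
  have hu' : u • (1 : E →L[ℂ] E) ∈ unitary (E →L[ℂ] E) := by
    have : (starRingEnd ℂ) u * u = 1 := by
      rw [← Complex.normSq_eq_conj_mul_self, Complex.normSq_eq_norm_sq, hu]; simp
    rw [Unitary.mem_iff]
    constructor
    · rw [star_smul, star_one, smul_mul_smul_comm, one_mul]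
      change ((starRingEnd ℂ) u * u) • (1 : E →L[ℂ] E) = 1
      rw [this, one_smul]
    · rw [star_smul, star_one, smul_mul_smul_comm, one_mul]
      change (u * (starRingEnd ℂ) u) • (1 : E →L[ℂ] E) = 1
      rw [mul_comm, this, one_smul]
  refine ⟨Unitary.linearIsometryEquiv.symm ρ * ⟨_, hu'⟩, ?_⟩
  rw [← hρ]
  rfl

theorem slice_onLeft {N K : Type*} [Fintype N] [DecidableEq N] (T : Op N) (x : N)
    (y : Hilb (N × K)) : slice (Equiv.prodComm N K) x (onLeft T y) =
      ∑ x', opMatrix T x x' • slice (Equiv.prodComm N K) x' y := by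
  ext k
  rw [lp.coeFn_sum, Finset.sum_apply]
  exact op_apply_eq_sum T _ x

theorem slice_onRight {N K : Type*} (R : Op K) (x : N) (y : Hilb (N × K)) :
    slice (Equiv.prodComm N K) x (onRight R y) = R (slice (Equiv.prodComm N K) x y) :=
  slice_ampl (Equiv.prodComm N K) R x y

theorem opMatrix_rankOne {N : Type*} [Fintype N] [DecidableEq N] (v : Hilb N) (x y : N) :
    opMatrix (InnerProductSpace.rankOne ℂ v v) x y = star (v y) * v x := by
  rw [opMatrix, InnerProductSpace.rankOne_apply, lp.inner_single_right, lp.coeFn_smul,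
    Pi.smul_apply, smul_eq_mul]
  simp

theorem inner_unembed {N K : Type*} [Fintype N] [DecidableEq N] (o : N) (φ : Hilb K)
    (y : Hilb (N × K)) : inner ℂ φ (unembed o y) = inner ℂ (embed o φ) y := by
  rw [inner_eq_sum_slice, Finset.sum_eq_single o]
  · rw [slice_embed, if_pos rfl]
    rfl
  · intro c _ hc
    rw [slice_embed, if_neg hc, inner_zero_left]
  · simp

section Equivalence

variable {K : Type*} {n : ℕ} {PA PB : Fin n → ℝ → Op K}

theorem seqProd_krausAt {P : Fin n → ℝ → Op K} (a : Fin n → ℝ) :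
    (seqProd fun i => krausAt (P i) (a i) : Op K) =
      ∑ c : Fin n → Fin 2, (∏ i, qubitCoords (a i) (c i)) • krausN P c := by
  simp only [krausAt]
  rw [seqProd_sum fun (i : Fin n) x => qubitCoords (a i) x • kraus (P i) x]
  simp only [seqProd_smul, krausN]

theorem IsSiteFamily.seqProd_apply {P : Fin n → ℝ → Op K} (hP : IsSiteFamily P) {v : Hilb K}
    (hv : v ∈ goodN P) (a : Fin n → angles) :
    (seqProd fun i => P i (a i) : Op K) v =
      (star (seqProd fun i => krausAt (P i) (a i) : Op K) *
        (seqProd fun i => krausAt (P i) (a i) : Op K)) v := by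
  have h := hP.subProd_apply hv Finset.univ fun i => a i
  rwa [subProd_univ fun i => P i (a i), subProd_univ fun i => krausAt (P i) (a i)] at h

/-- On good vectors, the projector of an outcome is the counterpart of the projector on the logical
state of that outcome. -/
theorem IsSiteFamily.seqProd_apply_eq_rep {P : Fin n → ℝ → Op K} (hP : IsSiteFamily P)
    {v : Hilb K} (hv : v ∈ goodN P) (a : Fin n → angles) :
    (seqProd fun i => P i (a i) : Op K) v =
      rep P (Matrix.of fun c d => (∏ i, qubitCoords (a i) (c i)) * ∏ i, qubitCoords (a i) (d i))
        v := by
  rw [hP.seqProd_apply hv a, seqProd_krausAt, rep]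
  congr 1
  have hq : ∀ c : Fin n → Fin 2, star (∏ i, qubitCoords (a i) (c i)) =
      ∏ i, qubitCoords (a i) (c i) := fun c => by
    rw [star_prod]
    simp only [qubitCoords_real]
  simp only [star_sum, star_smul, hq]
  rw [Finset.sum_mul_sum]
  refine Finset.sum_congr rfl fun c _ => Finset.sum_congr rfl fun d _ => ?_
  rw [smul_mul_smul_comm, hP.matUnitN_eq]
  rfl

/-- A subspace of good vectors is equivalent to the logical register. -/
theorem subspaceEquiv_of_le_goodN (hA : IsSiteFamily PA) (hB : IsSiteFamily PB)
    (hAB : ∀ i j a b, Commute (PA i a) (PB j b))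
    (U : Uni (((Fin n → Fin 2) × (Fin n → Fin 2)) × K))
    (hU : ∀ c d ψ, slice (Equiv.prodComm _ _) (c, d) (U.1 (embed (fun _ => 0, fun _ => 0) ψ)) =
      krausN PA c (krausN PB d ψ))
    {S : Submodule ℂ (Hilb K)} (hSA : S ≤ goodN PA) (hSB : S ≤ goodN PB) :
    SubspaceEquiv (W := (Fin n → angles) × (Fin n → angles)) (fun _ => 0, fun _ => 0)
      (fun w => (seqProd fun i => PA i (w.1 i) : Op K) * (seqProd fun i => PB i (w.2 i) : Op K))
      (fun w => registerKet (fun i => (w.1 i : ℝ)) (fun i => (w.2 i : ℝ))) U S := by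
  rintro ⟨a, b⟩ ψ hψ
  have hkA : (seqProd fun i => krausAt (PA i) (a i) : Op K) =
      ∑ c : Fin n → Fin 2, (∏ i, qubitCoords (a i) (c i)) • krausN PA c := seqProd_krausAt _
  have hkB : (seqProd fun i => krausAt (PB i) (b i) : Op K) =
      ∑ c : Fin n → Fin 2, (∏ i, qubitCoords (b i) (c i)) • krausN PB c := seqProd_krausAt _
  have hcA : ∀ i s, Commute (seqProd fun i => krausAt (PA i) (a i) : Op K) (PB i s) := by
    intro j t
    refine Commute.symm (commute_seqProd fun i => commute_krausAt (fun s => ?_) _)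
    exact (hAB i j s t).symm
  have hcB : ∀ i s, Commute (seqProd fun j => PB j (b j) : Op K) (PA i s) := by
    intro i s
    exact Commute.symm (commute_seqProd fun j => hAB i j s _)
  have hcAB : Commute (seqProd fun i => krausAt (PA i) (a i) : Op K)
      (seqProd fun j => PB j (b j) : Op K) := commute_seqProd fun j => hcA j _
  have eA := hA.seqProd_apply (apply_mem_goodN hcB (hSA hψ)) a
  have eB := hB.seqProd_apply (apply_mem_goodN hcA (hSB hψ)) b
  set kA : Op K := seqProd fun i => krausAt (PA i) (a i)
  set kB : Op K := seqProd fun i => krausAt (PB i) (b i)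
  have hk : ∀ φ, kB (kA φ) = ∑ x : (Fin n → Fin 2) × (Fin n → Fin 2),
      star (registerKet (fun i => (a i : ℝ)) (fun i => (b i : ℝ)) x) •
        krausN PA x.1 (krausN PB x.2 φ) := by
    intro φ
    rw [hkA, hkB, Fintype.sum_prod_type, Finset.sum_comm]
    simp only [sum_apply, op_smul_apply, map_sum, map_smul, Finset.smul_sum, smul_smul]
    rw [Finset.sum_comm]
    refine Finset.sum_congr rfl fun d _ => Finset.sum_congr rfl fun c _ => ?_
    rw [commute_apply (commute_krausN_krausN hAB c d)]
    congr 1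
    change _ = star ((∏ i, qubitCoords (a i) (c i)) * ∏ i, qubitCoords (b i) (d i))
    rw [star_mul, star_prod, star_prod]
    simp only [qubitCoords_real]
    exact mul_comm _ _
  -- both sides of the claim are positive operators, compared through their sesquilinear forms
  refine ext_inner_left ℂ fun φ => ?_
  have h1 : inner ℂ φ (((seqProd fun i => PA i (a i) : Op K) *
      (seqProd fun i => PB i (b i) : Op K)) ψ) = inner ℂ (kB (kA φ)) (kB (kA ψ)) := by
    rw [op_mul_apply, eA, op_mul_apply, commute_apply hcAB, eB, op_mul_apply,
      ContinuousLinearMap.star_eq_adjoint, ContinuousLinearMap.star_eq_adjoint,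
      ContinuousLinearMap.adjoint_inner_right, ContinuousLinearMap.adjoint_inner_right]
  rw [inner_unembed]
  have h2 : ∀ z, inner ℂ (embed (fun _ => 0, fun _ => 0) φ)
      ((star U : Uni (((Fin n → Fin 2) × (Fin n → Fin 2)) × K)).1 z) =
      inner ℂ (U.1 (embed (fun _ => 0, fun _ => 0) φ)) z := by
    intro z
    exact ContinuousLinearMap.adjoint_inner_right U.1 _ z
  refine h1.trans (Eq.trans ?_ (h2 _).symm)
  rw [inner_eq_sum_slice, hk, hk, sum_inner]
  refine Finset.sum_congr rfl fun x _ => ?_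
  obtain ⟨c, d⟩ := x
  rw [slice_onLeft, hU, inner_smul_left, inner_sum, inner_sum, Finset.mul_sum]
  refine Finset.sum_congr rfl fun y _ => ?_
  obtain ⟨c', d'⟩ := y
  rw [hU, opMatrix_rankOne, inner_smul_right, inner_smul_right, starRingEnd_apply, star_star]
  ring

/-- The components of the image under the gate `G` of a vector `σ_A τ_B φ`, if those of `G φ` are
given by the matrix `M`. Both `σ` and `τ` are moved to the `B` side, where they commute with `G`. -/
theorem krausN_rep_rep (hA : IsSiteFamily PA) (hB : IsSiteFamily PB)
    (hAB : ∀ i j a b, Commute (PA i a) (PB j b)) {G : Op K} (hG : ∀ i a, Commute G (PB i a))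
    {φ χ : Hilb K} (hφ : ∀ i, IsEPR (PA i) (PB i) φ)
    (M : Matrix (Fin n → Fin 2) (Fin n → Fin 2) ℂ)
    (hχ : ∀ c d, krausN PA c (krausN PB d (G φ)) = M c d • χ)
    (σ τ : Matrix (Fin n → Fin 2) (Fin n → Fin 2) ℂ) (x y : Fin n → Fin 2) :
    krausN PA x (krausN PB y (G (rep PA σ (rep PB τ φ)))) =
      (∑ e, M x e * (τ * σ.transpose) y e) • χ := by
  have hφB : φ ∈ goodN PB := mem_goodN.2 fun i => (hφ i).right
  have hcR : ∀ i a, Commute (rep PA σ) (PB i a) := fun i a =>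
    Commute.symm (hA.commute_rep (fun j b => (hAB j i b a).symm) σ)
  have hcRR : Commute (rep PA σ) (rep PB τ) := hB.commute_rep hcR τ
  rw [commute_apply hcRR, commute_apply (hB.commute_rep hG τ),
    hB.krausN_rep (apply_mem_goodN hG (apply_mem_goodN hcR hφB)), rep_apply_eq hA hB hAB hφ]
  have h1 : ∀ d, krausN PB d (G (rep PB σ.transpose φ)) =
      ∑ e, σ.transpose d e • krausN PB e (G φ) := by
    intro d
    rw [commute_apply (hB.commute_rep hG _), hB.krausN_rep (apply_mem_goodN hG hφB)]
  simp only [h1, map_sum, map_smul, hχ, Finset.smul_sum, smul_smul, Finset.sum_smul,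
    Matrix.mul_apply, Finset.mul_sum]
  rw [Finset.sum_comm]
  refine Finset.sum_congr rfl fun e _ => Finset.sum_congr rfl fun d _ => ?_
  congr 1
  ring

/-- The swapped state has components `M c d • χ` with a unitary matrix `M`, which gives its norm. -/
theorem norm_sq_eq_of_components
    (U : Uni (((Fin n → Fin 2) × (Fin n → Fin 2)) × K))
    (hU : ∀ c d ψ, slice (Equiv.prodComm _ _) (c, d) (U.1 (embed (fun _ => 0, fun _ => 0) ψ)) =
      krausN PA c (krausN PB d ψ))
    {v χ : Hilb K} (M : Matrix (Fin n → Fin 2) (Fin n → Fin 2) ℂ) (hM : M * M.conjTranspose = 1)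
    (hχ : ∀ c d, krausN PA c (krausN PB d v) = M c d • χ) :
    inner ℂ v v = (Fintype.card (Fin n → Fin 2) : ℂ) * inner ℂ χ χ := by
  let o : (Fin n → Fin 2) × (Fin n → Fin 2) := (fun _ => 0, fun _ => 0)
  have h1 : inner ℂ v v = inner ℂ (U.1 (embed o v)) (U.1 (embed o v)) := by
    have hs : (star U : Uni (((Fin n → Fin 2) × (Fin n → Fin 2)) × K)).1 (U.1 (embed o v)) =
        embed o v :=
      congrArg (fun T : Op _ => T (embed o v)) (Unitary.mem_iff.1 U.2).1
    have h2 : inner ℂ (U.1 (embed o v)) (U.1 (embed o v)) = inner ℂ (embed o v)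
        ((star U : Uni (((Fin n → Fin 2) × (Fin n → Fin 2)) × K)).1 (U.1 (embed o v))) :=
      (ContinuousLinearMap.adjoint_inner_right U.1 _ _).symm
    rw [h2, hs, ← inner_unembed]
    congr 1
    exact ((slice_embed o o v).trans (if_pos rfl)).symm
  rw [h1, inner_eq_sum_slice, Fintype.sum_prod_type]
  have h3 : ∀ c, ∑ d, M c d * star (M c d) = 1 := by
    intro c
    have := congrFun (congrFun hM c) c
    rw [Matrix.mul_apply, Matrix.one_apply_eq] at this
    exact this
  have h4 : ∀ c d, inner ℂ (slice (Equiv.prodComm _ _) (c, d) (U.1 (embed o v)))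
      (slice (Equiv.prodComm _ _) (c, d) (U.1 (embed o v))) =
      M c d * star (M c d) * inner ℂ χ χ := by
    intro c d
    rw [hU, hχ, inner_smul_left, inner_smul_right, starRingEnd_apply]
    ring
  simp only [h4, ← Finset.sum_mul, h3]
  simp

/-- If all components of a gate on one side are those of a logical gate applied to EPR pairs, then
the gate is equivalent to that logical gate on the span of the post-measurement states. -/
theorem gateEquiv_of_components (hA : IsSiteFamily PA) (hB : IsSiteFamily PB)
    (hAB : ∀ i j a b, Commute (PA i a) (PB j b)) {G : Op K} (hGu : G ∈ unitary (Op K))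
    (hG : ∀ i a, Commute G (PB i a)) {Ψ : Hilb K}
    (hΨ : ∀ i, IsEPR (PA i) (PB i) Ψ) (hgA : G Ψ ∈ goodN PA)
    (U : Uni (((Fin n → Fin 2) × (Fin n → Fin 2)) × K))
    (hU : ∀ c d ψ, slice (Equiv.prodComm _ _) (c, d) (U.1 (embed (fun _ => 0, fun _ => 0) ψ)) =
      krausN PA c (krausN PB d ψ))
    {T : Op (Fin n → Fin 2)} (hT : T ∈ unitary (Op (Fin n → Fin 2))) {χ₀ χ : Hilb K}
    (hχ₀ : ∀ c d, krausN PA c (krausN PB d Ψ) = (1 : Matrix _ _ ℂ) c d • χ₀)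
    (hχ : ∀ c d, krausN PA c (krausN PB d (G Ψ)) = opMatrix T c d • χ) :
    GateEquiv (W := (Fin n → angles) × (Fin n → angles)) (fun _ => 0, fun _ => 0)
      (fun w => (seqProd fun i => PA i (w.1 i) : Op K) * (seqProd fun i => PB i (w.2 i) : Op K))
      (fun w => registerKet (fun i => (w.1 i : ℝ)) (fun i => (w.2 i : ℝ))) U U G (onLeft T)
      (Submodule.span ℂ (Set.range fun w : (Fin n → angles) × (Fin n → angles) =>
        ((seqProd fun i => PA i (w.1 i) : Op K) * (seqProd fun i => PB i (w.2 i) : Op K)) Ψ)) := by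
  have hΨA : Ψ ∈ goodN PA := mem_goodN.2 fun i => (hΨ i).left
  have hΨB : Ψ ∈ goodN PB := mem_goodN.2 fun i => (hΨ i).right
  have hBA : ∀ i j a b, Commute (PB i a) (PA j b) := fun i j a b => (hAB j i b a).symm
  have hcA : ∀ σ i a, Commute (rep PA σ) (PB i a) := fun σ i a =>
    Commute.symm (hA.commute_rep (fun j b => hBA i j a b) σ)
  have hcB : ∀ σ i a, Commute (rep PB σ) (PA i a) := fun σ i a =>
    Commute.symm (hB.commute_rep (fun j b => hAB i j a b) σ)
  have hcAB : ∀ σ τ, Commute (rep PA σ) (rep PB τ) := fun σ τ => hB.commute_rep (hcA σ) τ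
  -- every generator is of the form `σ_A τ_B Ψ` for rank one projections `σ` and `τ`
  have hgen : ∀ w : (Fin n → angles) × (Fin n → angles), ∃ σ τ,
      ((seqProd fun i => PA i (w.1 i) : Op K) * (seqProd fun i => PB i (w.2 i) : Op K)) Ψ =
        rep PA σ (rep PB τ Ψ) := by
    intro w
    refine ⟨Matrix.of fun c d => (∏ i, qubitCoords (w.1 i) (c i)) * ∏ i, qubitCoords (w.1 i) (d i),
      Matrix.of fun c d => (∏ i, qubitCoords (w.2 i) (c i)) * ∏ i, qubitCoords (w.2 i) (d i), ?_⟩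
    rw [op_mul_apply, hB.seqProd_apply_eq_rep hΨB,
      hA.seqProd_apply_eq_rep (apply_mem_goodN (hcB _) hΨA)]
  have hSA : ∀ σ τ, rep PA σ (rep PB τ Ψ) ∈ goodN PA := by
    intro σ τ
    rw [commute_apply (hcAB σ τ), rep_apply_eq hA hB hAB hΨ]
    exact apply_mem_goodN (hcB _) (apply_mem_goodN (hcB _) hΨA)
  have hSB : ∀ σ τ, rep PA σ (rep PB τ Ψ) ∈ goodN PB := by
    intro σ τ
    rw [rep_apply_eq hB hA hBA fun i => (hΨ i).symm]
    exact apply_mem_goodN (hcA _) (apply_mem_goodN (hcA _) hΨB)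
  have hGA : ∀ σ τ, G (rep PA σ (rep PB τ Ψ)) ∈ goodN PA := by
    intro σ τ
    rw [commute_apply (hcAB σ τ), rep_apply_eq hA hB hAB hΨ, commute_apply (hB.commute_rep hG _),
      commute_apply (hB.commute_rep hG _)]
    exact apply_mem_goodN (hcB _) (apply_mem_goodN (hcB _) hgA)
  have hGΨ : inner ℂ (G Ψ) (G Ψ) = inner ℂ Ψ Ψ := by
    rw [← ContinuousLinearMap.adjoint_inner_right, ← ContinuousLinearMap.star_eq_adjoint,
      ← op_mul_apply, (Unitary.mem_iff.1 hGu).1]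
    rfl
  obtain ⟨R, hR⟩ : ∃ R : Uni K, R.1 χ₀ = χ := by
    refine exists_unitary_apply_eq ?_
    have h1 := norm_sq_eq_of_components U hU 1 (by simp) hχ₀
    have h2 := norm_sq_eq_of_components U hU _ (opMatrix_mul_conjTranspose hT) hχ
    rw [hGΨ, h1] at h2
    have h3 : (inner ℂ χ₀ χ₀ : ℂ) = inner ℂ χ χ :=
      mul_left_cancel₀ (Nat.cast_ne_zero.2 Fintype.card_ne_zero) h2
    rw [inner_self_eq_norm_sq_to_K, inner_self_eq_norm_sq_to_K] at h3
    have h4 : ‖χ₀‖ ^ 2 = ‖χ‖ ^ 2 := by exact_mod_cast h3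
    exact (sq_eq_sq₀ (norm_nonneg _) (norm_nonneg _)).1 h4
  refine ⟨subspaceEquiv_of_le_goodN hA hB hAB U hU ?_ ?_,
    subspaceEquiv_of_le_goodN hA hB hAB U hU ?_ ?_, R, ?_⟩
  · rw [Submodule.span_le]
    rintro _ ⟨w, rfl⟩
    obtain ⟨σ, τ, h⟩ := hgen w
    have h' := hSA σ τ
    rw [← h] at h'
    exact h'
  · rw [Submodule.span_le]
    rintro _ ⟨w, rfl⟩
    obtain ⟨σ, τ, h⟩ := hgen w
    have h' := hSB σ τ
    rw [← h] at h'
    exact h'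
  · rw [Submodule.map_span_le]
    rintro _ ⟨w, rfl⟩
    obtain ⟨σ, τ, h⟩ := hgen w
    have h' := hGA σ τ
    rw [← h] at h'
    exact h'
  · rw [Submodule.map_span_le]
    rintro _ ⟨w, rfl⟩
    obtain ⟨σ, τ, h⟩ := hgen w
    have h' := apply_mem_goodN hG (hSB σ τ)
    rw [← h] at h'
    exact h'
  · let o : (Fin n → Fin 2) × (Fin n → Fin 2) := (fun _ => 0, fun _ => 0)
    have hU' : ∀ c d ψ, slice (Equiv.prodComm _ _) (c, d) (U.1 (embed o ψ)) =
        krausN PA c (krausN PB d ψ) := hU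
    intro ψ hψ
    have key : U.1 (embed o (G ψ)) = tensorOp (onLeft T) R.1 (U.1 (embed o ψ)) := by
      -- both sides are linear in `ψ`, so that generators suffice
      let F₁ : Hilb K →ₗ[ℂ] Hilb (((Fin n → Fin 2) × (Fin n → Fin 2)) × K) :=
        (U.1.comp ((embedL K o).comp G)).toLinearMap
      let F₂ : Hilb K →ₗ[ℂ] Hilb (((Fin n → Fin 2) × (Fin n → Fin 2)) × K) :=
        ((tensorOp (onLeft T) R.1).comp (U.1.comp (embedL K o))).toLinearMap
      refine LinearMap.eqOn_span (f := F₁) (g := F₂) ?_ hψ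
      rintro _ ⟨w, rfl⟩
      obtain ⟨σ, τ, h⟩ := hgen w
      simp only [h]
      change U.1 (embed o (G (rep PA σ (rep PB τ Ψ)))) =
        tensorOp (onLeft T) R.1 (U.1 (embed o (rep PA σ (rep PB τ Ψ))))
      refine eq_of_slice_eq (Equiv.prodComm _ _) fun z => ?_
      obtain ⟨x, y⟩ := z
      rw [tensorOp, op_mul_apply, slice_onLeft, hU', krausN_rep_rep hA hB hAB hG hΨ _ hχ]
      have h1 : ∀ x' y', krausN PA x' (krausN PB y' (rep PA σ (rep PB τ Ψ))) =
          (τ * σ.transpose) y' x' • χ₀ := by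
        intro x' y'
        have := krausN_rep_rep hA hB hAB (G := 1) (fun i a => Commute.one_left _) hΨ 1
          (χ := χ₀) hχ₀ σ τ x' y'
        rw [one_apply_op] at this
        rw [this]
        simp [Matrix.one_apply]
      have h2 : ∀ x' y', opMatrix (onLeft T : Op ((Fin n → Fin 2) × (Fin n → Fin 2)))
          (x, y) (x', y') = if y = y' then opMatrix T x x' else 0 := by
        intro x' y'
        rw [opMatrix, onLeft, ampl_apply, slice_single, map_smul, lp.coeFn_smul, Pi.smul_apply]
        by_cases hy : y = y'
        · subst hy
          simp [opMatrix]
        · simp [hy]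
      rw [Fintype.sum_prod_type]
      simp only [slice_onRight, hU', h1, h2, map_smul, hR, ite_mul, zero_mul, ite_smul, zero_smul,
        Finset.sum_ite_eq, Finset.mem_univ, if_true, smul_smul, Finset.sum_smul]
    rw [← key]
    exact (congrArg (fun S : Op _ => S (embed o (G ψ))) (Unitary.mem_iff.1 U.2).1).symm

end Equivalence

/-! ### From the statistics to the components of the product of the gates -/

/-- The statistics of the single gates determine the components of the product of the gates on one
side: they are those of the product of the ideal gates, applied to EPR pairs. -/
theorem exists_krausN_compUpTo_eq {K : Type*} {n t : ℕ} {PA PB : Fin n → ℝ → Op K}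
    (hA : IsSiteFamily PA) (hB : IsSiteFamily PB)
    (hAB : ∀ i j a b, Commute (PA i a) (PB j b)) {I : Fin t → Finset (Fin n)}
    {G H : Fin t → Op K} (hGA : ∀ j, ∀ i ∉ I j, ∀ a, Commute (G j) (PA i a))
    (hGB : ∀ j i a, Commute (G j) (PB i a)) (hHA : ∀ j i a, Commute (H j) (PA i a))
    (hHB : ∀ j, ∀ i ∉ I j, ∀ a, Commute (H j) (PB i a)) (hGH : ∀ j k, Commute (G j) (H k))
    (hH : ∀ j, Function.Injective (H j)) {T : ∀ j, Op (I j → Fin 2)}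
    (hTu : ∀ j, T j ∈ unitary (Op (I j → Fin 2))) (hT : ∀ j, IsRealOp (T j))
    {Ψs : Fin (t + 1) → Hilb K} (hsucc : ∀ j : Fin t, Ψs j.succ = G j (H j (Ψs j.castSucc)))
    (h₁ : ∀ i, IsEPR (PA i) (PB i) (Ψs 0))
    (h₂ : ∀ j : Fin t, ∀ i ∈ I j, IsEPR (PA i) (PB i) (Ψs j.succ))
    (h₃ : ∀ j : Fin t, ∀ a b : I j → angles,
      ‖(subProd (I j) fun i => PA i (a i) : Op K) ((subProd (I j) fun i => PB i (b i) : Op K)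
        (G j (Ψs j.castSucc)))‖ =
      ‖inner ℂ (registerKet (fun i => (a i : ℝ)) fun i => (b i : ℝ))
        (onLeft (T j) (maxEntangled (I j → Fin 2)))‖) :
    compUpTo G (Fin.last t) (Ψs 0) ∈ goodN PA ∧
    ∃ χ, ∀ c d, krausN PA c (krausN PB d (compUpTo G (Fin.last t) (Ψs 0))) =
      opMatrix (compUpTo (fun j => onSubset (α := fun _ => Fin 2) (I j) (T j)) (Fin.last t)) c d •
        χ := by
  have hepr := isEPR_of_gates hGA hGB hHA hHB hsucc h₁ h₂
  have hgoodA : ∀ j, Ψs j ∈ goodN PA := fun j => mem_goodN.2 fun i => (hepr j i).left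
  have hgoodB : ∀ j, Ψs j ∈ goodN PB := fun j => mem_goodN.2 fun i => (hepr j i).right
  have hGgood : ∀ j : Fin t, G j (Ψs j.castSucc) ∈ goodN PA := by
    intro j
    refine mem_goodN_of_apply_mem (hHA j) (hH j) ?_
    rw [← commute_apply (hGH j j), ← hsucc]
    exact hgoodA _
  -- the intertwining relation of a single gate
  have hrel : ∀ j σ, rep PA σ (G j (Ψs j.castSucc)) = G j (rep PA
      ((opMatrix (onSubset (α := fun _ => Fin 2) (I j) (T j))).conjTranspose * σ *
        opMatrix (onSubset (α := fun _ => Fin 2) (I j) (T j))) (Ψs j.castSucc)) := by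
    intro j
    obtain ⟨χ, hχ⟩ := exists_subProd_kraus_eq hA hB hAB (hGgood j)
      (apply_mem_goodN (hGB j) (hgoodB _))
      (fun c d => (opMatrix (T j) c d).re / Real.sqrt (Fintype.card (I j → Fin 2)))
      (fun a b => (h₃ j a b).trans (by rw [inner_registerKet_onLeft _ (hT j)]))
    -- the normalisation of the EPR pairs is absorbed in the vector
    have hχ' : ∀ c d, (subProd (I j) fun i => kraus (PA i) (c i) : Op K)
        ((subProd (I j) fun i => kraus (PB i) (d i) : Op K) (G j (Ψs j.castSucc))) =
        opMatrix (T j) c d • ((1 / Real.sqrt (Fintype.card (I j → Fin 2)) : ℝ) : ℂ) • χ := by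
      intro c d
      have hre : opMatrix (T j) c d = ((opMatrix (T j) c d).re : ℂ) :=
        Complex.ext (Complex.ofReal_re _).symm ((hT j c d).trans (Complex.ofReal_im _).symm)
      rw [hχ, hre, smul_smul, ← Complex.ofReal_mul, mul_one_div, Complex.ofReal_re]
    obtain ⟨χ', hχ''⟩ := exists_krausN_eq hA hB hAB
      (fun i hi => (hepr j.castSucc i).map (hGA j i hi) (hGB j i)) _ hχ'
    rw [← opMatrix_onSubset] at hχ''
    exact rep_gate_apply hA hB hAB (hGB j) (hepr j.castSucc) (hGgood j) _
      (opMatrix_mul_conjTranspose (ampl_mem_unitary _ (hTu j))) hχ''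
  obtain ⟨h1, h2⟩ := rep_compUpTo hA hHA hGH hH _ hsucc hgoodA hrel (Fin.last t)
  exact ⟨h1, exists_krausN_eq_of_rep hA hB hAB
    (fun i a => (commute_compUpTo (fun j => (hGB j i a).symm) _).symm) h₁ h1 _ h2⟩

theorem seqProd_mem_unitary {M : Type*} [Monoid M] [StarMul M] {n : ℕ} {f : Fin n → M}
    (h : ∀ i, f i ∈ unitary M) : seqProd f ∈ unitary M := by
  refine Submonoid.list_prod_mem _ fun y hy => ?_
  obtain ⟨i, rfl⟩ := (List.mem_ofFn' _ _).1 hy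
  exact h i

theorem tensorOp_piOp_mem_unitary {n : ℕ} {α β : Fin n → Type*} {f : ∀ i, Op (α i)}
    {g : ∀ i, Op (β i)} (hf : ∀ i, f i ∈ unitary (Op (α i))) (hg : ∀ i, g i ∈ unitary (Op (β i))) :
    tensorOp (piOp f) (piOp g) ∈ unitary (Op ((∀ i, α i) × (∀ i, β i))) :=
  mul_mem
    (ampl_mem_unitary _ (seqProd_mem_unitary fun i => ampl_mem_unitary _ (hf i)))
    (ampl_mem_unitary _ (seqProd_mem_unitary fun i => ampl_mem_unitary _ (hg i)))

theorem tensorOp_piOp {n : ℕ} {α β : Fin n → Type*} (f : ∀ i, Op (α i)) (g : ∀ i, Op (β i)) :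
    tensorOp (piOp f) (piOp g) = (seqProd fun i => onLeft (onFactor i (f i))) *
      seqProd fun i => onRight (onFactor i (g i)) := by
  rw [tensorOp, onLeft_piOp, onRight_piOp]

end SelfTest

end
theorem mainTheorem2 {n t : ℕ} {α β : Fin n → Type*}
    -- the measurements on the registers `A i = Hilb (α i)` and `B i = Hilb (β i)`
    (PA : ∀ i, ℝ → Op (α i)) (PB : ∀ i, ℝ → Op (β i))
    (hPA : ∀ i, IsMeasurementFamily (PA i)) (hPB : ∀ i, IsMeasurementFamily (PB i))
    -- the physical gates on the registers in `I j`, and the ideal real gates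
    (I : Fin t → Finset (Fin n))
    (GA : ∀ j, Uni (∀ i : I j, α i)) (GB : ∀ j, Uni (∀ i : I j, β i))
    (T : ∀ j, Uni (I j → Fin 2)) (hT : ∀ j, IsRealOp (T j).1)
    -- the initial state and the states after each step
    (Ψ : Hilb ((∀ i, α i) × (∀ i, β i))) (hΨ : ‖Ψ‖ = 1)
    (Ψs : Fin (t + 1) → Hilb ((∀ i, α i) × (∀ i, β i)))
    (hΨs_zero : Ψs 0 = Ψ)
    (hΨs_succ : ∀ j : Fin t, Ψs j.succ =
      tensorOp (onSubset (I j) (GA j).1) (onSubset (I j) (GB j).1) (Ψs j.castSucc))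
    -- the initial state simulates an EPR pair on every pair of registers
    (h₁ : ∀ i, Simulates (W := angles × angles)
      (fun w => tensorOp (onFactor i (PA i w.1)) (onFactor i (PB i w.2)))
      (fun w => pairKet w.1 w.2) Ψ (maxEntangled (Fin 2)))
    -- so does every later state, on the pairs of registers touched by the last gate
    (h₂ : ∀ j : Fin t, ∀ i ∈ I j, Simulates (W := angles × angles)
      (fun w => tensorOp (onFactor i (PA i w.1)) (onFactor i (PB i w.2)))
      (fun w => pairKet w.1 w.2) (Ψs j.succ) (maxEntangled (Fin 2)))
    -- applying only the `A` side of the gate simulates the ideal gate on EPR pairs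
    (h₃ : ∀ j : Fin t, Simulates (W := (I j → angles) × (I j → angles))
      (fun w => tensorOp (piOpOn (I j) fun i => PA i (w.1 i)) (piOpOn (I j) fun i => PB i (w.2 i)))
      (fun w => registerKet (fun i => (w.1 i : ℝ)) (fun i => (w.2 i : ℝ)))
      (onLeft (onSubset (I j) (GA j).1) (Ψs j.castSucc))
      (onLeft (T j).1 (maxEntangled (I j → Fin 2)))) :
    TensorEquiv PA PB
      (onLeft (compUpTo (fun j => onSubset (I j) (GA j).1) (Fin.last t)))
      (onLeft (compUpTo (fun j => onSubset (I j) (T j).1) (Fin.last t)))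
      (Submodule.span ℂ (Set.range fun w : (Fin n → angles) × (Fin n → angles) =>
        tensorOp (piOp fun i => PA i (w.1 i)) (piOp fun i => PB i (w.2 i)) Ψ)) := by
  have hA := isSiteFamily_onLeft (Y := ∀ i, β i) hPA
  have hB := isSiteFamily_onRight (Y := ∀ i, α i) hPB
  have hAB : ∀ i j a b, Commute (onLeft (onFactor i (PA i a)) : Op ((∀ i, α i) × (∀ i, β i)))
      (onRight (onFactor j (PB j b))) := fun i j a b => onLeft_commute_onRight _ _
  have hEPR : ∀ v : Hilb ((∀ i, α i) × (∀ i, β i)), ∀ i, Simulates (W := angles × angles)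
      (fun w => tensorOp (onFactor i (PA i w.1)) (onFactor i (PB i w.2)))
      (fun w => pairKet w.1 w.2) v (maxEntangled (Fin 2)) →
      IsEPR (fun a => onLeft (onFactor i (PA i a))) (fun b => onRight (onFactor i (PB i b))) v :=
    fun v i h => isEPR_of_simulates (hA.meas i) (hB.meas i) (hAB i i) h
  have hΨ₁ := fun i => hEPR Ψ i (h₁ i)
  have hGu : ∀ j, onLeft (onSubset (I j) (GA j).1) ∈ unitary (Op ((∀ i, α i) × (∀ i, β i))) :=
    fun j => ampl_mem_unitary _ (ampl_mem_unitary _ (GA j).2)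
  have hHu : ∀ j, onRight (onSubset (I j) (GB j).1) ∈ unitary (Op ((∀ i, α i) × (∀ i, β i))) :=
    fun j => ampl_mem_unitary _ (ampl_mem_unitary _ (GB j).2)
  obtain ⟨hgood, χ, hχ⟩ := exists_krausN_compUpTo_eq hA hB hAB
    (fun j i hi a => onLeft_commute_onLeft (onSubset_commute_onFactor hi (GA j).1 (PA i a)))
    (fun j i a => onLeft_commute_onRight _ _)
    (fun j i a => (onLeft_commute_onRight _ _).symm)
    (fun j i hi a => onRight_commute_onRight (onSubset_commute_onFactor hi (GB j).1 (PB i a)))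
    (fun j k => onLeft_commute_onRight _ _) (fun j => op_injective_of_mem_unitary (hHu j))
    (fun j => (T j).2) hT (Ψs := Ψs) hΨs_succ (fun i => by rw [hΨs_zero]; exact hΨ₁ i)
    (fun j i hi => hEPR _ i (h₂ j i hi)) fun j a b => by
      have h := h₃ j (a, b)
      simp only [tensorOp, onLeft_piOpOn, onRight_piOpOn] at h
      exact (sq_eq_sq₀ (norm_nonneg _) (norm_nonneg _)).1 h
  -- without any gates, the components of the initial state are those of EPR pairs
  obtain ⟨χ₀, hχ₀⟩ := exists_krausN_eq_of_rep hA hB hAB (G := 1)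
    (fun i a => Commute.one_left _) hΨ₁ (mem_goodN.2 fun i => (hΨ₁ i).left) 1 fun σ => by
      simp
  rw [hΨs_zero] at hgood hχ
  let U : Uni (((Fin n → Fin 2) × (Fin n → Fin 2)) × ((∀ i, α i) × (∀ i, β i))) :=
    ⟨regroupHom α β (tensorOp (piOp fun i => swapOp (PA i)) (piOp fun i => swapOp (PB i))),
      Unitary.map_mem _ (tensorOp_piOp_mem_unitary (fun i => swapOp_mem_unitary (hPA i))
        fun i => swapOp_mem_unitary (hPB i))⟩
  have hU : IsTensorUnitary U := ⟨fun i => ⟨swapOp (PA i), swapOp_mem_unitary (hPA i)⟩,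
    fun i => ⟨swapOp (PB i), swapOp_mem_unitary (hPB i)⟩, rfl⟩
  refine ⟨U, U, hU, hU, ?_⟩
  have hL : ∀ g : Fin t → Op (∀ i, α i),
      (onLeft (compUpTo g (Fin.last t)) : Op ((∀ i, α i) × (∀ i, β i))) =
        compUpTo (fun j => onLeft (g j)) (Fin.last t) := fun g =>
    map_compUpTo (amplHom (Equiv.refl _)) g _
  simp only [tensorOp_piOp, hL]
  exact gateEquiv_of_components hA hB hAB (compUpTo_mem_unitary hGu _)
    (fun i a => (commute_compUpTo (fun j => (onLeft_commute_onRight _ _).symm) _).symm) hΨ₁ hgood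
    U (slice_regroup_swap PA PB)
    (compUpTo_mem_unitary (fun j => ampl_mem_unitary _ (T j).2) _) hχ₀ hχ
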